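/- Let $d \ge 3$ be an integer and $t > 0$. Let $\mathbb T_d$ be the infinite $d$-regular tree (the Bethe lattice) with vertex set $\mathbb V$ and root $0$, let $A$ be its adjacency operator on $\ell^2(\mathbb V)$, let $(g_v)_{v\in\mathbb V}$ be i.i.d. standard Gaussian random variables, and let $V$ be the operator of multiplication by $(g_v)_{v \in \mathbb V}$ on its maximal domain. Let $H_{d,t} = -tA + V$, a self-adjoint operator on the domain of $V$, and let $\mu$ be its (random) projection-valued spectral measure, so that $H_{d,t} = \int \lambda \, d\mu(\lambda)$. Define the spectral measure at the root by $\mu_0(S) = \langle \delta_0, \mu(S)\delta_0\rangle$ and the density of states measure by $\nu(S) = \mathbb E[\mu_0(S)]$, for Borel sets $S \subset \mathbb R$. Then for every $D > 0$ there exists a constant $c = c(d,t,D) > 0$ such that for all intervals $I \subset [-D, D]$, $$\nu(I) \ge c\,|I|,$$ where $|I|$ is the length of $I$. -/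

import Mathlib

open MeasureTheory
open scoped ENNReal

namespace BetheDOS

/-! ### The Bethe lattice -/

/-- Vertices of the `d`-regular rooted tree: words over the alphabet `Fin d` with no two
consecutive letters equal. The empty word is the root; the children of a word `l` are the words
`a :: l`, with `a` different from the first letter of `l`. So the root has `d` children, and any
other vertex has `d - 1` children and one parent (its tail). -/
abbrev Vertex (d : ℕ) : Type := {l : List (Fin d) // l.IsChain (· ≠ ·)}

/-- The root of the tree: the empty word. -/
def root (d : ℕ) : Vertex d := ⟨[], List.isChain_nil⟩

/-- The Bethe lattice, i.e. the `d`-regular tree: two words are adjacent iff one of them arises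
from the other by prepending a letter. -/
def betheLattice (d : ℕ) : SimpleGraph (Vertex d) where
  Adj u v := (∃ a, u.1 = a :: v.1) ∨ (∃ a, v.1 = a :: u.1)
  symm := ⟨fun _ _ h => h.symm⟩
  loopless := ⟨by
    rintro u (⟨a, h⟩ | ⟨a, h⟩) <;> simpa using congrArg List.length h⟩

/-- The vertex reached from `u` along the edge with label `a`. -/
def step {d : ℕ} (u : Vertex d) (a : Fin d) : Vertex d :=
  if h : u.1.head? = some a then ⟨u.1.tail, u.2.tail⟩
  else ⟨a :: u.1, by
    refine List.isChain_cons.2 ⟨?_, u.2⟩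
    rintro y hy rfl
    exact h hy⟩

theorem step_injective {d : ℕ} (u : Vertex d) : Function.Injective (step u) := by
  intro a b hab
  have h := congrArg Subtype.val hab
  have hl := congrArg List.length h
  by_cases h1 : u.1.head? = some a <;> by_cases h2 : u.1.head? = some b
  · exact Option.some_injective _ (h1.symm.trans h2)
  · rw [step, step, dif_pos h1, dif_neg h2, List.length_tail, List.length_cons] at hl
    omega
  · rw [step, step, dif_neg h1, dif_pos h2, List.length_tail, List.length_cons] at hl
    omega
  · simpa [step, h1, h2] using h

theorem betheLattice_neighborSet {d : ℕ} (u : Vertex d) :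
    (betheLattice d).neighborSet u = Set.range (step u) := by
  ext v
  rw [SimpleGraph.mem_neighborSet, Set.mem_range]
  constructor
  · rintro (⟨a, h⟩ | ⟨a, h⟩)
    · exact ⟨a, Subtype.ext (by simp [step, h])⟩
    · have hv := v.2
      rw [h, List.isChain_cons] at hv
      have hne : u.1.head? ≠ some a := fun h' => hv.1 a h' rfl
      exact ⟨a, Subtype.ext (by simp [step, hne, h])⟩
  · rintro ⟨a, rfl⟩
    by_cases h : u.1.head? = some a
    · left
      obtain ⟨l, hl⟩ := List.head?_eq_some_iff.1 h
      exact ⟨a, by simp [step, hl]⟩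
    · right
      exact ⟨a, by simp [step, h]⟩

noncomputable instance betheLatticeLocallyFinite (d : ℕ) : (betheLattice d).LocallyFinite := fun u =>
  ((betheLattice_neighborSet u) ▸ Set.finite_range (step u) :
    ((betheLattice d).neighborSet u).Finite).fintype

theorem betheLattice_regular (d : ℕ) : (betheLattice d).IsRegularOfDegree d := by
  intro u
  rw [← SimpleGraph.card_neighborSet_eq_degree, ← Nat.card_eq_fintype_card,
    betheLattice_neighborSet, Nat.card_range_of_injective (step_injective u), Nat.card_fin]

/-! ### The Anderson Hamiltonian -/

/-- The complex Hilbert space `ℓ²(V)`. -/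
abbrev L2 (V : Type*) : Type _ := lp (fun _ : V => ℂ) 2

section Adjacency

variable {V : Type*} (G : SimpleGraph V) [G.LocallyFinite]

theorem sum_neighbors_le {d : ℕ} (hG : ∀ v, G.degree v ≤ d) {f : V → ℝ} (hf0 : ∀ v, 0 ≤ f v)
    (hf : Summable f) (s : Finset V) :
    ∑ v ∈ s, ∑ w ∈ G.neighborFinset v, f w ≤ d * ∑' w, f w := by
  classical
  rw [Finset.sum_comm' (t' := s.biUnion fun v => G.neighborFinset v)
    (s' := fun w => s.filter fun v => w ∈ G.neighborFinset v)]
  · calc _ ≤ ∑ w ∈ s.biUnion fun v => G.neighborFinset v, d * f w := by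
          refine Finset.sum_le_sum fun w _ => ?_
          rw [Finset.sum_const, nsmul_eq_mul]
          refine mul_le_mul_of_nonneg_right ?_ (hf0 w)
          have : (s.filter fun v => w ∈ G.neighborFinset v) ⊆ G.neighborFinset w := by
            intro v hv
            simpa [SimpleGraph.adj_comm] using (Finset.mem_filter.1 hv).2
          exact_mod_cast (Finset.card_le_card this).trans (hG w)
      _ ≤ d * ∑' w, f w := by
          rw [← Finset.mul_sum]
          exact mul_le_mul_of_nonneg_left (hf.sum_le_tsum _ fun w _ => hf0 w) (Nat.cast_nonneg d)
  · intro v w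
    simp only [Finset.mem_filter, Finset.mem_biUnion]
    constructor
    · rintro ⟨hv, hw⟩
      exact ⟨⟨hv, hw⟩, v, hv, hw⟩
    · rintro ⟨⟨hv, hw⟩, -⟩
      exact ⟨hv, hw⟩

theorem sum_adjacency_le {d : ℕ} (hG : ∀ v, G.degree v ≤ d) (ψ : L2 V) (s : Finset V) :
    ∑ v ∈ s, ‖∑ w ∈ G.neighborFinset v, ψ w‖ ^ (2 : ℝ≥0∞).toReal
      ≤ (d * ‖ψ‖) ^ (2 : ℝ≥0∞).toReal := by
  have h2 : (0 : ℝ) < (2 : ℝ≥0∞).toReal := by norm_num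
  have hs := (lp.memℓp ψ).summable h2
  have hn := lp.norm_rpow_eq_tsum h2 ψ
  simp only [ENNReal.toReal_ofNat, Real.rpow_ofNat] at hs hn ⊢
  calc _ ≤ ∑ v ∈ s, ∑ w ∈ G.neighborFinset v, d * ‖ψ w‖ ^ 2 := by
        refine Finset.sum_le_sum fun v _ => ?_
        calc _ ≤ (∑ w ∈ G.neighborFinset v, ‖ψ w‖) ^ 2 := by
              gcongr
              exact norm_sum_le _ _
          _ ≤ (G.neighborFinset v).card * ∑ w ∈ G.neighborFinset v, ‖ψ w‖ ^ 2 :=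
              sq_sum_le_card_mul_sum_sq
          _ ≤ d * ∑ w ∈ G.neighborFinset v, ‖ψ w‖ ^ 2 := by
              gcongr
              exact hG v
          _ = _ := Finset.mul_sum _ _ _
    _ ≤ d * ∑' w, d * ‖ψ w‖ ^ 2 :=
        sum_neighbors_le G hG (fun v => by positivity) (hs.mul_left _) s
    _ = (d * ‖ψ‖) ^ 2 := by
        rw [tsum_mul_left, mul_pow, hn]
        ring

/-- The adjacency operator of a graph with degrees at most `d`, as a bounded operator on `ℓ²(V)`:
`(A ψ)(v) = ∑_{w ∼ v} ψ(w)`. -/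
noncomputable def adjacencyOperator {d : ℕ} (hG : ∀ v, G.degree v ≤ d) : L2 V →L[ℂ] L2 V :=
  LinearMap.mkContinuous
    { toFun := fun ψ =>
        ⟨fun v => ∑ w ∈ G.neighborFinset v, ψ w, memℓp_gen' (sum_adjacency_le G hG ψ)⟩
      map_add' := fun φ ψ => by
        ext v
        exact Finset.sum_add_distrib (f := fun w => φ w) (g := fun w => ψ w)
      map_smul' := fun c ψ => by
        ext v
        simp [Finset.mul_sum] }
    d
    (fun ψ => lp.norm_le_of_forall_sum_le (by norm_num) (by positivity)
      (sum_adjacency_le G hG ψ))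

end Adjacency

/-- The operator of multiplication by a real function `g` on `ℓ²(V)`, on its maximal domain
`{ψ ∈ ℓ²(V) : g ψ ∈ ℓ²(V)}`. -/
noncomputable def potential {V : Type*} (g : V → ℝ) : L2 V →ₗ.[ℂ] L2 V where
  domain :=
    { carrier := {ψ | Memℓp (fun v => (g v : ℂ) * ψ v) 2}
      add_mem' := fun {φ ψ} hφ hψ => by
        have h := hφ.add hψ
        have e : (fun v => (g v : ℂ) * (φ + ψ : L2 V) v)
            = (fun v => (g v : ℂ) * φ v) + fun v => (g v : ℂ) * ψ v := by
          ext v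
          simp [mul_add]
        change Memℓp _ 2
        rw [e]
        exact h
      zero_mem' := by
        have e : (fun v => (g v : ℂ) * (0 : L2 V) v) = 0 := by
          ext v
          simp
        change Memℓp _ 2
        rw [e]
        exact zero_memℓp
      smul_mem' := fun c ψ hψ => by
        have h := hψ.const_smul c
        have e : (fun v => (g v : ℂ) * (c • ψ : L2 V) v) = c • fun v => (g v : ℂ) * ψ v := by
          ext v
          simp [mul_left_comm]
        change Memℓp _ 2
        rw [e]
        exact h }
  toFun :=
    { toFun := fun ψ => ⟨fun v => (g v : ℂ) * ψ.1 v, ψ.2⟩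
      map_add' := fun φ ψ => by
        ext v
        exact mul_add (g v : ℂ) (φ.1 v) (ψ.1 v)
      map_smul' := fun c ψ => by
        ext v
        simp [mul_left_comm] }

/-- The Anderson Hamiltonian `H_{d,t} = -t A + V` on the Bethe lattice for the realization `g` of
the potential, an unbounded operator on `ℓ²` whose domain is that of `V`. -/
noncomputable def hamiltonian (d : ℕ) (t : ℝ) (g : Vertex d → ℝ) :
    L2 (Vertex d) →ₗ.[ℂ] L2 (Vertex d) :=
  (-(t : ℂ) • (adjacencyOperator (betheLattice d)
    fun v => (betheLattice_regular d v).le).toLinearMap) +ᵥ potential g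

/-! ### Projection-valued measures and the spectral resolution -/

section Spectral

variable {E : Type*} [NormedAddCommGroup E] [InnerProductSpace ℂ E] [CompleteSpace E]

variable (E) in
/-- A projection-valued measure on the Borel sets of `ℝ`: orthogonal projections, countably additive
in the strong sense, with total mass the identity. (Only the values on Borel sets matter.) -/
structure ProjectionValuedMeasure where
  /-- The projection attached to a set. -/
  proj : Set ℝ → E →L[ℂ] E
  isStarProjection : ∀ S, MeasurableSet S → IsStarProjection (proj S)
  proj_univ : proj Set.univ = 1
  hasSum_iUnion : ∀ S : ℕ → Set ℝ, (∀ n, MeasurableSet (S n)) →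
    Pairwise (Function.onFun Disjoint S) →
    ∀ ψ, HasSum (fun n => proj (S n) ψ) (proj (⋃ n, S n) ψ)

namespace ProjectionValuedMeasure

variable (P : ProjectionValuedMeasure E)

theorem proj_empty (ψ : E) : P.proj ∅ ψ = 0 := by
  have h := P.hasSum_iUnion (fun _ => ∅) (fun _ => MeasurableSet.empty)
    (fun _ _ _ => disjoint_bot_left) ψ
  exact tendsto_nhds_unique tendsto_const_nhds h.summable.tendsto_atTop_zero

theorem re_inner_proj_nonneg {S : Set ℝ} (hS : MeasurableSet S) (ψ : E) :
    0 ≤ (inner ℂ ψ (P.proj S ψ)).re := by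
  have h := P.isStarProjection S hS
  have h1 : P.proj S (P.proj S ψ) = P.proj S ψ :=
    congrArg (fun T : E →L[ℂ] E => T ψ) h.isIdempotentElem.eq
  have h2 : inner ℂ ψ (P.proj S ψ) = inner ℂ (P.proj S ψ) (P.proj S ψ) := by
    have h3 := h.isSelfAdjoint.isSymmetric ψ (P.proj S ψ)
    simp only [ContinuousLinearMap.coe_coe] at h3
    rw [h3, h1]
  rw [h2]
  exact inner_self_nonneg (𝕜 := ℂ)

/-- The spectral measure `S ↦ ⟨ψ, P(S) ψ⟩` of a vector `ψ`. -/
noncomputable def scalarMeasure (ψ : E) : Measure ℝ :=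
  Measure.ofMeasurable (fun S _ => ENNReal.ofReal (inner ℂ ψ (P.proj S ψ)).re)
    (by simp [P.proj_empty ψ])
    (fun S hS hd => by
      have h := (Complex.reCLM.hasSum ((innerSL ℂ ψ).hasSum (P.hasSum_iUnion S hS hd ψ)))
      simp only [innerSL_apply_apply, Complex.reCLM_apply] at h
      rw [← h.tsum_eq]
      exact ENNReal.ofReal_tsum_of_nonneg (fun n => P.re_inner_proj_nonneg (hS n) ψ) h.summable)

/-- `T = ∫ λ dP(λ)`: the domain of `T` is `{ψ : ∫ λ² d⟨ψ, P(λ) ψ⟩ < ∞}`, and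
`⟨ψ, T ψ⟩ = ∫ λ d⟨ψ, P(λ) ψ⟩` for all `ψ` in it (on a complex Hilbert space this quadratic form
determines `T`, by polarization). -/
def Resolves (T : E →ₗ.[ℂ] E) : Prop :=
  (∀ ψ : E, ψ ∈ T.domain ↔ Integrable (fun x : ℝ => x ^ 2) (P.scalarMeasure ψ)) ∧
    ∀ ψ : T.domain, inner ℂ (ψ : E) (T ψ) = ((∫ x, x ∂(P.scalarMeasure (ψ : E)) : ℝ) : ℂ)

end ProjectionValuedMeasure

open Classical in
/-- The spectral measure `S ↦ ⟨ψ, μ(S) ψ⟩` of the operator `T` at the vector `ψ`, for the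
projection-valued measure `μ` with `T = ∫ λ dμ(λ)`, which exists and is unique on Borel sets when
`T` is self-adjoint. (The zero measure if there is no such `μ`.) -/
noncomputable def spectralMeasure (T : E →ₗ.[ℂ] E) (ψ : E) : Measure ℝ :=
  if h : ∃ P : ProjectionValuedMeasure E, P.Resolves T then h.choose.scalarMeasure ψ else 0

end Spectral

/-! ### The density of states -/

open Classical in
/-- The spectral measure `μ₀(S) = ⟨δ₀, μ(S) δ₀⟩` of the Hamiltonian at the root. -/
noncomputable def rootSpectralMeasure (d : ℕ) (t : ℝ) (g : Vertex d → ℝ) : Measure ℝ :=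
  spectralMeasure (hamiltonian d t g) (lp.single 2 (root d) (1 : ℂ))

/-- The law of an i.i.d. family of standard Gaussian variables indexed by the vertices. -/
noncomputable def potentialLaw (d : ℕ) : Measure (Vertex d → ℝ) :=
  Measure.infinitePi fun _ => ProbabilityTheory.gaussianReal 0 1

/-- The density of states measure `ν(S) = 𝔼[μ₀(S)]`. -/
noncomputable def densityOfStates (d : ℕ) (t : ℝ) : Measure ℝ :=
  (potentialLaw d).bind (rootSpectralMeasure d t)

end BetheDOS

/-!
For the potential `g` let `G(z) = ⟨δ₀, (H - z)⁻¹ δ₀⟩` be the Green function at the root. Its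
imaginary part at `z = l + i η` is the Poisson integral of the spectral measure at the root, so by
Stieltjes inversion a lower bound `c ≤ 𝔼[Im G(l + i η)]`, uniform in `|l| ≤ D` and `0 < η ≤ 1`,
gives `ν(I) ≥ (c / π) |I|` for intervals `I ⊆ [-D, D]` (`mul_volume_le_of_poisson`).

The lower bound comes from the randomness at the root and at its neighbours only. Removing the root
leaves `d` branches, and `G = 1 / (g₀ - w)` with `w = z + t² ∑ F_i`, where `F_i` is the Green
function of the branch `i` at its root (`rootGreen_mul`). Here `w` lies in the upper half-plane and
does not depend on the potential `g₀` at the root (`branchGreen_update_root`), so the average of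
`Im G` over `g₀` is the Gaussian average of a Poisson kernel with pole `w`, which is bounded below
as long as `w` is bounded (`le_lintegral_poisson_gaussianReal`). To bound `w`, note that `1 / F_i`
is shifted by `s - g_i` when the potential `g_i` at the root of the branch is replaced by `s`
(`inv_green_update`). As the Gaussian density is bounded, `|F_i| > M` has probability at most
`2 / M`, whatever `z` is (`potentialLaw_lt_norm_branchGreen_le`); so with probability at least one half
all `F_i` are bounded by `4 d`, uniformly in `η`.

Three facts make these objects meaningful. The Hamiltonian has a spectral resolution
(`spectralResolution_resolves`): the continuous functional calculus of the normal operator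
`(T - i)⁻¹` gives scalar measures by the Riesz representation theorem, these give projections, and
`r ↦ Re (1 / r)` transports them to the real line. For every resolution, the Stieltjes transform of the
spectral measure is the matrix element of the resolvent (`inner_resolvent_eq_integral`); the proof
uses the isometry of `L²` of the spectral measure onto the cyclic subspace. Finally the spectral
measure at the root is a measurable function of the potential (`measurable_rootSpectralMeasure`),
since the resolvent is strongly continuous in the potential (`continuous_schroedingerResolvent`)
and the measure is recovered from its Poisson integrals by limits
(`measurable_of_measurable_poisson`).
-/

namespace BetheDOS

open Filter Topology

/-! ### Resolvents of unbounded self-adjoint operators -/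

section Resolvent

variable {E : Type*} [NormedAddCommGroup E] [InnerProductSpace ℂ E]

/-- Self-adjointness of an unbounded operator, in the form of the range criterion: `T` is symmetric
and `T - z` is onto for every non-real `z`. (Density of the domain follows.) Mathlib's
`LinearPMap` adjoint is not used; this form yields the resolvents directly. -/
structure IsSelfAdjointPMap (T : E →ₗ.[ℂ] E) : Prop where
  symm : ∀ x y : T.domain, inner ℂ (T x) (y : E) = inner ℂ (x : E) (T y)
  surj : ∀ z : ℂ, z.im ≠ 0 → ∀ φ : E, ∃ x : T.domain, T x - z • (x : E) = φ

namespace IsSelfAdjointPMap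

variable {T : E →ₗ.[ℂ] E}

theorem im_inner_self_eq_zero (h : ∀ x y : T.domain, inner ℂ (T x) (y : E) = inner ℂ (x : E) (T y))
    (x : T.domain) : (inner ℂ (x : E) (T x)).im = 0 := by
  have h1 := h x x
  rw [← inner_conj_symm] at h1
  have h2 := congrArg Complex.im h1
  rw [Complex.conj_im] at h2
  linarith

/-- The a priori bound `|Im z| ‖x‖ ≤ ‖(T - z) x‖` for a symmetric operator. -/
theorem abs_im_mul_norm_le
    (h : ∀ x y : T.domain, inner ℂ (T x) (y : E) = inner ℂ (x : E) (T y)) (z : ℂ) (x : T.domain) :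
    |z.im| * ‖(x : E)‖ ≤ ‖T x - z • (x : E)‖ := by
  have h1 : (inner ℂ (x : E) (T x - z • (x : E))).im = -(z.im * ‖(x : E)‖ ^ 2) := by
    rw [inner_sub_right, inner_smul_right, inner_self_eq_norm_sq_to_K, Complex.sub_im,
      im_inner_self_eq_zero h]
    have h4 : (z * ((‖(x : E)‖ : ℝ) : ℂ) ^ 2).im = z.im * ‖(x : E)‖ ^ 2 := by
      rw [← Complex.ofReal_pow]
      simp [Complex.mul_im, -Complex.ofReal_pow]
    rw [zero_sub, ← h4]
    rfl
  have h2 : |z.im| * ‖(x : E)‖ ^ 2 ≤ ‖(x : E)‖ * ‖T x - z • (x : E)‖ := by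
    calc |z.im| * ‖(x : E)‖ ^ 2 = |(inner ℂ (x : E) (T x - z • (x : E))).im| := by
          rw [h1, abs_neg, abs_mul, abs_of_nonneg (sq_nonneg ‖(x : E)‖)]
      _ ≤ ‖inner ℂ (x : E) (T x - z • (x : E))‖ := Complex.abs_im_le_norm _
      _ ≤ _ := norm_inner_le_norm _ _
  rcases (norm_nonneg (x : E)).eq_or_lt with h3 | h3
  · rw [← h3]
    simp
  · refine le_of_mul_le_mul_left ?_ h3
    nlinarith

theorem eq_of_sub_smul_eq (h : IsSelfAdjointPMap T) {z : ℂ} (hz : z.im ≠ 0) {x y : T.domain}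
    (hxy : T x - z • (x : E) = T y - z • (y : E)) : x = y := by
  have h1 := abs_im_mul_norm_le h.symm z (x - y)
  have h2 : T (x - y) - z • ((x - y : T.domain) : E) = 0 := by
    rw [LinearPMap.map_sub, AddSubgroupClass.coe_sub, smul_sub]
    rw [← sub_eq_zero] at hxy
    rw [← hxy]
    abel
  rw [h2, norm_zero] at h1
  have h3 : ‖((x - y : T.domain) : E)‖ = 0 := by
    have := abs_pos.2 hz
    nlinarith [norm_nonneg ((x - y : T.domain) : E)]
  exact sub_eq_zero.1 (Subtype.ext (norm_eq_zero.1 h3))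

/-- The solution `x` of `(T - z) x = φ`. -/
noncomputable def solve (h : IsSelfAdjointPMap T) {z : ℂ} (hz : z.im ≠ 0) (φ : E) : T.domain :=
  (h.surj z hz φ).choose

theorem solve_spec (h : IsSelfAdjointPMap T) {z : ℂ} (hz : z.im ≠ 0) (φ : E) :
    T (h.solve hz φ) - z • (h.solve hz φ : E) = φ :=
  (h.surj z hz φ).choose_spec

/-- The resolvent `(T - z)⁻¹` as a bounded operator. -/
noncomputable def resolvent (h : IsSelfAdjointPMap T) {z : ℂ} (hz : z.im ≠ 0) : E →L[ℂ] E :=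
  LinearMap.mkContinuous
    { toFun := fun φ => h.solve hz φ
      map_add' := fun φ χ => by
        rw [← Submodule.coe_add]
        congr 1
        apply h.eq_of_sub_smul_eq hz
        rw [h.solve_spec, LinearPMap.map_add, Submodule.coe_add, smul_add, add_sub_add_comm,
          h.solve_spec, h.solve_spec]
      map_smul' := fun c φ => by
        rw [RingHom.id_apply, ← Submodule.coe_smul]
        congr 1
        apply h.eq_of_sub_smul_eq hz
        rw [h.solve_spec, LinearPMap.map_smul, Submodule.coe_smul, smul_comm z c, ← smul_sub,
          h.solve_spec] }
    |z.im|⁻¹ (fun φ => by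
      have h1 := abs_im_mul_norm_le h.symm z (h.solve hz φ)
      rw [h.solve_spec] at h1
      rw [inv_mul_eq_div, le_div_iff₀ (abs_pos.2 hz), mul_comm]
      exact h1)

variable (h : IsSelfAdjointPMap T) {z : ℂ} (hz : z.im ≠ 0)

theorem resolvent_mem (φ : E) : h.resolvent hz φ ∈ T.domain := (h.solve hz φ).2

theorem apply_resolvent (φ : E) :
    T ⟨h.resolvent hz φ, h.resolvent_mem hz φ⟩ = φ + z • h.resolvent hz φ :=
  sub_eq_iff_eq_add.1 (h.solve_spec hz φ)

theorem resolvent_eq {x : T.domain} {φ : E} (hx : T x = φ + z • (x : E)) :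
    h.resolvent hz φ = x := by
  have : (⟨h.resolvent hz φ, h.resolvent_mem hz φ⟩ : T.domain) = x := by
    apply h.eq_of_sub_smul_eq hz
    rw [h.apply_resolvent, hx, add_sub_cancel_right, add_sub_cancel_right]
  exact congrArg Subtype.val this

theorem resolvent_injective : Function.Injective (h.resolvent hz) := by
  intro φ χ e
  have h1 := h.apply_resolvent hz φ
  have h2 := h.apply_resolvent hz χ
  have h3 : (⟨h.resolvent hz φ, h.resolvent_mem hz φ⟩ : T.domain)
      = ⟨h.resolvent hz χ, h.resolvent_mem hz χ⟩ := Subtype.ext e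
  rw [h3, h2, e] at h1
  exact (add_right_cancel h1).symm

theorem norm_resolvent_apply_le (φ : E) : ‖h.resolvent hz φ‖ ≤ |z.im|⁻¹ * ‖φ‖ := by
  have h1 := abs_im_mul_norm_le h.symm z ⟨h.resolvent hz φ, h.resolvent_mem hz φ⟩
  rw [h.apply_resolvent, add_sub_cancel_right] at h1
  rw [inv_mul_eq_div, le_div_iff₀ (abs_pos.2 hz), mul_comm]
  exact h1

/-- The adjoint of `(T - z)⁻¹` is `(T - z̄)⁻¹`. -/
theorem inner_resolvent_left {w : ℂ} (hw : w.im ≠ 0) (hzw : w = (starRingEnd ℂ) z) (φ χ : E) :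
    inner ℂ (h.resolvent hz φ) χ = inner ℂ φ (h.resolvent hw χ) := by
  have h1 := h.symm ⟨h.resolvent hz φ, h.resolvent_mem hz φ⟩
    ⟨h.resolvent hw χ, h.resolvent_mem hw χ⟩
  rw [h.apply_resolvent, h.apply_resolvent, inner_add_left, inner_add_right, inner_smul_left,
    inner_smul_right, ← hzw] at h1
  exact (add_right_cancel h1).symm

/-- The resolvent identity. -/
theorem resolvent_sub_resolvent {w : ℂ} (hw : w.im ≠ 0) (φ : E) :
    h.resolvent hz φ - h.resolvent hw φ = (z - w) • h.resolvent hz (h.resolvent hw φ) := by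
  have h1 := h.resolvent_eq hz (x := ⟨h.resolvent hw φ, h.resolvent_mem hw φ⟩)
    (φ := φ - (z - w) • h.resolvent hw φ) (by rw [h.apply_resolvent, sub_smul]; abel)
  rw [map_sub, map_smul] at h1
  rw [sub_eq_iff_eq_add, add_comm, ← sub_eq_iff_eq_add]
  exact h1

/-- `Im ⟨φ, (T - z)⁻¹ φ⟩ = Im z ‖(T - z)⁻¹ φ‖²`. -/
theorem im_inner_resolvent (φ : E) :
    (inner ℂ φ (h.resolvent hz φ)).im = z.im * ‖h.resolvent hz φ‖ ^ 2 := by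
  have h1 := h.apply_resolvent hz φ
  have h2 := im_inner_self_eq_zero h.symm ⟨h.resolvent hz φ, h.resolvent_mem hz φ⟩
  rw [h1, inner_add_right, inner_smul_right, inner_self_eq_norm_sq_to_K, Complex.add_im] at h2
  have h3 : (inner ℂ φ (h.resolvent hz φ)).im = -(inner ℂ (h.resolvent hz φ) φ).im := by
    rw [← inner_conj_symm, Complex.conj_im]
  have h4 : (z * ((‖h.resolvent hz φ‖ : ℝ) : ℂ) ^ 2).im = z.im * ‖h.resolvent hz φ‖ ^ 2 := by
    rw [← Complex.ofReal_pow]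
    simp [Complex.mul_im, -Complex.ofReal_pow]
  rw [h3]
  have h5 : (inner ℂ (h.resolvent hz φ) φ).im + z.im * ‖h.resolvent hz φ‖ ^ 2 = 0 := by
    rw [← h4]
    exact h2
  linarith

end IsSelfAdjointPMap

end Resolvent

/-! ### Projections from scalar spectral measures -/

section Projections

variable {E : Type*} [NormedAddCommGroup E] [InnerProductSpace ℂ E] [CompleteSpace E]

theorem isStarProjection_of_inner_eq_norm_sq {P : E →L[ℂ] E}
    (h : ∀ ψ, inner ℂ ψ (P ψ) = ((‖P ψ‖ ^ 2 : ℝ) : ℂ)) : IsStarProjection P := by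
  have hsymm : P.toLinearMap.IsSymmetric := by
    rw [LinearMap.isSymmetric_iff_inner_map_self_real]
    intro ψ
    have e : inner ℂ (P ψ) ψ = ((‖P ψ‖ ^ 2 : ℝ) : ℂ) := by
      rw [← inner_conj_symm, h, Complex.conj_ofReal]
    change (starRingEnd ℂ) (inner ℂ (P ψ) ψ) = inner ℂ (P ψ) ψ
    rw [e, Complex.conj_ofReal]
  have hP : (P * P).toLinearMap = P.toLinearMap := by
    rw [← ext_inner_map]
    intro ψ
    have e1 : inner ℂ (P (P ψ)) ψ = inner ℂ (P ψ) (P ψ) := hsymm (P ψ) ψ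
    have e2 : inner ℂ (P ψ) ψ = inner ℂ ψ (P ψ) := hsymm ψ ψ
    change inner ℂ (P (P ψ)) ψ = inner ℂ (P ψ) ψ
    rw [e1, e2, h, inner_self_eq_norm_sq_to_K]
    simp
  exact ⟨ContinuousLinearMap.coe_injective hP,
    ContinuousLinearMap.isSelfAdjoint_iff_isSymmetric.2 hsymm⟩

variable {X : Type*} [MeasurableSpace X]

/-- `P` is the spectral projection of the set `S` for the family `M` of scalar spectral measures:
`⟨ψ, P ψ⟩ = M ψ S` for all `ψ`, and `P` is a projection, which is encoded by `‖P ψ‖² = M ψ S`.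
The two conditions pass to strong limits, and they determine `P`. -/
structure IsSpectralProjection (M : E → Measure X) (S : Set X) (P : E →L[ℂ] E) : Prop where
  inner_self : ∀ ψ, inner ℂ ψ (P ψ) = (((M ψ).real S : ℝ) : ℂ)
  norm_sq : ∀ ψ, ‖P ψ‖ ^ 2 = (M ψ).real S

namespace IsSpectralProjection

variable {M : E → Measure X} {S S' : Set X} {P Q : E →L[ℂ] E}

theorem isStarProjection (h : IsSpectralProjection M S P) : IsStarProjection P :=
  isStarProjection_of_inner_eq_norm_sq fun ψ => by rw [h.inner_self, h.norm_sq]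

theorem inner_left (h : IsSpectralProjection M S P) (φ ψ : E) :
    inner ℂ (P φ) ψ = inner ℂ φ (P ψ) :=
  h.isStarProjection.isSelfAdjoint.isSymmetric φ ψ

theorem apply_apply (h : IsSpectralProjection M S P) (ψ : E) : P (P ψ) = P ψ :=
  congrArg (fun T : E →L[ℂ] E => T ψ) h.isStarProjection.isIdempotentElem.eq

omit [CompleteSpace E] in
theorem empty : IsSpectralProjection M ∅ 0 := ⟨fun ψ => by simp, fun ψ => by simp⟩

omit [InnerProductSpace ℂ E] [CompleteSpace E] in
theorem finite_of_univ (hM : ∀ ψ, M ψ Set.univ = ENNReal.ofReal (‖ψ‖ ^ 2)) (ψ : E) :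
    IsFiniteMeasure (M ψ) := ⟨by rw [hM]; exact ENNReal.ofReal_lt_top⟩

omit [InnerProductSpace ℂ E] [CompleteSpace E] in
theorem real_univ (hM : ∀ ψ, M ψ Set.univ = ENNReal.ofReal (‖ψ‖ ^ 2)) (ψ : E) :
    (M ψ).real Set.univ = ‖ψ‖ ^ 2 := by
  rw [measureReal_def, hM, ENNReal.toReal_ofReal (sq_nonneg _)]

/-- A strong limit of operators whose quadratic forms and squared norms converge to `M ψ S` is the
spectral projection of `S`. -/
theorem of_tendsto {ι : Type*} {l : Filter ι} [l.NeBot] [l.IsCountablyGenerated]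
    {P : ι → E →L[ℂ] E} {L : E → E} (hL : ∀ ψ, Tendsto (fun n => P n ψ) l (𝓝 (L ψ)))
    (h1 : ∀ ψ, Tendsto (fun n => inner ℂ ψ (P n ψ)) l (𝓝 (((M ψ).real S : ℝ) : ℂ)))
    (h2 : ∀ ψ, Tendsto (fun n => ‖P n ψ‖ ^ 2) l (𝓝 ((M ψ).real S))) :
    ∃ Q, IsSpectralProjection M S Q := by
  refine ⟨continuousLinearMapOfTendsto P (tendsto_pi_nhds.2 hL), fun ψ => ?_, fun ψ => ?_⟩
  · exact tendsto_nhds_unique (((continuous_const.inner continuous_id).tendsto (L ψ)).comp (hL ψ))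
      (h1 ψ)
  · exact tendsto_nhds_unique ((continuous_norm.pow 2).tendsto (L ψ) |>.comp (hL ψ)) (h2 ψ)

variable (hM : ∀ ψ, M ψ Set.univ = ENNReal.ofReal (‖ψ‖ ^ 2))

include hM

omit [CompleteSpace E] in
theorem compl (hS : MeasurableSet S) (h : IsSpectralProjection M S P) :
    IsSpectralProjection M Sᶜ (1 - P) := by
  have hf := finite_of_univ hM
  constructor
  · intro ψ
    have e := measureReal_compl (μ := M ψ) hS
    rw [real_univ hM] at e
    rw [e]
    change inner ℂ ψ (ψ - P ψ) = _
    rw [inner_sub_right, h.inner_self, inner_self_eq_norm_sq_to_K]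
    push_cast
    rfl
  · intro ψ
    have e := measureReal_compl (μ := M ψ) hS
    rw [real_univ hM] at e
    rw [e]
    change ‖ψ - P ψ‖ ^ 2 = _
    rw [@_root_.norm_sub_sq ℂ, h.inner_self, h.norm_sq]
    simp only [RCLike.re_to_complex, Complex.ofReal_re]
    ring

/-- Spectral projections of disjoint sets annihilate each other: on the range of `P` the measure
`M (P ψ)` already has full mass on `S`. -/
theorem apply_apply_of_disjoint (hS' : MeasurableSet S')
    (h : IsSpectralProjection M S P) (h' : IsSpectralProjection M S' Q) (hd : Disjoint S S')
    (ψ : E) : Q (P ψ) = 0 := by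
  have hf := finite_of_univ hM
  have h1 : (M (P ψ)).real (S ∪ S') ≤ ‖P ψ‖ ^ 2 := by
    rw [← real_univ hM]
    exact measureReal_mono (Set.subset_univ _)
  rw [measureReal_union hd hS', ← h.norm_sq, ← h'.norm_sq, h.apply_apply] at h1
  have h2 : ‖Q (P ψ)‖ ^ 2 ≤ 0 := by linarith
  exact norm_eq_zero.1 (pow_eq_zero_iff two_ne_zero |>.1 (le_antisymm h2 (sq_nonneg _)))

theorem union (hS' : MeasurableSet S') (h : IsSpectralProjection M S P)
    (h' : IsSpectralProjection M S' Q) (hd : Disjoint S S') :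
    IsSpectralProjection M (S ∪ S') (P + Q) := by
  have hf := finite_of_univ hM
  constructor
  · intro ψ
    rw [measureReal_union hd hS']
    change inner ℂ ψ (P ψ + Q ψ) = _
    rw [inner_add_right, h.inner_self, h'.inner_self]
    push_cast
    rfl
  · intro ψ
    rw [measureReal_union hd hS']
    change ‖P ψ + Q ψ‖ ^ 2 = _
    have e : inner ℂ (P ψ) (Q ψ) = 0 := by
      rw [← h'.inner_left, apply_apply_of_disjoint hM hS' h h' hd, inner_zero_left]
    rw [@norm_add_sq ℂ, e, h.norm_sq, h'.norm_sq]
    simp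

theorem sum {S : ℕ → Set X} (hS : ∀ n, MeasurableSet (S n))
    (hd : Pairwise (Function.onFun Disjoint S)) {P : ℕ → E →L[ℂ] E}
    (h : ∀ n, IsSpectralProjection M (S n) (P n)) (F : Finset ℕ) :
    IsSpectralProjection M (⋃ n ∈ F, S n) (∑ n ∈ F, P n) := by
  classical
  induction F using Finset.induction_on with
  | empty => simpa using empty
  | insert a F ha ih =>
    rw [Finset.sum_insert ha, Finset.set_biUnion_insert]
    refine union hM (Finset.measurableSet_biUnion _ fun n _ => hS n) (h a) ih ?_
    rw [Set.disjoint_iUnion₂_right]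
    intro n hn
    exact hd (fun e => ha (e ▸ hn))

/-- Differences of nested spectral projections are controlled by the measure of the difference set,
which turns convergence of measures into strong convergence of projections. -/
theorem norm_sub_sq (hS' : MeasurableSet S') (hSS : S ⊆ S')
    (h : IsSpectralProjection M S P) (h' : IsSpectralProjection M S' Q) (ψ : E) :
    ‖Q ψ - P ψ‖ ^ 2 = (M ψ).real S' - (M ψ).real S := by
  have hf := finite_of_univ hM
  have e : Q (P ψ) = P ψ := by
    have e1 := apply_apply_of_disjoint hM hS'.compl h (compl hM hS' h')
      (Set.disjoint_compl_right_iff_subset.2 hSS) ψ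
    exact (sub_eq_zero.1 e1).symm
  have e2 : inner ℂ (Q ψ) (P ψ) = (((M ψ).real S : ℝ) : ℂ) := by
    rw [h'.inner_left, e, h.inner_self]
  rw [@_root_.norm_sub_sq ℂ, e2, h.norm_sq, h'.norm_sq]
  simp only [RCLike.re_to_complex, Complex.ofReal_re]
  ring

omit [InnerProductSpace ℂ E] [CompleteSpace E] in
theorem tendsto_measureReal_biUnion {S : ℕ → Set X} (hS : ∀ n, MeasurableSet (S n))
    (hd : Pairwise (Function.onFun Disjoint S)) (ψ : E) :
    Tendsto (fun F : Finset ℕ => (M ψ).real (⋃ n ∈ F, S n)) atTop (𝓝 ((M ψ).real (⋃ n, S n))) := by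
  have hf := finite_of_univ hM
  have h1 : HasSum (fun n => M ψ (S n)) (M ψ (⋃ n, S n)) := by
    rw [measure_iUnion hd hS]
    exact ENNReal.summable.hasSum
  have h2 := (ENNReal.tendsto_toReal (measure_ne_top (M ψ) (⋃ n, S n))).comp h1
  refine h2.congr fun F => ?_
  rw [measureReal_def, measure_biUnion_finset (fun i _ j _ hij => hd hij) fun n _ => hS n]
  rfl

/-- Countable additivity in the strong sense. -/
theorem hasSum {S : ℕ → Set X} (hS : ∀ n, MeasurableSet (S n))
    (hd : Pairwise (Function.onFun Disjoint S)) {P : ℕ → E →L[ℂ] E}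
    (h : ∀ n, IsSpectralProjection M (S n) (P n)) (hQ : IsSpectralProjection M (⋃ n, S n) Q)
    (ψ : E) : HasSum (fun n => P n ψ) (Q ψ) := by
  have h1 : Tendsto (fun F : Finset ℕ => ‖Q ψ - ∑ n ∈ F, P n ψ‖ ^ 2) atTop (𝓝 0) := by
    have h2 := (tendsto_measureReal_biUnion hM hS hd ψ).const_sub ((M ψ).real (⋃ n, S n))
    rw [sub_self] at h2
    refine h2.congr fun F => ?_
    have h3 := norm_sub_sq hM
      (MeasurableSet.iUnion hS) (Set.iUnion₂_subset_iUnion _ _) (sum hM hS hd h F) hQ ψ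
    rw [← h3, sum_apply]
  have h4 : Tendsto (fun F : Finset ℕ => ‖∑ n ∈ F, P n ψ - Q ψ‖) atTop (𝓝 0) := by
    have h5 := h1.sqrt
    rw [Real.sqrt_zero] at h5
    refine h5.congr fun F => ?_
    rw [Real.sqrt_sq (norm_nonneg _), norm_sub_rev]
  exact tendsto_iff_norm_sub_tendsto_zero.2 h4

/-- The sets that have a spectral projection are closed under countable disjoint unions. -/
theorem exists_iUnion {S : ℕ → Set X} (hS : ∀ n, MeasurableSet (S n))
    (hd : Pairwise (Function.onFun Disjoint S)) {P : ℕ → E →L[ℂ] E}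
    (h : ∀ n, IsSpectralProjection M (S n) (P n)) :
    ∃ Q, IsSpectralProjection M (⋃ n, S n) Q := by
  have hF := fun N => sum hM hS hd h (Finset.range N)
  have ht := fun ψ => (tendsto_measureReal_biUnion hM hS hd ψ).comp tendsto_finset_range
  have hc : ∀ ψ, ∃ u, Tendsto (fun N => (∑ n ∈ Finset.range N, P n) ψ) atTop (𝓝 u) := by
    intro ψ
    refine cauchySeq_tendsto_of_complete ?_
    have hcr := (ht ψ).cauchySeq
    rw [Metric.cauchySeq_iff'] at hcr ⊢
    intro ε hε
    obtain ⟨N, hN⟩ := hcr (ε ^ 2) (by positivity)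
    refine ⟨N, fun n hn => ?_⟩
    have h3 := norm_sub_sq hM (Finset.measurableSet_biUnion _ fun n _ => hS n)
      (Set.biUnion_subset_biUnion_left fun k hk => Finset.range_mono hn hk) (hF N) (hF n) ψ
    have h4 := hN n hn
    rw [Real.dist_eq] at h4
    rw [dist_eq_norm]
    refine lt_of_pow_lt_pow_left₀ 2 hε.le ?_
    rw [h3]
    exact (le_abs_self _).trans_lt h4
  choose L hL using hc
  refine of_tendsto hL (fun ψ => ?_) (fun ψ => ?_)
  · refine ((Complex.continuous_ofReal.tendsto _).comp (ht ψ)).congr fun N => ?_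
    exact ((hF N).inner_self ψ).symm
  · exact (ht ψ).congr fun N => ((hF N).norm_sq ψ).symm

end IsSpectralProjection

end Projections

/-! ### Spectral measures of a continuous functional calculus -/

section ContinuousCalculus

variable {E : Type*} [NormedAddCommGroup E] [InnerProductSpace ℂ E] [CompleteSpace E]
variable {X : Type*} [TopologicalSpace X] [CompactSpace X] [MeasurableSpace X] [BorelSpace X]
variable (Φ : C(X, ℂ) →⋆ₐ[ℂ] (E →L[ℂ] E))

omit [CompactSpace X] [MeasurableSpace X] [BorelSpace X] in
theorem inner_starAlgHom_left (f : C(X, ℂ)) (φ ψ : E) :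
    inner ℂ (Φ f φ) ψ = inner ℂ φ (Φ (star f) ψ) := by
  rw [map_star, ContinuousLinearMap.star_eq_adjoint, ContinuousLinearMap.adjoint_inner_right]

/-- A real function on `X` regarded as a complex one. -/
def complexify (f : C(X, ℝ)) : C(X, ℂ) := ⟨fun x => (f x : ℂ), by fun_prop⟩

omit [CompactSpace X] [MeasurableSpace X] [BorelSpace X] in
theorem inner_complexify_mul_self (f : C(X, ℝ)) (ψ : E) :
    inner ℂ ψ (Φ (complexify (f * f)) ψ) = ((‖Φ (complexify f) ψ‖ ^ 2 : ℝ) : ℂ) := by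
  have e : complexify (f * f) = star (complexify f) * complexify f := by
    ext x
    simp [complexify]
  rw [e, map_mul]
  change inner ℂ ψ (Φ (star (complexify f)) (Φ (complexify f) ψ)) = _
  rw [← inner_starAlgHom_left, inner_self_eq_norm_sq_to_K]
  simp

/-- The positive functional `f ↦ ⟨ψ, Φ(f) ψ⟩`. -/
noncomputable def spectralFunctional (ψ : E) : CompactlySupportedContinuousMap X ℝ →ₚ[ℝ] ℝ :=
  PositiveLinearMap.mk₀
    { toFun := fun f => (inner ℂ ψ (Φ (complexify f.1) ψ)).re
      map_add' := fun f g => by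
        have e : complexify (f + g).1 = complexify f.1 + complexify g.1 := by
          ext x
          simp [complexify]
        rw [e, map_add]
        change (inner ℂ ψ (Φ (complexify f.1) ψ + Φ (complexify g.1) ψ)).re = _
        rw [inner_add_right, Complex.add_re]
      map_smul' := fun c f => by
        have e : complexify (c • f).1 = (c : ℂ) • complexify f.1 := by
          ext x
          simp [complexify]
        rw [e, map_smul]
        change (inner ℂ ψ ((c : ℂ) • Φ (complexify f.1) ψ)).re = _
        rw [inner_smul_right, Complex.re_ofReal_mul]
        rfl }
    (fun f hf => by
      -- positivity: `f` is the square of `√f`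
      have e : f.1 = (⟨fun x => Real.sqrt (f x), by fun_prop⟩ : C(X, ℝ)) *
          ⟨fun x => Real.sqrt (f x), by fun_prop⟩ := by
        ext x
        exact (Real.mul_self_sqrt (hf x)).symm
      change 0 ≤ (inner ℂ ψ (Φ (complexify f.1) ψ)).re
      rw [e, inner_complexify_mul_self, Complex.ofReal_re]
      positivity)

variable [T2Space X]

/-- The scalar spectral measure of `ψ`, given by the Riesz representation theorem. -/
noncomputable def calculusMeasure (ψ : E) : Measure X :=
  RealRMK.rieszMeasure (spectralFunctional Φ ψ)

instance (ψ : E) : IsFiniteMeasure (calculusMeasure Φ ψ) := by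
  unfold calculusMeasure
  infer_instance

theorem integrable_calculusMeasure (ψ : E) {F : Type*} [NormedAddCommGroup F] (f : C(X, F)) :
    Integrable f (calculusMeasure Φ ψ) :=
  f.continuous.integrable_of_hasCompactSupport (HasCompactSupport.of_compactSpace f)

theorem integrable_norm_sq (ψ : E) (f : C(X, ℂ)) :
    Integrable (fun x => ‖f x‖ ^ 2) (calculusMeasure Φ ψ) :=
  (f.continuous.norm.pow 2).integrable_of_hasCompactSupport (HasCompactSupport.of_compactSpace _)

theorem integral_complexify (ψ : E) (f : C(X, ℝ)) :
    ∫ x, f x ∂(calculusMeasure Φ ψ) = (inner ℂ ψ (Φ (complexify f) ψ)).re :=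
  RealRMK.integral_rieszMeasure (spectralFunctional Φ ψ)
    (CompactlySupportedContinuousMap.continuousMapEquiv f)

theorem inner_calculus (ψ : E) (f : C(X, ℂ)) :
    inner ℂ ψ (Φ f ψ) = ∫ x, f x ∂(calculusMeasure Φ ψ) := by
  have hreal : ∀ g : C(X, ℝ), inner ℂ ψ (Φ (complexify g) ψ)
      = ((∫ x, g x ∂(calculusMeasure Φ ψ) : ℝ) : ℂ) := by
    intro g
    rw [integral_complexify]
    refine Complex.ext rfl ?_
    rw [Complex.ofReal_im]
    have e : inner ℂ ψ (Φ (complexify g) ψ) = (starRingEnd ℂ) (inner ℂ ψ (Φ (complexify g) ψ)) := by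
      rw [inner_conj_symm, inner_starAlgHom_left]
      congr 3
      ext x
      simp [complexify]
    have e2 := congrArg Complex.im e
    rw [Complex.conj_im] at e2
    linarith
  have e : f = complexify ⟨fun x => (f x).re, by fun_prop⟩
      + Complex.I • complexify ⟨fun x => (f x).im, by fun_prop⟩ := by
    ext x
    simp [complexify, mul_comm Complex.I]
  have hi := integral_re_add_im (integrable_calculusMeasure Φ ψ f)
  rw [← hi]
  conv_lhs => rw [e, map_add, map_smul]
  change inner ℂ ψ (Φ _ ψ + Complex.I • Φ _ ψ) = _
  rw [inner_add_right, inner_smul_right, hreal, hreal, mul_comm]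
  rfl

theorem norm_calculus_sq (ψ : E) (f : C(X, ℂ)) :
    ‖Φ f ψ‖ ^ 2 = ∫ x, ‖f x‖ ^ 2 ∂(calculusMeasure Φ ψ) := by
  have h1 : inner ℂ ψ (Φ (star f * f) ψ) = ((‖Φ f ψ‖ ^ 2 : ℝ) : ℂ) := by
    rw [map_mul]
    change inner ℂ ψ (Φ (star f) (Φ f ψ)) = _
    rw [← inner_starAlgHom_left, inner_self_eq_norm_sq_to_K]
    simp
  rw [inner_calculus] at h1
  have h2 : ∫ x, (star f * f) x ∂(calculusMeasure Φ ψ)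
      = ((∫ x, ‖f x‖ ^ 2 ∂(calculusMeasure Φ ψ) : ℝ) : ℂ) := by
    rw [← integral_complex_ofReal]
    congr 1
    ext x
    simp [Complex.conj_mul']
  exact Complex.ofReal_injective (h1.symm.trans h2)

theorem calculusMeasure_univ (ψ : E) :
    calculusMeasure Φ ψ Set.univ = ENNReal.ofReal (‖ψ‖ ^ 2) := by
  have h := norm_calculus_sq Φ ψ 1
  rw [map_one] at h
  simp only [ContinuousMap.one_apply, norm_one, one_pow, integral_const, smul_eq_mul,
    mul_one] at h
  rw [← ofReal_measureReal (measure_ne_top _ _), ← h]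
  rfl

omit [CompleteSpace E] in
theorem norm_sub_sq_le_two_mul_add {F : Type*} [SeminormedAddCommGroup F] (a b c : F) :
    ‖a - b‖ ^ 2 ≤ 2 * ‖a - c‖ ^ 2 + 2 * ‖b - c‖ ^ 2 := by
  have h1 : ‖a - b‖ ≤ ‖a - c‖ + ‖b - c‖ := by
    rw [← sub_sub_sub_cancel_right a b c]
    exact norm_sub_le _ _
  have h2 := pow_le_pow_left₀ (norm_nonneg _) h1 2
  nlinarith [sq_nonneg (‖a - c‖ - ‖b - c‖)]

/-- If `f n → F` in `L²` of the scalar spectral measure of `ψ`, then `Φ(f n) ψ` converges. -/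
theorem exists_tendsto_calculus (ψ : E) {f : ℕ → C(X, ℂ)} {F : X → ℂ}
    (hi : ∀ n, Integrable (fun x => ‖f n x - F x‖ ^ 2) (calculusMeasure Φ ψ))
    (h : Tendsto (fun n => ∫ x, ‖f n x - F x‖ ^ 2 ∂(calculusMeasure Φ ψ)) atTop (𝓝 0)) :
    ∃ u, Tendsto (fun n => Φ (f n) ψ) atTop (𝓝 u) := by
  refine cauchySeq_tendsto_of_complete (Metric.cauchySeq_iff.2 fun ε hε => ?_)
  obtain ⟨N, hN⟩ := eventually_atTop.1 (h.eventually_lt_const (show 0 < ε ^ 2 / 4 by positivity))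
  refine ⟨N, fun m hm n hn => ?_⟩
  rw [dist_eq_norm]
  refine lt_of_pow_lt_pow_left₀ 2 hε.le ?_
  have e : Φ (f m) ψ - Φ (f n) ψ = Φ (f m - f n) ψ := by
    rw [map_sub]
    rfl
  rw [e, norm_calculus_sq]
  calc ∫ x, ‖(f m - f n) x‖ ^ 2 ∂(calculusMeasure Φ ψ)
      ≤ ∫ x, (2 * ‖f m x - F x‖ ^ 2 + 2 * ‖f n x - F x‖ ^ 2) ∂(calculusMeasure Φ ψ) := by
        refine integral_mono ?_ (((hi m).const_mul 2).add ((hi n).const_mul 2)) fun x => ?_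
        · exact integrable_norm_sq Φ ψ (f m - f n)
        · exact norm_sub_sq_le_two_mul_add (f m x) (f n x) (F x)
    _ = 2 * ∫ x, ‖f m x - F x‖ ^ 2 ∂(calculusMeasure Φ ψ)
        + 2 * ∫ x, ‖f n x - F x‖ ^ 2 ∂(calculusMeasure Φ ψ) := by
        rw [integral_add ((hi m).const_mul 2) ((hi n).const_mul 2), integral_const_mul,
          integral_const_mul]
    _ < ε ^ 2 := by
        have h1 := hN m hm
        have h2 := hN n hn
        linarith

/-- A closed set has a spectral projection: approximate its indicator function from above by
continuous functions. -/
theorem exists_isSpectralProjection_of_isClosed [HasOuterApproxClosed X] {S : Set X}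
    (hS : IsClosed S) : ∃ P, IsSpectralProjection (calculusMeasure Φ) S P := by
  let f : ℕ → C(X, ℂ) := fun n => ⟨fun x => ((hS.apprSeq n x : ℝ) : ℂ), by fun_prop⟩
  have hlim : ∀ x, Tendsto (fun n => f n x) atTop (𝓝 (S.indicator 1 x)) := by
    intro x
    have h1 := tendsto_pi_nhds.1 (HasOuterApproxClosed.tendsto_apprSeq hS) x
    have h2 := ((Complex.continuous_ofReal.comp NNReal.continuous_coe).tendsto _).comp h1
    have h3 : S.indicator (1 : X → ℂ) x
        = (Complex.ofReal ∘ NNReal.toReal) (S.indicator (fun _ => 1) x) := by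
      by_cases hx : x ∈ S <;> simp [hx]
    rw [h3]
    exact h2
  have hle : ∀ n x, ‖f n x‖ ≤ 1 := by
    intro n x
    change ‖((hS.apprSeq n x : ℝ) : ℂ)‖ ≤ 1
    rw [Complex.norm_real, Real.norm_of_nonneg (NNReal.coe_nonneg _)]
    exact_mod_cast HasOuterApproxClosed.apprSeq_apply_le_one hS n x
  have hind : ∀ x, ‖S.indicator (1 : X → ℂ) x‖ ≤ 1 := fun x => by
    by_cases hx : x ∈ S <;> simp [hx]
  have hindm : Measurable (S.indicator (1 : X → ℂ)) := measurable_one.indicator hS.measurableSet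
  have hdm : ∀ n, Measurable fun x => ‖f n x - S.indicator 1 x‖ ^ 2 := fun n =>
    ((f n).continuous.measurable.sub hindm).norm.pow_const 2
  have hdle : ∀ n x, ‖‖f n x - S.indicator 1 x‖ ^ 2‖ ≤ 4 := by
    intro n x
    rw [Real.norm_of_nonneg (sq_nonneg _)]
    have h1 : ‖f n x - S.indicator 1 x‖ ≤ 2 := by
      calc _ ≤ ‖f n x‖ + ‖S.indicator (1 : X → ℂ) x‖ := norm_sub_le _ _
        _ ≤ 2 := by linarith [hle n x, hind x]
    nlinarith [norm_nonneg (f n x - S.indicator 1 x)]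
  have hc : ∀ ψ, ∃ u, Tendsto (fun n => Φ (f n) ψ) atTop (𝓝 u) := by
    intro ψ
    refine exists_tendsto_calculus Φ ψ (F := S.indicator 1)
      (fun n => Integrable.of_bound (hdm n).aestronglyMeasurable 4
        (Eventually.of_forall (hdle n))) ?_
    have h1 := tendsto_integral_of_dominated_convergence (μ := calculusMeasure Φ ψ)
      (F := fun n x => ‖f n x - S.indicator 1 x‖ ^ 2) (f := fun _ => 0) (fun _ => (4 : ℝ))
      (fun n => (hdm n).aestronglyMeasurable) (integrable_const _)
      (fun n => Eventually.of_forall (hdle n))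
      (Eventually.of_forall fun x => by
        have h2 := (tendsto_iff_norm_sub_tendsto_zero.1 (hlim x)).pow 2
        rwa [zero_pow two_ne_zero] at h2)
    rwa [integral_zero] at h1
  choose L hL using hc
  refine IsSpectralProjection.of_tendsto hL (fun ψ => ?_) (fun ψ => ?_)
  · have h1 := tendsto_integral_of_dominated_convergence (μ := calculusMeasure Φ ψ)
      (F := fun n x => f n x) (f := S.indicator 1) (fun _ => (1 : ℝ))
      (fun n => (f n).continuous.aestronglyMeasurable) (integrable_const _)
      (fun n => Eventually.of_forall (hle n)) (Eventually.of_forall hlim)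
    have h2 : ∫ x, S.indicator (1 : X → ℂ) x ∂(calculusMeasure Φ ψ)
        = (((calculusMeasure Φ ψ).real S : ℝ) : ℂ) := by
      rw [integral_indicator hS.measurableSet]
      simp
    rw [h2] at h1
    exact h1.congr fun n => (inner_calculus Φ ψ (f n)).symm
  · have h1 := tendsto_integral_of_dominated_convergence (μ := calculusMeasure Φ ψ)
      (F := fun n x => ‖f n x‖ ^ 2) (f := S.indicator 1) (fun _ => (1 : ℝ))
      (fun n => ((f n).continuous.norm.pow 2).aestronglyMeasurable) (integrable_const _)
      (fun n => Eventually.of_forall fun x => by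
        rw [Real.norm_of_nonneg (sq_nonneg _)]
        exact pow_le_one₀ (norm_nonneg _) (hle n x))
      (Eventually.of_forall fun x => by
        have h2 := (hlim x).norm.pow 2
        convert h2 using 2
        by_cases hx : x ∈ S <;> simp [hx])
    rw [integral_indicator_one hS.measurableSet] at h1
    exact h1.congr fun n => (norm_calculus_sq Φ ψ (f n)).symm

/-- Every Borel set has a spectral projection, by the `π`-`λ` theorem. -/
theorem exists_isSpectralProjection [HasOuterApproxClosed X] {S : Set X} (hS : MeasurableSet S) :
    ∃ P, IsSpectralProjection (calculusMeasure Φ) S P := by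
  have hM := calculusMeasure_univ Φ
  refine MeasurableSpace.induction_on_inter
    (C := fun S _ => ∃ P, IsSpectralProjection (calculusMeasure Φ) S P)
    (BorelSpace.measurable_eq.trans borel_eq_generateFrom_isClosed) isPiSystem_isClosed
    ⟨0, IsSpectralProjection.empty⟩ (fun t ht => exists_isSpectralProjection_of_isClosed Φ ht)
    ?_ ?_ S hS
  · rintro t ht ⟨P, hP⟩
    exact ⟨1 - P, hP.compl hM ht⟩
  · intro f hd hf ih
    choose P hP using ih
    exact IsSpectralProjection.exists_iUnion hM hf hd hP

end ContinuousCalculus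

/-! ### Existence of the spectral resolution -/

section ContinuousCalculus

variable {E : Type*} [NormedAddCommGroup E] [InnerProductSpace ℂ E] [CompleteSpace E]
variable {X : Type*} [TopologicalSpace X] [CompactSpace X] [MeasurableSpace X] [BorelSpace X]
  [T2Space X] [HasOuterApproxClosed X]
variable (Φ : C(X, ℂ) →⋆ₐ[ℂ] (E →L[ℂ] E))

/-- The scalar spectral measure of `Φ(g) φ` is `|g|²` times that of `φ`. -/
theorem calculusMeasure_apply (g : C(X, ℂ)) (φ : E) :
    calculusMeasure Φ (Φ g φ)
      = (calculusMeasure Φ φ).withDensity fun x => ENNReal.ofReal (‖g x‖ ^ 2) := by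
  have hfin : IsFiniteMeasure
      ((calculusMeasure Φ φ).withDensity fun x => ENNReal.ofReal (‖g x‖ ^ 2)) :=
    isFiniteMeasure_withDensity_ofReal (integrable_norm_sq Φ φ g).2
  refine ext_of_forall_integral_eq_of_IsFiniteMeasure fun f => ?_
  have h1 := integral_complexify Φ (Φ g φ) f.toContinuousMap
  have h2 := integral_complexify Φ φ (⟨fun x => ‖g x‖ ^ 2 * f x, by fun_prop⟩ : C(X, ℝ))
  have e : complexify (⟨fun x => ‖g x‖ ^ 2 * f x, by fun_prop⟩ : C(X, ℝ))
      = star g * complexify f.toContinuousMap * g := by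
    ext x
    simp only [complexify, ContinuousMap.coe_mk, ContinuousMap.mul_apply, ContinuousMap.star_apply,
      RCLike.star_def, Complex.ofReal_mul, Complex.ofReal_pow]
    rw [mul_right_comm, Complex.conj_mul']
    rfl
  have e2 : inner ℂ (Φ g φ) (Φ (complexify f.toContinuousMap) (Φ g φ))
      = inner ℂ φ (Φ (star g * complexify f.toContinuousMap * g) φ) := by
    rw [inner_starAlgHom_left, map_mul, map_mul]
    rfl
  rw [e2, ← e, ← h2] at h1
  have h3 := integral_withDensity_eq_integral_smul (μ := calculusMeasure Φ φ)
    (f := fun x => Real.toNNReal (‖g x‖ ^ 2)) (by fun_prop) (fun x => f x)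
  refine h1.trans (Eq.trans ?_ h3.symm)
  congr 1
  ext x
  rw [NNReal.smul_def, Real.coe_toNNReal _ (sq_nonneg _)]
  rfl

/-- If `Φ(g)` is injective then the zero set of `g` is a null set of every spectral measure. -/
theorem calculusMeasure_zero_set {g : C(X, ℂ)} (hg : Function.Injective (Φ g)) (ψ : E) :
    calculusMeasure Φ ψ {x | g x = 0} = 0 := by
  have hS : MeasurableSet {x | g x = 0} :=
    (isClosed_singleton.preimage g.continuous).measurableSet
  obtain ⟨P, hP⟩ := exists_isSpectralProjection Φ hS
  -- the projection `P` onto the zero set satisfies `Φ(g) P = 0`, so `P = 0`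
  have h1 : (calculusMeasure Φ (P ψ)).real {x | g x = 0}ᶜ = 0 := by
    rw [measureReal_compl hS, IsSpectralProjection.real_univ (calculusMeasure_univ Φ),
      ← hP.norm_sq, hP.apply_apply, sub_self]
  have h2 : ‖Φ g (P ψ)‖ ^ 2 = 0 := by
    rw [norm_calculus_sq]
    refine integral_eq_zero_of_ae ?_
    rw [measureReal_eq_zero_iff] at h1
    filter_upwards [mem_ae_iff.2 ((compl_compl {x | g x = 0}).symm ▸ h1 :
      calculusMeasure Φ (P ψ) {x | g x = 0}ᶜ = 0)] with x hx
    have hx' : g x = 0 := hx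
    simp [hx']
  have h3 : P ψ = 0 := by
    apply hg
    rw [map_zero]
    exact norm_eq_zero.1 (pow_eq_zero_iff two_ne_zero |>.1 h2)
  rw [← measureReal_eq_zero_iff, ← hP.norm_sq, h3]
  simp

end ContinuousCalculus

section Existence

variable {E : Type*} [NormedAddCommGroup E] [InnerProductSpace ℂ E] [CompleteSpace E]

theorem ProjectionValuedMeasure.scalarMeasure_apply (P : ProjectionValuedMeasure E) (ψ : E)
    {S : Set ℝ} (hS : MeasurableSet S) :
    P.scalarMeasure ψ S = ENNReal.ofReal (inner ℂ ψ (P.proj S ψ)).re :=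
  Measure.ofMeasurable_apply S hS

variable {T : E →ₗ.[ℂ] E} (h : IsSelfAdjointPMap T)

/-- The resolvent `(T - i)⁻¹`. -/
noncomputable def resolventI : E →L[ℂ] E := h.resolvent (z := Complex.I) (by simp)

theorem star_resolventI_apply (φ : E) :
    star (resolventI h) φ = h.resolvent (z := -Complex.I) (by simp) φ := by
  refine ext_inner_left ℂ fun χ => ?_
  rw [ContinuousLinearMap.star_eq_adjoint, ContinuousLinearMap.adjoint_inner_right]
  exact h.inner_resolvent_left (by simp) (by simp) (by simp) χ φ

theorem resolventI_sub_star :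
    resolventI h - star (resolventI h)
      = (2 * Complex.I) • (resolventI h * star (resolventI h)) := by
  ext φ
  have h1 := h.resolvent_sub_resolvent (z := Complex.I) (by simp) (w := -Complex.I) (by simp) φ
  rw [sub_neg_eq_add, ← two_mul] at h1
  change resolventI h φ - star (resolventI h) φ
    = (2 * Complex.I) • resolventI h (star (resolventI h) φ)
  rw [star_resolventI_apply]
  exact h1

theorem isStarNormal_resolventI : IsStarNormal (resolventI h) := by
  constructor
  ext φ
  have h1 := h.resolvent_sub_resolvent (z := Complex.I) (by simp) (w := -Complex.I) (by simp) φ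
  have h2 := h.resolvent_sub_resolvent (z := -Complex.I) (by simp) (w := Complex.I) (by simp) φ
  change star (resolventI h) (resolventI h φ) = resolventI h (star (resolventI h) φ)
  rw [star_resolventI_apply, star_resolventI_apply]
  rw [← neg_sub, h1, ← neg_smul] at h2
  have h3 : -(Complex.I - -Complex.I) ≠ 0 := by
    rw [sub_neg_eq_add, ← two_mul]
    simp
  rw [show -Complex.I - Complex.I = -(Complex.I - -Complex.I) by ring] at h2
  exact (smul_right_injective E h3 h2).symm

/-- The continuous functional calculus of the resolvent. -/
noncomputable def resolventCalculus : C(spectrum ℂ (resolventI h), ℂ) →⋆ₐ[ℂ] (E →L[ℂ] E) :=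
  cfcHom (R := ℂ) (isStarNormal_resolventI h)

/-- The coordinate function on the spectrum of the resolvent. -/
def resolventCoord : C(spectrum ℂ (resolventI h), ℂ) := ⟨Subtype.val, continuous_subtype_val⟩

theorem resolventCalculus_coord : resolventCalculus h (resolventCoord h) = resolventI h :=
  cfcHom_id (R := ℂ) (isStarNormal_resolventI h)

instance : CompactSpace (spectrum ℂ (resolventI h)) :=
  isCompact_iff_compactSpace.1 (spectrum.isCompact _)

/-- The spectrum of `(T - i)⁻¹` lies on the circle `Im r = |r|²`, the image of the real line. -/
theorem im_eq_norm_sq (x : spectrum ℂ (resolventI h)) : (x : ℂ).im = ‖(x : ℂ)‖ ^ 2 := by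
  have h1 : resolventCoord h - star (resolventCoord h)
      = (2 * Complex.I) • (resolventCoord h * star (resolventCoord h)) := by
    apply cfcHom_injective (R := ℂ) (isStarNormal_resolventI h)
    change resolventCalculus h _ = resolventCalculus h _
    rw [map_sub, map_star, map_smul, map_mul, map_star, resolventCalculus_coord,
      resolventI_sub_star]
  have h2 := congrArg Complex.im (DFunLike.congr_fun h1 x)
  simp only [resolventCoord, ContinuousMap.sub_apply, ContinuousMap.coe_mk,
    ContinuousMap.star_apply, ContinuousMap.smul_apply, ContinuousMap.mul_apply,
    RCLike.star_def, Complex.mul_conj', smul_eq_mul] at h2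
  rw [← Complex.ofReal_pow, Complex.im_mul_ofReal] at h2
  simp at h2
  linarith

/-- The spectral variable of `T` as a function of that of its resolvent: `r ↦ Re (1 / r)`.
It has the junk value `0` at `r = 0`, the image of infinity, which is a null set of every scalar
spectral measure. -/
noncomputable def energy (x : spectrum ℂ (resolventI h)) : ℝ := (x : ℂ).re / ‖(x : ℂ)‖ ^ 2

omit [CompleteSpace E] in
theorem measurable_energy : Measurable (energy h) := by
  unfold energy
  fun_prop

omit [CompleteSpace E] in
theorem energy_mul_norm_sq (x : spectrum ℂ (resolventI h)) :
    energy h x * ‖(x : ℂ)‖ ^ 2 = (x : ℂ).re := by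
  unfold energy
  rcases eq_or_ne (x : ℂ) 0 with hx | hx
  · simp [hx]
  · exact div_mul_cancel₀ _ (by simpa using hx)

omit [CompleteSpace E] in
theorem energy_sq_mul_norm_sq_le (x : spectrum ℂ (resolventI h)) :
    energy h x ^ 2 * ‖(x : ℂ)‖ ^ 2 ≤ 1 := by
  rcases eq_or_ne (x : ℂ) 0 with hx | hx
  · simp [hx]
  · have h1 : 0 < ‖(x : ℂ)‖ ^ 2 := by positivity
    unfold energy
    rw [div_pow, div_mul_eq_mul_div, div_le_one (by positivity), sq (‖(x : ℂ)‖ ^ 2)]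
    refine mul_le_mul_of_nonneg_right ?_ h1.le
    rw [← sq_abs]
    exact pow_le_pow_left₀ (abs_nonneg _) (Complex.abs_re_le_norm _) 2

theorem norm_inv_sq_le (x : spectrum ℂ (resolventI h)) :
    ‖(x : ℂ)⁻¹‖ ^ 2 ≤ energy h x ^ 2 + 1 := by
  rcases eq_or_ne (x : ℂ) 0 with hx | hx
  · rw [hx, inv_zero, norm_zero, zero_pow two_ne_zero]
    positivity
  · have h1 : 0 < ‖(x : ℂ)‖ ^ 2 := by positivity
    have h2 : ‖(x : ℂ)‖ ^ 2 = (x : ℂ).re ^ 2 + (x : ℂ).im ^ 2 := by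
      rw [← Complex.normSq_eq_norm_sq, Complex.normSq_apply]
      ring
    refine le_of_mul_le_mul_right ?_ h1
    rw [norm_inv, inv_pow, inv_mul_cancel₀ h1.ne', add_mul, sq (energy h x), mul_assoc,
      energy_mul_norm_sq, one_mul]
    refine le_of_mul_le_mul_right ?_ h1
    rw [add_mul, mul_right_comm, energy_mul_norm_sq, one_mul, h2, ← sq, ← sq, ← h2,
      ← im_eq_norm_sq]
    exact ((im_eq_norm_sq h x).trans h2).le

/-- The spectral projection of `T` for a set `S` of energies, i.e. that of its resolvent for the
preimage of `S`. (Zero if `S` is not a Borel set.) -/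
noncomputable def spectralProj (S : Set ℝ) : E →L[ℂ] E :=
  open Classical in
  if hS : MeasurableSet S then
    (exists_isSpectralProjection (resolventCalculus h) (measurable_energy h hS)).choose
  else 0

theorem spectralProj_spec {S : Set ℝ} (hS : MeasurableSet S) :
    IsSpectralProjection (calculusMeasure (resolventCalculus h)) (energy h ⁻¹' S)
      (spectralProj h S) := by
  rw [spectralProj, dif_pos hS]
  exact (exists_isSpectralProjection (resolventCalculus h) (measurable_energy h hS)).choose_spec

/-- The spectral resolution of a self-adjoint operator. -/
noncomputable def spectralResolution : ProjectionValuedMeasure E where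
  proj := spectralProj h
  isStarProjection _ hS := (spectralProj_spec h hS).isStarProjection
  proj_univ := by
    have h1 := spectralProj_spec h MeasurableSet.univ
    have h2 := h1.compl (calculusMeasure_univ _) (measurable_energy h MeasurableSet.univ)
    ext ψ
    have h3 := h2.norm_sq ψ
    rw [Set.preimage_univ, Set.compl_univ, measureReal_empty] at h3
    exact (sub_eq_zero.1 (norm_eq_zero.1 (pow_eq_zero_iff two_ne_zero |>.1 h3))).symm
  hasSum_iUnion S hS hd ψ := by
    refine IsSpectralProjection.hasSum (calculusMeasure_univ (resolventCalculus h))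
      (fun n => measurable_energy h (hS n)) (fun i j hij => (hd hij).preimage _)
      (fun n => spectralProj_spec h (hS n)) ?_ ψ
    rw [← Set.preimage_iUnion]
    exact spectralProj_spec h (MeasurableSet.iUnion hS)

theorem scalarMeasure_spectralResolution (ψ : E) :
    (spectralResolution h).scalarMeasure ψ
      = (calculusMeasure (resolventCalculus h) ψ).map (energy h) := by
  ext S hS
  rw [ProjectionValuedMeasure.scalarMeasure_apply _ _ hS,
    Measure.map_apply (measurable_energy h) hS]
  change ENNReal.ofReal (inner ℂ ψ (spectralProj h S ψ)).re = _
  rw [(spectralProj_spec h hS).inner_self, Complex.ofReal_re, ofReal_measureReal]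

theorem calculusMeasure_resolventI (φ : E) :
    calculusMeasure (resolventCalculus h) (resolventI h φ)
      = (calculusMeasure (resolventCalculus h) φ).withDensity
        fun x => ((‖(x : ℂ)‖ ^ 2).toNNReal : ℝ≥0∞) := by
  have h1 := calculusMeasure_apply (resolventCalculus h) (resolventCoord h) φ
  rwa [DFunLike.congr_fun (resolventCalculus_coord h) φ] at h1

theorem integrable_energy_sq_resolventI (φ : E) :
    Integrable (fun x => energy h x ^ 2)
      (calculusMeasure (resolventCalculus h) (resolventI h φ)) := by
  rw [calculusMeasure_resolventI, integrable_withDensity_iff_integrable_smul (by fun_prop)]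
  refine Integrable.of_bound ?_ 1 (Eventually.of_forall fun x => ?_)
  · have := measurable_energy h
    exact Measurable.aestronglyMeasurable (by fun_prop)
  · rw [NNReal.smul_def, Real.coe_toNNReal _ (sq_nonneg _), smul_eq_mul, mul_comm,
      Real.norm_of_nonneg (by positivity)]
    exact energy_sq_mul_norm_sq_le h x

theorem integral_energy_resolventI (φ : E) :
    ∫ x, energy h x ∂(calculusMeasure (resolventCalculus h) (resolventI h φ))
      = ∫ x, (x : ℂ).re ∂(calculusMeasure (resolventCalculus h) φ) := by
  rw [calculusMeasure_resolventI, integral_withDensity_eq_integral_smul (by fun_prop)]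
  congr 1
  ext x
  rw [NNReal.smul_def, Real.coe_toNNReal _ (sq_nonneg _), smul_eq_mul, mul_comm,
    energy_mul_norm_sq]

theorem re_inner_resolventI (φ : E) :
    (inner ℂ φ (resolventI h φ)).re
      = ∫ x, (x : ℂ).re ∂(calculusMeasure (resolventCalculus h) φ) := by
  have h1 := inner_calculus (resolventCalculus h) φ (resolventCoord h)
  rw [resolventCalculus_coord] at h1
  rw [h1]
  exact (integral_re (integrable_calculusMeasure (resolventCalculus h) φ (resolventCoord h))).symm

/-- A vector with finite second moment lies in the range of the resolvent: `1 / r` is then square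
integrable, and the regularizations `r̄ / (|r|² + 1 / (n + 1))` of it, applied to the vector,
converge to a preimage. -/
theorem exists_resolventI_eq {ψ : E}
    (hψ : Integrable (fun x => energy h x ^ 2) (calculusMeasure (resolventCalculus h) ψ)) :
    ∃ u, resolventI h u = ψ := by
  set μ := calculusMeasure (resolventCalculus h) ψ with hμ
  have hpos : ∀ (n : ℕ) (x : spectrum ℂ (resolventI h)),
      0 < ‖(x : ℂ)‖ ^ 2 + 1 / ((n : ℝ) + 1) := fun n x => by positivity
  let f : ℕ → C(spectrum ℂ (resolventI h), ℂ) := fun n =>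
    ⟨fun x => (((‖(x : ℂ)‖ ^ 2 + 1 / ((n : ℝ) + 1))⁻¹ : ℝ) : ℂ) * (starRingEnd ℂ) (x : ℂ),
      (Complex.continuous_ofReal.comp (Continuous.inv₀ (by fun_prop) fun x => (hpos n x).ne')).mul
        (Complex.continuous_conj.comp continuous_subtype_val)⟩
  -- `x * f n x` lies in `[0, 1]` and tends to `1` away from `0`
  have hxf : ∀ (n : ℕ) (x : spectrum ℂ (resolventI h)), (x : ℂ) * f n x
      = ((‖(x : ℂ)‖ ^ 2 / (‖(x : ℂ)‖ ^ 2 + 1 / ((n : ℝ) + 1)) : ℝ) : ℂ) := by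
    intro n x
    change (x : ℂ) *
      ((((‖(x : ℂ)‖ ^ 2 + 1 / ((n : ℝ) + 1))⁻¹ : ℝ) : ℂ) * (starRingEnd ℂ) (x : ℂ)) = _
    rw [mul_left_comm, Complex.mul_conj', ← Complex.ofReal_pow, ← Complex.ofReal_mul,
      inv_mul_eq_div]
  have hle : ∀ (n : ℕ) (x : spectrum ℂ (resolventI h)), ‖(x : ℂ) * f n x - 1‖ ≤ 1 := by
    intro n x
    have h1 : 0 ≤ ‖(x : ℂ)‖ ^ 2 / (‖(x : ℂ)‖ ^ 2 + 1 / ((n : ℝ) + 1)) :=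
      div_nonneg (sq_nonneg _) (hpos n x).le
    have h2 : ‖(x : ℂ)‖ ^ 2 / (‖(x : ℂ)‖ ^ 2 + 1 / ((n : ℝ) + 1)) ≤ 1 := by
      rw [div_le_one (hpos n x)]
      linarith [show (0 : ℝ) < 1 / ((n : ℝ) + 1) by positivity]
    rw [hxf, ← Complex.ofReal_one, ← Complex.ofReal_sub, Complex.norm_real, Real.norm_eq_abs,
      abs_le]
    constructor <;> linarith
  have hlim : ∀ x : spectrum ℂ (resolventI h), (x : ℂ) ≠ 0 →
      Tendsto (fun n => (x : ℂ) * f n x - 1) atTop (𝓝 0) := by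
    intro x hx
    have h1 : ‖(x : ℂ)‖ ^ 2 ≠ 0 := by simpa using hx
    have h2 := (tendsto_one_div_add_atTop_nhds_zero_nat (𝕜 := ℝ)).const_add (‖(x : ℂ)‖ ^ 2)
    rw [add_zero] at h2
    have h3 := (tendsto_const_nhds (x := ‖(x : ℂ)‖ ^ 2)).div h2 h1
    rw [div_self h1] at h3
    have h4 := ((Complex.continuous_ofReal.tendsto _).comp h3).sub_const 1
    rw [Complex.ofReal_one, sub_self] at h4
    exact h4.congr fun n => by rw [hxf]; rfl
  have hfx : ∀ n x, f n x - (x : ℂ)⁻¹ = (x : ℂ)⁻¹ * ((x : ℂ) * f n x - 1) := by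
    intro n x
    rcases eq_or_ne (x : ℂ) 0 with hx | hx
    · have e : f n x = 0 := by
        change (((‖(x : ℂ)‖ ^ 2 + 1 / ((n : ℝ) + 1))⁻¹ : ℝ) : ℂ) * (starRingEnd ℂ) (x : ℂ) = 0
        rw [hx, map_zero, mul_zero]
      rw [e, hx]
      simp
    · rw [mul_sub, inv_mul_cancel_left₀ hx, mul_one]
  have hdm : ∀ n, Measurable fun x => ‖f n x - (x : ℂ)⁻¹‖ ^ 2 := fun n =>
    ((f n).continuous.measurable.sub measurable_subtype_coe.inv).norm.pow_const 2
  have hdle : ∀ n x, ‖‖f n x - (x : ℂ)⁻¹‖ ^ 2‖ ≤ energy h x ^ 2 + 1 := by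
    intro n x
    rw [Real.norm_of_nonneg (sq_nonneg _), hfx, norm_mul, mul_pow]
    calc _ ≤ ‖(x : ℂ)⁻¹‖ ^ 2 * 1 :=
          mul_le_mul_of_nonneg_left (pow_le_one₀ (norm_nonneg _) (hle n x)) (sq_nonneg _)
      _ ≤ energy h x ^ 2 + 1 := by
          rw [mul_one]
          exact norm_inv_sq_le h x
  have hint : Integrable (fun x => energy h x ^ 2 + 1) μ := hψ.add (integrable_const _)
  have hdlim : Tendsto (fun n => ∫ x, ‖f n x - (x : ℂ)⁻¹‖ ^ 2 ∂μ) atTop (𝓝 0) := by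
    have h1 := tendsto_integral_of_dominated_convergence (μ := μ)
      (F := fun n x => ‖f n x - (x : ℂ)⁻¹‖ ^ 2) (f := fun _ => 0) (fun x => energy h x ^ 2 + 1)
      (fun n => (hdm n).aestronglyMeasurable) hint (fun n => Eventually.of_forall (hdle n))
      (Eventually.of_forall fun x => by
        simp only [hfx]
        rcases eq_or_ne (x : ℂ) 0 with hx | hx
        · simp [hx]
        · have h2 := (((hlim x hx).const_mul (x : ℂ)⁻¹).norm).pow 2
          rwa [mul_zero, norm_zero, zero_pow two_ne_zero] at h2)
    rwa [integral_zero] at h1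
  obtain ⟨u, hu⟩ := exists_tendsto_calculus (resolventCalculus h) ψ (f := f)
    (F := fun x => (x : ℂ)⁻¹)
    (fun n => hint.mono' (hdm n).aestronglyMeasurable (Eventually.of_forall (hdle n))) hdlim
  refine ⟨u, tendsto_nhds_unique (((resolventI h).continuous.tendsto u).comp hu) ?_⟩
  rw [tendsto_iff_norm_sub_tendsto_zero]
  have hnull := calculusMeasure_zero_set (resolventCalculus h) (g := resolventCoord h)
    (by rw [resolventCalculus_coord]; exact h.resolvent_injective _) ψ
  have h1 := tendsto_integral_of_dominated_convergence (μ := μ)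
    (F := fun n x => ‖(x : ℂ) * f n x - 1‖ ^ 2) (f := fun _ => 0) (fun _ => 1)
    (fun n => (((continuous_subtype_val.mul (f n).continuous).sub continuous_const).norm.pow
      2).aestronglyMeasurable) (integrable_const _)
    (fun n => Eventually.of_forall fun x => by
      rw [Real.norm_of_nonneg (sq_nonneg _)]
      exact pow_le_one₀ (norm_nonneg _) (hle n x))
    (by
      filter_upwards [compl_mem_ae_iff.2 hnull] with x hx
      have h2 := ((hlim x hx).norm).pow 2
      rwa [norm_zero, zero_pow two_ne_zero] at h2)
  rw [integral_zero] at h1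
  have h2 := h1.sqrt
  rw [Real.sqrt_zero] at h2
  refine h2.congr fun n => ?_
  have h3 := norm_calculus_sq (resolventCalculus h) ψ (resolventCoord h * f n - 1)
  have h4 : resolventCalculus h (resolventCoord h * f n - 1) ψ
      = resolventI h (resolventCalculus h (f n) ψ) - ψ := by
    rw [map_sub, map_mul, map_one, resolventCalculus_coord]
    rfl
  rw [h4] at h3
  refine Eq.trans (congrArg Real.sqrt h3.symm) ?_
  rw [Real.sqrt_sq (norm_nonneg _)]
  rfl

/-- The spectral theorem: the spectral resolution resolves `T`. -/
theorem spectralResolution_resolves : (spectralResolution h).Resolves T := by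
  have hκ := measurable_energy h
  -- every vector of the domain is `(T - i)⁻¹ φ` for some `φ`
  have hdom : ∀ ψ : T.domain, ∃ φ, resolventI h φ = ψ ∧ T ψ = φ + Complex.I • (ψ : E) := by
    intro ψ
    have e : T ψ = (T ψ - Complex.I • (ψ : E)) + Complex.I • (ψ : E) := by abel
    exact ⟨T ψ - Complex.I • (ψ : E), h.resolvent_eq _ e, e⟩
  constructor
  · intro ψ
    rw [scalarMeasure_spectralResolution, integrable_map_measure (by fun_prop) hκ.aemeasurable]
    constructor
    · intro hψ
      obtain ⟨φ, hφ, -⟩ := hdom ⟨ψ, hψ⟩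
      have h1 := integrable_energy_sq_resolventI h φ
      rw [hφ] at h1
      exact h1
    · intro hψ
      obtain ⟨u, hu⟩ := exists_resolventI_eq h hψ
      rw [← hu]
      exact h.resolvent_mem _ u
  · intro ψ
    obtain ⟨φ, hφ, hT⟩ := hdom ψ
    rw [scalarMeasure_spectralResolution, integral_map hκ.aemeasurable (by fun_prop), ← hφ,
      integral_energy_resolventI, ← re_inner_resolventI]
    refine Complex.ext ?_ ?_
    · rw [hT, inner_add_right, inner_smul_right, hφ, inner_self_eq_norm_sq_to_K, Complex.add_re,
        Complex.ofReal_re, ← hφ, ← inner_conj_symm, Complex.conj_re]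
      simp [← Complex.ofReal_pow]
    · rw [Complex.ofReal_im, hφ]
      exact IsSelfAdjointPMap.im_inner_self_eq_zero h.symm ψ

end Existence

/-! ### The cyclic subspace of a vector -/

section Cyclic

variable {E : Type*} [NormedAddCommGroup E] [InnerProductSpace ℂ E] [CompleteSpace E]

omit [CompleteSpace E] in
/-- Linear combinations of two families with the same Gram matrix have the same norm. -/
theorem norm_linearCombination_eq_of_gram {F ι : Type*} [NormedAddCommGroup F]
    [InnerProductSpace ℂ F] {a : ι → E} {b : ι → F}
    (h : ∀ i j, inner ℂ (a i) (a j) = inner ℂ (b i) (b j)) (x : ι →₀ ℂ) :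
    ‖Finsupp.linearCombination ℂ a x‖ = ‖Finsupp.linearCombination ℂ b x‖ := by
  have h1 : inner ℂ (Finsupp.linearCombination ℂ a x) (Finsupp.linearCombination ℂ a x)
      = inner ℂ (Finsupp.linearCombination ℂ b x) (Finsupp.linearCombination ℂ b x) := by
    simp only [Finsupp.linearCombination_apply, Finsupp.sum_inner, Finsupp.inner_sum,
      inner_smul_left, inner_smul_right, h]
  rw [@norm_eq_sqrt_re_inner ℂ, @norm_eq_sqrt_re_inner ℂ _ _ _ _
    (Finsupp.linearCombination ℂ b x), h1]

namespace ProjectionValuedMeasure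

variable (P : ProjectionValuedMeasure E)

theorem scalarMeasure_univ (ψ : E) :
    P.scalarMeasure ψ Set.univ = ENNReal.ofReal (‖ψ‖ ^ 2) := by
  rw [P.scalarMeasure_apply ψ MeasurableSet.univ, P.proj_univ]
  congr 1
  exact inner_self_eq_norm_sq (𝕜 := ℂ) ψ

instance (ψ : E) : IsFiniteMeasure (P.scalarMeasure ψ) :=
  IsSpectralProjection.finite_of_univ P.scalarMeasure_univ ψ

theorem isSpectralProjection {S : Set ℝ} (hS : MeasurableSet S) :
    IsSpectralProjection P.scalarMeasure S (P.proj S) := by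
  have h := P.isStarProjection S hS
  have h1 : ∀ ψ, inner ℂ ψ (P.proj S ψ) = ((‖P.proj S ψ‖ ^ 2 : ℝ) : ℂ) := by
    intro ψ
    have h2 : P.proj S (P.proj S ψ) = P.proj S ψ :=
      congrArg (fun T : E →L[ℂ] E => T ψ) h.isIdempotentElem.eq
    have h3 := h.isSelfAdjoint.isSymmetric ψ (P.proj S ψ)
    simp only [ContinuousLinearMap.coe_coe] at h3
    rw [h2] at h3
    rw [← h3, inner_self_eq_norm_sq_to_K]
    simp
  have h4 : ∀ ψ, (P.scalarMeasure ψ).real S = ‖P.proj S ψ‖ ^ 2 := by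
    intro ψ
    rw [measureReal_def, P.scalarMeasure_apply ψ hS, h1, Complex.ofReal_re,
      ENNReal.toReal_ofReal (sq_nonneg _)]
  exact ⟨fun ψ => by rw [h1, h4], fun ψ => (h4 ψ).symm⟩

theorem eq_of_isSpectralProjection {S : Set ℝ} (hS : MeasurableSet S) {Q : E →L[ℂ] E}
    (hQ : IsSpectralProjection P.scalarMeasure S Q) : P.proj S = Q := by
  refine ContinuousLinearMap.coe_injective ((ext_inner_map _ _).1 fun ψ => ?_)
  change inner ℂ (P.proj S ψ) ψ = inner ℂ (Q ψ) ψ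
  rw [(P.isSpectralProjection hS).inner_left, hQ.inner_left, hQ.inner_self,
    (P.isSpectralProjection hS).inner_self]

/-- Spectral projections are multiplicative. -/
theorem proj_proj {S S' : Set ℝ} (hS : MeasurableSet S) (hS' : MeasurableSet S') (ψ : E) :
    P.proj S (P.proj S' ψ) = P.proj (S ∩ S') ψ := by
  have hM := P.scalarMeasure_univ
  have h1 := (P.isSpectralProjection (hS.inter hS')).union hM (hS'.diff hS)
    (P.isSpectralProjection (hS'.diff hS))
    (Set.disjoint_left.2 fun x hx hx' => hx'.2 hx.1)
  have e : S ∩ S' ∪ S' \ S = S' := by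
    rw [Set.inter_comm]
    exact Set.inter_union_sdiff S' S
  rw [e] at h1
  rw [P.eq_of_isSpectralProjection hS' h1]
  change P.proj S (P.proj (S ∩ S') ψ + P.proj (S' \ S) ψ) = _
  rw [map_add, (P.isSpectralProjection (hS'.diff hS)).apply_apply_of_disjoint hM hS
    (P.isSpectralProjection hS) Set.disjoint_sdiff_left, add_zero]
  have h2 := (P.isSpectralProjection (hS.inter hS')).apply_apply_of_disjoint hM hS.compl
    ((P.isSpectralProjection hS).compl hM hS)
    (Set.disjoint_left.2 fun x hx hx' => hx' hx.1) ψ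
  exact (sub_eq_zero.1 h2).symm

theorem inner_proj_proj {S S' : Set ℝ} (hS : MeasurableSet S) (hS' : MeasurableSet S') (ψ : E) :
    inner ℂ (P.proj S ψ) (P.proj S' ψ) = (((P.scalarMeasure ψ).real (S ∩ S') : ℝ) : ℂ) := by
  rw [(P.isSpectralProjection hS).inner_left, P.proj_proj hS hS',
    (P.isSpectralProjection (hS.inter hS')).inner_self]

/-- Finite linear combinations of indicators of Borel sets, as elements of `L²` of the spectral
measure of `ψ`. -/
noncomputable def stepLp (ψ : E) :
    ({S : Set ℝ // MeasurableSet S} →₀ ℂ) →ₗ[ℂ] Lp ℂ 2 (P.scalarMeasure ψ) :=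
  Finsupp.linearCombination ℂ fun S => indicatorConstLp 2 S.2 (measure_ne_top _ _) 1

/-- The vectors `∑ c_k P(S_k) ψ`. -/
noncomputable def stepVector (ψ : E) : ({S : Set ℝ // MeasurableSet S} →₀ ℂ) →ₗ[ℂ] E :=
  Finsupp.linearCombination ℂ fun S => P.proj S.1 ψ

theorem restrict_indicatorConstLp (μ : Measure ℝ) [IsFiniteMeasure μ] (S : Set ℝ)
    {A : Set ℝ} (hA : MeasurableSet A) :
    LpToLpRestrictCLM ℝ ℂ ℂ μ 2 S (indicatorConstLp 2 hA (measure_ne_top _ _) 1)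
      = indicatorConstLp 2 hA (measure_ne_top _ _) 1 := by
  refine Lp.ext ?_
  have h1 := indicatorConstLp_coeFn (μ := μ) (p := 2) (hs := hA) (hμs := measure_ne_top _ _)
    (c := (1 : ℂ))
  have h2 := indicatorConstLp_coeFn (μ := μ.restrict S) (p := 2) (hs := hA)
    (hμs := measure_ne_top _ _) (c := (1 : ℂ))
  exact ((LpToLpRestrictCLM_coeFn ℂ S _).trans (ae_restrict_of_ae h1)).trans h2.symm

/-- Restriction to `S` on the side of `L²` corresponds to `P(S)` on the side of the Hilbert space.
-/
theorem norm_proj_stepVector (ψ : E) {S : Set ℝ} (hS : MeasurableSet S)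
    (x : {S : Set ℝ // MeasurableSet S} →₀ ℂ) :
    ‖P.proj S (P.stepVector ψ x)‖
      = ‖LpToLpRestrictCLM ℝ ℂ ℂ (P.scalarMeasure ψ) 2 S (P.stepLp ψ x)‖ := by
  have e1 := Finsupp.apply_linearCombination ℂ (P.proj S).toLinearMap (fun A => P.proj A.1 ψ) x
  have e2 := Finsupp.apply_linearCombination ℂ
    (LpToLpRestrictCLM ℝ ℂ ℂ (P.scalarMeasure ψ) 2 S).toLinearMap
    (fun A : {S : Set ℝ // MeasurableSet S} =>
      indicatorConstLp (μ := P.scalarMeasure ψ) 2 A.2 (measure_ne_top _ _) 1) x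
  refine Eq.trans (congrArg norm e1) (Eq.trans ?_ (congrArg norm e2).symm)
  refine norm_linearCombination_eq_of_gram (fun A B => ?_) x
  change inner ℂ (P.proj S (P.proj A.1 ψ)) (P.proj S (P.proj B.1 ψ))
    = inner ℂ (LpToLpRestrictCLM ℝ ℂ ℂ (P.scalarMeasure ψ) 2 S (indicatorConstLp 2 A.2 _ 1))
      (LpToLpRestrictCLM ℝ ℂ ℂ (P.scalarMeasure ψ) 2 S (indicatorConstLp 2 B.2 _ 1))
  rw [restrict_indicatorConstLp, restrict_indicatorConstLp,
    L2.inner_indicatorConstLp_one_indicatorConstLp_one, P.proj_proj hS A.2, P.proj_proj hS B.2,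
    P.inner_proj_proj (hS.inter A.2) (hS.inter B.2),
    measureReal_restrict_apply (A.2.inter B.2)]
  have e : S ∩ A.1 ∩ (S ∩ B.1) = A.1 ∩ B.1 ∩ S := by
    ext y
    simp only [Set.mem_inter_iff]
    tauto
  rw [e]
  rfl

theorem norm_stepVector (ψ : E) (x : {S : Set ℝ // MeasurableSet S} →₀ ℂ) :
    ‖P.stepVector ψ x‖ = ‖P.stepLp ψ x‖ := by
  refine norm_linearCombination_eq_of_gram (fun A B => ?_) x
  rw [L2.inner_indicatorConstLp_one_indicatorConstLp_one, P.inner_proj_proj A.2 B.2]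
  rfl

theorem denseRange_stepLp (ψ : E) : DenseRange (P.stepLp ψ) := by
  have hsub : ∀ f, f ∈ (LinearMap.range (P.stepLp ψ)).topologicalClosure := by
    intro f
    refine Lp.induction ENNReal.ofNat_ne_top
      (motive := fun f => f ∈ (LinearMap.range (P.stepLp ψ)).topologicalClosure) ?_
      (fun f g hf hg _ h1 h2 => Submodule.add_mem _ h1 h2)
      (Submodule.isClosed_topologicalClosure _) f
    intro c S hs hμs
    refine Submodule.le_topologicalClosure _ ⟨Finsupp.single ⟨S, hs⟩ c, ?_⟩
    rw [Lp.simpleFunc.coe_indicatorConst, stepLp, Finsupp.linearCombination_single]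
    refine Lp.ext ?_
    refine (Lp.coeFn_smul _ _).trans ?_
    filter_upwards [indicatorConstLp_coeFn (p := 2) (hs := hs) (hμs := hμs.ne) (c := c),
      indicatorConstLp_coeFn (p := 2) (hs := hs) (hμs := hμs.ne) (c := (1 : ℂ))] with y h1 h2
    rw [Pi.smul_apply, h1, h2]
    by_cases hy : y ∈ S <;> simp [hy]
  intro f
  exact hsub f

/-- The isometry `f ↦ f(P) ψ` from `L²` of the spectral measure of `ψ` onto the cyclic subspace
of `ψ`. -/
noncomputable def cyclic (ψ : E) : Lp ℂ 2 (P.scalarMeasure ψ) →L[ℂ] E :=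
  (P.stepVector ψ).extendOfNorm (P.stepLp ψ)

theorem cyclic_stepLp (ψ : E) (x : {S : Set ℝ // MeasurableSet S} →₀ ℂ) :
    P.cyclic ψ (P.stepLp ψ x) = P.stepVector ψ x :=
  LinearMap.extendOfNorm_eq (P.denseRange_stepLp ψ)
    ⟨1, fun x => by rw [one_mul, P.norm_stepVector]⟩ x

theorem cyclic_indicator (ψ : E) {S : Set ℝ} (hS : MeasurableSet S) :
    P.cyclic ψ (indicatorConstLp 2 hS (measure_ne_top _ _) 1) = P.proj S ψ := by
  have h := P.cyclic_stepLp ψ (Finsupp.single ⟨S, hS⟩ 1)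
  rw [stepLp, stepVector, Finsupp.linearCombination_single, Finsupp.linearCombination_single,
    one_smul, one_smul] at h
  exact h

theorem norm_proj_cyclic (ψ : E) {S : Set ℝ} (hS : MeasurableSet S)
    (f : Lp ℂ 2 (P.scalarMeasure ψ)) :
    ‖P.proj S (P.cyclic ψ f)‖ = ‖LpToLpRestrictCLM ℝ ℂ ℂ (P.scalarMeasure ψ) 2 S f‖ := by
  refine (P.denseRange_stepLp ψ).induction_on f (isClosed_eq (by fun_prop) (by fun_prop))
    fun x => ?_
  rw [P.cyclic_stepLp, P.norm_proj_stepVector ψ hS]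

theorem norm_cyclic (ψ : E) (f : Lp ℂ 2 (P.scalarMeasure ψ)) : ‖P.cyclic ψ f‖ = ‖f‖ := by
  refine (P.denseRange_stepLp ψ).induction_on f (isClosed_eq (by fun_prop) (by fun_prop))
    fun x => ?_
  rw [P.cyclic_stepLp, P.norm_stepVector]

theorem inner_cyclic (ψ : E) (f g : Lp ℂ 2 (P.scalarMeasure ψ)) :
    inner ℂ (P.cyclic ψ f) (P.cyclic ψ g) = inner ℂ f g :=
  LinearIsometry.inner_map_map (⟨(P.cyclic ψ).toLinearMap, P.norm_cyclic ψ⟩ :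
    Lp ℂ 2 (P.scalarMeasure ψ) →ₗᵢ[ℂ] E) f g

/-- The spectral measure of `f(P) ψ` is `|f|²` times that of `ψ`. -/
theorem scalarMeasure_cyclic (ψ : E) {f : ℝ → ℂ} (hf : MemLp f 2 (P.scalarMeasure ψ)) :
    P.scalarMeasure (P.cyclic ψ (hf.toLp f))
      = (P.scalarMeasure ψ).withDensity fun x => ENNReal.ofReal (‖f x‖ ^ 2) := by
  ext S hS
  have hi : Integrable (fun x => ‖f x‖ ^ 2) (P.scalarMeasure ψ) :=
    (memLp_two_iff_integrable_sq_norm hf.1).1 hf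
  rw [withDensity_apply _ hS, ← ofReal_integral_eq_lintegral_ofReal hi.restrict
    (Eventually.of_forall fun x => sq_nonneg _), ← ofReal_measureReal,
    ← (P.isSpectralProjection hS).norm_sq, P.norm_proj_cyclic ψ hS]
  congr 1
  have h1 := @inner_self_eq_norm_sq ℂ _ _ _ _
    (LpToLpRestrictCLM ℝ ℂ ℂ (P.scalarMeasure ψ) 2 S (hf.toLp f))
  rw [← h1, L2.inner_def]
  have h2 : ∀ᵐ x ∂((P.scalarMeasure ψ).restrict S),
      inner ℂ (LpToLpRestrictCLM ℝ ℂ ℂ (P.scalarMeasure ψ) 2 S (hf.toLp f) x)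
        (LpToLpRestrictCLM ℝ ℂ ℂ (P.scalarMeasure ψ) 2 S (hf.toLp f) x)
      = ((‖f x‖ ^ 2 : ℝ) : ℂ) := by
    filter_upwards [LpToLpRestrictCLM_coeFn ℂ S (hf.toLp f), ae_restrict_of_ae hf.coeFn_toLp]
      with x hx1 hx2
    rw [hx1, hx2, inner_self_eq_norm_sq_to_K]
    simp
  rw [integral_congr_ae h2, integral_complex_ofReal]
  rfl

theorem integral_scalarMeasure_cyclic (ψ : E) {f : ℝ → ℂ} (hfm : Measurable f)
    (hf : MemLp f 2 (P.scalarMeasure ψ)) (k : ℝ → ℝ) :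
    ∫ x, k x ∂(P.scalarMeasure (P.cyclic ψ (hf.toLp f)))
      = ∫ x, ‖f x‖ ^ 2 * k x ∂(P.scalarMeasure ψ) := by
  rw [P.scalarMeasure_cyclic]
  have h := integral_withDensity_eq_integral_smul (μ := P.scalarMeasure ψ)
    (f := fun x => (‖f x‖ ^ 2).toNNReal) (by fun_prop) k
  refine h.trans (integral_congr_ae (Eventually.of_forall fun x => ?_))
  change (‖f x‖ ^ 2).toNNReal • k x = ‖f x‖ ^ 2 * k x
  rw [NNReal.smul_def, Real.coe_toNNReal _ (sq_nonneg _), smul_eq_mul]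

theorem integrable_scalarMeasure_cyclic_iff (ψ : E) {f : ℝ → ℂ} (hfm : Measurable f)
    (hf : MemLp f 2 (P.scalarMeasure ψ)) (k : ℝ → ℝ) :
    Integrable k (P.scalarMeasure (P.cyclic ψ (hf.toLp f)))
      ↔ Integrable (fun x => ‖f x‖ ^ 2 * k x) (P.scalarMeasure ψ) := by
  rw [P.scalarMeasure_cyclic]
  have h := integrable_withDensity_iff_integrable_smul (μ := P.scalarMeasure ψ)
    (f := fun x => (‖f x‖ ^ 2).toNNReal) (by fun_prop) (g := k)
  refine h.trans (integrable_congr (Eventually.of_forall fun x => ?_))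
  change (‖f x‖ ^ 2).toNNReal • k x = ‖f x‖ ^ 2 * k x
  rw [NNReal.smul_def, Real.coe_toNNReal _ (sq_nonneg _), smul_eq_mul]

end ProjectionValuedMeasure

end Cyclic

/-! ### The Stieltjes transform of a spectral measure -/

section Uniqueness

variable {E : Type*} [NormedAddCommGroup E] [InnerProductSpace ℂ E] [CompleteSpace E]
variable {P : ProjectionValuedMeasure E} {T : E →ₗ.[ℂ] E}

namespace ProjectionValuedMeasure

variable (P) in
theorem tendsto_proj_inter_Icc {S : Set ℝ} (hS : MeasurableSet S) (ψ : E) :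
    Tendsto (fun n : ℕ => P.proj (S ∩ Set.Icc (-(n : ℝ)) n) ψ) atTop (𝓝 (P.proj S ψ)) := by
  have hU : ⋃ n : ℕ, S ∩ Set.Icc (-(n : ℝ)) n = S := by
    rw [← Set.inter_iUnion, Set.inter_eq_left]
    intro x _
    obtain ⟨n, hn⟩ := exists_nat_ge |x|
    exact Set.mem_iUnion.2 ⟨n, abs_le.1 hn⟩
  have hm : Monotone fun n : ℕ => S ∩ Set.Icc (-(n : ℝ)) n := by
    intro m n hmn
    have h1 : (m : ℝ) ≤ n := by exact_mod_cast hmn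
    exact Set.inter_subset_inter_right _ (Set.Icc_subset_Icc (by linarith) h1)
  have h1 := tendsto_measure_iUnion_atTop (μ := P.scalarMeasure ψ) hm
  rw [hU] at h1
  have h2 := ((ENNReal.tendsto_toReal (measure_ne_top _ S)).comp h1).const_sub
    ((P.scalarMeasure ψ).real S)
  rw [← measureReal_def, sub_self] at h2
  have h3 := h2.sqrt
  rw [Real.sqrt_zero] at h3
  refine tendsto_iff_norm_sub_tendsto_zero.2 (h3.congr fun n => ?_)
  have h4 := IsSpectralProjection.norm_sub_sq P.scalarMeasure_univ hS
    (Set.inter_subset_left (t := Set.Icc (-(n : ℝ)) n))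
    (P.isSpectralProjection (hS.inter measurableSet_Icc)) (P.isSpectralProjection hS) ψ
  refine (congrArg Real.sqrt h4.symm).trans ?_
  rw [Real.sqrt_sq (norm_nonneg _), norm_sub_rev]

theorem Resolves.integrable_id (hP : P.Resolves T) (v : T.domain) :
    Integrable (fun x : ℝ => x) (P.scalarMeasure (v : E)) := by
  refine (((hP.1 v).1 v.2).add (integrable_const 1)).mono' measurable_id.aestronglyMeasurable
    (Eventually.of_forall fun x => ?_)
  change |x| ≤ x ^ 2 + 1
  rw [abs_le]
  constructor <;> nlinarith [sq_nonneg (x - 1), sq_nonneg (x + 1)]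

theorem Resolves.proj_mem (hP : P.Resolves T) {S : Set ℝ} (hS : MeasurableSet S) {R : ℝ}
    (hR : S ⊆ Set.Icc (-R) R) (v : E) : P.proj S v ∈ T.domain := by
  have hf : MemLp (S.indicator fun _ => (1 : ℂ)) 2 (P.scalarMeasure v) :=
    memLp_indicator_const 2 hS 1 (Or.inr (measure_ne_top _ _))
  have e : P.proj S v = P.cyclic v (hf.toLp _) := (P.cyclic_indicator v hS).symm
  have hfm : Measurable (S.indicator fun _ => (1 : ℂ)) := measurable_const.indicator hS
  rw [hP.1, e, P.integrable_scalarMeasure_cyclic_iff v hfm hf]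
  refine Integrable.of_bound (by fun_prop) (R ^ 2) (Eventually.of_forall fun x => ?_)
  by_cases hx : x ∈ S
  · have h1 := hR hx
    rw [Set.indicator_of_mem hx, norm_one, one_pow, one_mul,
      Real.norm_of_nonneg (sq_nonneg _)]
    exact sq_le_sq' h1.1 h1.2
  · rw [Set.indicator_of_notMem hx]
    simpa using sq_nonneg R

/-- Polarization: a resolution prescribes only the quadratic form of `T`; if this form, along the
vectors `v + c w`, has cross term `2 Re (c̄ κ)`, then `⟨w, T v⟩ = κ`. -/
theorem Resolves.inner_apply_eq (hP : P.Resolves T)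
    (hT : ∀ x y : T.domain, inner ℂ (T x) (y : E) = inner ℂ (x : E) (T y)) {v w : T.domain} {κ : ℂ}
    (h : ∀ c : ℂ, ∫ x, x ∂(P.scalarMeasure ((v : E) + c • (w : E)))
      = ∫ x, x ∂(P.scalarMeasure (v : E)) + ‖c‖ ^ 2 * ∫ x, x ∂(P.scalarMeasure (w : E))
        + 2 * ((starRingEnd ℂ) c * κ).re) :
    inner ℂ (w : E) (T v) = κ := by
  have hre : ∀ c : ℂ, ((starRingEnd ℂ) c * inner ℂ (w : E) (T v)).re
      = ((starRingEnd ℂ) c * κ).re := by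
    intro c
    have h1 := congrArg Complex.re (hP.2 (v + c • w))
    have hv := congrArg Complex.re (hP.2 v)
    have hw := congrArg Complex.re (hP.2 w)
    rw [Complex.ofReal_re] at h1 hv hw
    have h2 : (inner ℂ (v : E) (T w)) = (starRingEnd ℂ) (inner ℂ (w : E) (T v)) := by
      rw [← hT, inner_conj_symm]
    have h3 : ((v + c • w : T.domain) : E) = (v : E) + c • (w : E) := rfl
    rw [h3, h c, LinearPMap.map_add, LinearPMap.map_smul, inner_add_left, inner_add_right,
      inner_add_right, inner_smul_left, inner_smul_left, inner_smul_right, inner_smul_right, h2,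
      ← hv, ← hw] at h1
    have h4 : (c * (starRingEnd ℂ) (inner ℂ (w : E) (T v))).re
        = ((starRingEnd ℂ) c * inner ℂ (w : E) (T v)).re := by
      rw [← Complex.conj_re]
      simp
    have h5 : ((starRingEnd ℂ) c * (c * inner ℂ (w : E) (T w))).re
        = ‖c‖ ^ 2 * (inner ℂ (w : E) (T w)).re := by
      rw [← mul_assoc, Complex.conj_mul', ← Complex.ofReal_pow, Complex.re_ofReal_mul]
    rw [Complex.add_re, Complex.add_re, Complex.add_re, h4, h5] at h1
    linarith
  refine Complex.ext ?_ ?_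
  · simpa using hre 1
  · simpa using hre Complex.I

/-- If `w` is orthogonal to the cyclic subspace of `v` then `⟨w, T v⟩ = 0`. -/
theorem Resolves.inner_apply_eq_zero (hP : P.Resolves T)
    (hT : ∀ x y : T.domain, inner ℂ (T x) (y : E) = inner ℂ (x : E) (T y)) {v w : T.domain}
    (h : ∀ S, MeasurableSet S → inner ℂ (P.proj S v) (w : E) = 0) :
    inner ℂ (w : E) (T v) = 0 := by
  refine hP.inner_apply_eq hT fun c => ?_
  have hm : P.scalarMeasure ((v : E) + c • (w : E))
      = P.scalarMeasure (v : E) + (‖c‖ ^ 2).toNNReal • P.scalarMeasure (w : E) := by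
    ext S hS
    have hS' := P.isSpectralProjection hS
    have e1 : (P.scalarMeasure ((v : E) + c • (w : E))).real S
        = (P.scalarMeasure (v : E)).real S + ‖c‖ ^ 2 * (P.scalarMeasure (w : E)).real S := by
      have e2 : inner ℂ (P.proj S v) (P.proj S (w : E)) = 0 := by
        rw [← hS'.inner_left, hS'.apply_apply, h S hS]
      rw [← hS'.norm_sq, ← hS'.norm_sq, ← hS'.norm_sq, map_add, map_smul, @norm_add_sq ℂ,
        inner_smul_right, e2, norm_smul, mul_pow]
      simp
    rw [Measure.add_apply, Measure.smul_apply, ← ofReal_measureReal, e1,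
      ENNReal.ofReal_add (by positivity) (by positivity), ENNReal.ofReal_mul (by positivity),
      ofReal_measureReal, ofReal_measureReal]
    rfl
  have hi := hP.integrable_id w
  rw [hm, integral_add_measure (hP.integrable_id v) (hi.smul_measure_nnreal),
    integral_smul_nnreal_measure, NNReal.smul_def, Real.coe_toNNReal _ (sq_nonneg _)]
  simp

end ProjectionValuedMeasure

open ProjectionValuedMeasure

theorem norm_inv_ofReal_sub_le {z : ℂ} (hz : z.im ≠ 0) (x : ℝ) :
    ‖((x : ℂ) - z)⁻¹‖ ≤ |z.im|⁻¹ := by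
  rw [norm_inv]
  refine inv_anti₀ (abs_pos.2 hz) ?_
  have h := Complex.abs_im_le_norm ((x : ℂ) - z)
  simpa using h

theorem ofReal_sub_ne_zero {z : ℂ} (hz : z.im ≠ 0) (x : ℝ) : (x : ℂ) - z ≠ 0 := by
  intro h
  apply hz
  have := congrArg Complex.im h
  simpa using this

theorem norm_ofReal_mul_inv_sub_le {z : ℂ} (hz : z.im ≠ 0) (x : ℝ) :
    ‖(x : ℂ) * ((x : ℂ) - z)⁻¹‖ ≤ 1 + ‖z‖ * |z.im|⁻¹ := by
  have e : (x : ℂ) * ((x : ℂ) - z)⁻¹ = 1 + z * ((x : ℂ) - z)⁻¹ := by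
    have := ofReal_sub_ne_zero hz x
    field_simp
    ring
  rw [e]
  refine (norm_add_le _ _).trans ?_
  rw [norm_one, norm_mul]
  gcongr
  exact norm_inv_ofReal_sub_le hz x

/-- For any resolution `P` of a self-adjoint operator `T`, the Stieltjes transform of the spectral
measure of `ψ` is the diagonal matrix element of the resolvent. In particular the spectral measure
does not depend on `P`. -/
theorem inner_resolvent_eq_integral (h : IsSelfAdjointPMap T) (hP : P.Resolves T) {z : ℂ}
    (hz : z.im ≠ 0) (ψ : E) :
    inner ℂ ψ (h.resolvent hz ψ) = ∫ x, ((x : ℂ) - z)⁻¹ ∂(P.scalarMeasure ψ) := by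
  set μ := P.scalarMeasure ψ with hμ
  set f : ℝ → ℂ := fun x => ((x : ℂ) - z)⁻¹ with hf
  have hfm : Measurable f := by fun_prop
  have hfb := norm_inv_ofReal_sub_le hz
  have hfL : MemLp f 2 μ := MemLp.of_bound hfm.aestronglyMeasurable _ (Eventually.of_forall hfb)
  -- the candidate `u = f(P) ψ` for `(T - z)⁻¹ ψ`
  set u := P.cyclic ψ (hfL.toLp f) with hu
  have huD : u ∈ T.domain := by
    rw [hP.1, P.integrable_scalarMeasure_cyclic_iff ψ hfm hfL]
    refine Integrable.of_bound (by fun_prop) ((1 + ‖z‖ * |z.im|⁻¹) ^ 2)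
      (Eventually.of_forall fun x => ?_)
    have e : ‖f x‖ ^ 2 * x ^ 2 = ‖(x : ℂ) * f x‖ ^ 2 := by
      rw [norm_mul, mul_pow, Complex.norm_real, Real.norm_eq_abs, sq_abs, mul_comm]
    rw [e, Real.norm_of_nonneg (sq_nonneg _)]
    exact pow_le_pow_left₀ (norm_nonneg _) (norm_ofReal_mul_inv_sub_le hz x) 2
  have hPu : ∀ S, MeasurableSet S → inner ℂ (P.proj S ψ) u = ∫ x in S, f x ∂μ := by
    intro S hS
    rw [← P.cyclic_indicator ψ hS, hu, P.inner_cyclic, L2.inner_indicatorConstLp_one]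
    exact setIntegral_congr_ae hS (hfL.coeFn_toLp.mono fun x hx _ => hx)
  set v := T ⟨u, huD⟩ - z • u - ψ with hv
  -- `⟨P(S) ψ, (T - z) u - ψ⟩ = ∫_S (x - z) f - μ(S) = 0` for bounded `S`
  have h1 : ∀ S, MeasurableSet S → ∀ R : ℝ, S ⊆ Set.Icc (-R) R → inner ℂ (P.proj S ψ) v = 0 := by
    intro S hS R hR
    have hgL : MemLp (S.indicator fun _ => (1 : ℂ)) 2 μ :=
      memLp_indicator_const 2 hS 1 (Or.inr (measure_ne_top _ _))
    have hgm : Measurable (S.indicator fun _ => (1 : ℂ)) := measurable_const.indicator hS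
    have hgv : ∀ x, S.indicator (fun _ => (1 : ℂ)) x = 1 ∧ |x| ≤ R
        ∨ S.indicator (fun _ => (1 : ℂ)) x = 0 := by
      intro x
      by_cases hx : x ∈ S
      · exact Or.inl ⟨Set.indicator_of_mem hx _, abs_le.2 (hR hx)⟩
      · exact Or.inr (Set.indicator_of_notMem hx _)
    set g : ℝ → ℂ := S.indicator fun _ => (1 : ℂ) with hg
    have hgu : P.cyclic ψ (hgL.toLp g) = P.proj S ψ := P.cyclic_indicator ψ hS
    have hxf : Integrable (fun x : ℝ => g x * ((x : ℂ) * f x)) μ := by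
      refine Integrable.of_bound (by fun_prop) (1 + ‖z‖ * |z.im|⁻¹)
        (Eventually.of_forall fun x => ?_)
      rcases hgv x with ⟨e, -⟩ | e
      · rw [e, one_mul]
        exact norm_ofReal_mul_inv_sub_le hz x
      · rw [e, zero_mul, norm_zero]
        positivity
    have hTu : inner ℂ (P.proj S ψ) (T ⟨u, huD⟩) = ∫ x, g x * ((x : ℂ) * f x) ∂μ := by
      refine hP.inner_apply_eq h.symm (v := ⟨u, huD⟩) (w := ⟨P.proj S ψ, hP.proj_mem hS hR ψ⟩)
        fun c => ?_
      have hsL : MemLp (f + c • g) 2 μ := hfL.add (hgL.const_smul c)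
      have hsm : Measurable (f + c • g) := hfm.add (hgm.const_smul c)
      have e1 : u + c • P.proj S ψ = P.cyclic ψ (hsL.toLp (f + c • g)) := by
        rw [MemLp.toLp_add hfL (hgL.const_smul c), MemLp.toLp_const_smul c hgL, map_add, map_smul,
          hgu]
      change ∫ x, x ∂(P.scalarMeasure (u + c • P.proj S ψ)) = ∫ x, x ∂(P.scalarMeasure u)
        + ‖c‖ ^ 2 * ∫ x, x ∂(P.scalarMeasure (P.proj S ψ)) + _
      have hi1 : Integrable (fun x => ‖f x‖ ^ 2 * x) μ :=
        (P.integrable_scalarMeasure_cyclic_iff ψ hfm hfL _).1 (hP.integrable_id ⟨u, huD⟩)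
      have hi2 : Integrable (fun x => ‖g x‖ ^ 2 * x) μ := by
        refine (P.integrable_scalarMeasure_cyclic_iff ψ hgm hgL _).1 ?_
        rw [hgu]
        exact hP.integrable_id ⟨P.proj S ψ, hP.proj_mem hS hR ψ⟩
      rw [e1, P.integral_scalarMeasure_cyclic ψ hsm hsL, P.integral_scalarMeasure_cyclic ψ hfm hfL,
        ← hgu, P.integral_scalarMeasure_cyclic ψ hgm hgL]
      have hi3 : Integrable (fun x => ((starRingEnd ℂ) c * (g x * ((x : ℂ) * f x))).re) μ :=
        (hxf.const_mul _).re
      have e2 : ((starRingEnd ℂ) c * ∫ x, g x * ((x : ℂ) * f x) ∂μ).re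
          = ∫ x, ((starRingEnd ℂ) c * (g x * ((x : ℂ) * f x))).re ∂μ := by
        rw [← integral_const_mul]
        exact (integral_re (hxf.const_mul _)).symm
      rw [e2, ← integral_const_mul, ← integral_const_mul, ← integral_add hi1 (hi2.const_mul _),
        ← integral_add (show Integrable (fun x => ‖f x‖ ^ 2 * x + ‖c‖ ^ 2 * (‖g x‖ ^ 2 * x)) μ from
          hi1.add (hi2.const_mul _)) (hi3.const_mul _)]
      refine integral_congr_ae (Eventually.of_forall fun x => ?_)
      have e3 : ∀ a b : ℂ, ‖a + b‖ ^ 2 = ‖a‖ ^ 2 + ‖b‖ ^ 2 + 2 * ((starRingEnd ℂ) b * a).re := by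
        intro a b
        rw [← Complex.normSq_eq_norm_sq, ← Complex.normSq_eq_norm_sq, ← Complex.normSq_eq_norm_sq,
          Complex.normSq_add, mul_comm a]
      change ‖f x + c * g x‖ ^ 2 * x = ‖f x‖ ^ 2 * x + ‖c‖ ^ 2 * (‖g x‖ ^ 2 * x)
        + 2 * ((starRingEnd ℂ) c * (g x * ((x : ℂ) * f x))).re
      rcases hgv x with ⟨e, -⟩ | e
      · rw [e, e3, mul_one, norm_one, one_mul, mul_left_comm ((starRingEnd ℂ) c),
          Complex.re_ofReal_mul]
        ring
      · rw [e]
        simp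
    have hfi : Integrable f μ := Integrable.of_bound hfm.aestronglyMeasurable _
      (Eventually.of_forall hfb)
    have hgf : ∀ k : ℝ → ℂ, ∫ x in S, k x ∂μ = ∫ x, g x * k x ∂μ := by
      intro k
      rw [← integral_indicator hS]
      congr 1
      ext x
      by_cases hx : x ∈ S <;> simp [hg, hx]
    have hone : (((P.scalarMeasure ψ).real S : ℝ) : ℂ) = ∫ x in S, (1 : ℂ) ∂μ := by
      simp [hμ]
    have hψS : inner ℂ (P.proj S ψ) ψ = ∫ x in S, (1 : ℂ) ∂μ := by
      rw [(P.isSpectralProjection hS).inner_left, (P.isSpectralProjection hS).inner_self, hone]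
    rw [hv, inner_sub_right, inner_sub_right, inner_smul_right, hTu, hPu S hS, hψS,
      ← hgf fun x => (x : ℂ) * f x, ← integral_const_mul, ← integral_sub, ← integral_sub]
    · refine integral_eq_zero_of_ae (Eventually.of_forall fun x => ?_)
      change (x : ℂ) * f x - z * f x - 1 = 0
      rw [← sub_mul, hf, mul_inv_cancel₀ (ofReal_sub_ne_zero hz x), sub_self]
    · refine (Integrable.of_bound (C := (1 + ‖z‖ * |z.im|⁻¹) + ‖z‖ * |z.im|⁻¹) (by fun_prop)
        (Eventually.of_forall fun x => ?_))
      refine (norm_sub_le _ _).trans (add_le_add (norm_ofReal_mul_inv_sub_le hz x) ?_)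
      rw [norm_mul]
      gcongr
      exact hfb x
    · exact integrable_const _
    · exact Integrable.of_bound (by fun_prop) _
        (Eventually.of_forall fun x => norm_ofReal_mul_inv_sub_le hz x)
    · exact hfi.restrict.const_mul z
  have h2 : ∀ S, MeasurableSet S → inner ℂ (P.proj S ψ) v = 0 := by
    intro S hS
    refine tendsto_nhds_unique ((P.tendsto_proj_inter_Icc hS ψ).inner tendsto_const_nhds) ?_
    refine tendsto_const_nhds.congr fun n => ?_
    exact (h1 _ (hS.inter measurableSet_Icc) n Set.inter_subset_right).symm
  -- so `v` is orthogonal to the cyclic subspace of `ψ`, which contains that of `u`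
  have h3 : ∀ S S', MeasurableSet S → MeasurableSet S' →
      inner ℂ (P.proj S' u) (P.proj S v) = 0 := by
    intro S S' hS hS'
    rw [(P.isSpectralProjection hS').inner_left, P.proj_proj hS' hS,
      ← (P.isSpectralProjection (hS'.inter hS)).inner_left]
    have h4 : ∀ A, MeasurableSet A → ∀ k : Lp ℂ 2 μ, inner ℂ (P.proj A (P.cyclic ψ k)) v = 0 := by
      intro A hA k
      refine (P.denseRange_stepLp ψ).induction_on k
        (isClosed_eq (by fun_prop) continuous_const) fun x => ?_
      rw [P.cyclic_stepLp, (P.isSpectralProjection hA).inner_left, stepVector,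
        Finsupp.linearCombination_apply, Finsupp.sum_inner]
      refine Finset.sum_eq_zero fun B _ => ?_
      change inner ℂ (x B • P.proj B.1 ψ) (P.proj A v) = 0
      rw [inner_smul_left, ← (P.isSpectralProjection hA).inner_left, P.proj_proj hA B.2,
        h2 _ (hA.inter B.2), mul_zero]
    exact h4 _ (hS'.inter hS) _
  have h5 : v = 0 := by
    -- the truncations of `v` are orthogonal to `ψ`, to `u`, and, as they are orthogonal to the
    -- cyclic subspace of `u`, also to `T u`
    have h6 : ∀ n : ℕ, inner ℂ (P.proj (Set.univ ∩ Set.Icc (-(n : ℝ)) n) v) v = 0 := by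
      intro n
      have hSn : MeasurableSet (Set.univ ∩ Set.Icc (-(n : ℝ)) n) :=
        MeasurableSet.univ.inter measurableSet_Icc
      have e1 := hP.inner_apply_eq_zero h.symm (v := ⟨u, huD⟩)
        (w := ⟨_, hP.proj_mem hSn Set.inter_subset_right v⟩) (fun S hS => h3 _ S hSn hS)
      have e2 := h3 _ _ hSn MeasurableSet.univ
      rw [P.proj_univ] at e2
      have e3 : inner ℂ (P.proj (Set.univ ∩ Set.Icc (-(n : ℝ)) n) v) u = 0 := by
        rw [← inner_conj_symm]
        exact (congrArg (starRingEnd ℂ) e2).trans (map_zero _)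
      have e4 : inner ℂ (P.proj (Set.univ ∩ Set.Icc (-(n : ℝ)) n) v) ψ = 0 := by
        rw [(P.isSpectralProjection hSn).inner_left, ← inner_conj_symm, h2 _ hSn, map_zero]
      conv_lhs => rw [hv]
      rw [inner_sub_right, inner_sub_right, inner_smul_right, e3, e4]
      rw [mul_zero, sub_zero, sub_zero]
      exact e1
    have h7 := tendsto_nhds_unique
      ((P.tendsto_proj_inter_Icc MeasurableSet.univ v).inner (tendsto_const_nhds (x := v)))
      (tendsto_const_nhds.congr fun n => (h6 n).symm)
    rw [P.proj_univ] at h7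
    exact inner_self_eq_zero.1 h7
  have h8 : h.resolvent hz ψ = u := by
    refine h.resolvent_eq hz (x := ⟨u, huD⟩) ?_
    rw [hv, sub_eq_zero, sub_eq_iff_eq_add] at h5
    exact h5
  rw [h8]
  have h9 := hPu _ MeasurableSet.univ
  rw [P.proj_univ, Measure.restrict_univ] at h9
  exact h9

end Uniqueness

/-! ### Schrödinger operators and their Green functions -/

section Schroedinger

variable {V : Type*}

/-- The operator `B + g` on `ℓ²(V)`, for a bounded operator `B` and a potential `g`. -/
noncomputable def schroedinger (B : L2 V →L[ℂ] L2 V) (g : V → ℝ) : L2 V →ₗ.[ℂ] L2 V :=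
  (B : L2 V →ₗ[ℂ] L2 V) +ᵥ potential g

variable {B : L2 V →L[ℂ] L2 V}

theorem mem_schroedinger_domain {g : V → ℝ} {ψ : L2 V} :
    ψ ∈ (schroedinger B g).domain ↔ Memℓp (fun v => (g v : ℂ) * ψ v) 2 := Iff.rfl

/-- A pointwise solution of `(B + g - z) ψ = φ` lies in the domain, since the equation expresses
`g ψ` through square-summable functions. -/
theorem mem_domain_of_pointwise {g : V → ℝ} {ψ φ : L2 V} {z : ℂ}
    (h : ∀ v, (B ψ) v + (g v : ℂ) * ψ v = φ v + z * ψ v) : ψ ∈ (schroedinger B g).domain := by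
  rw [mem_schroedinger_domain]
  have e : (fun v => (g v : ℂ) * ψ v) = ((φ + z • ψ - B ψ : L2 V) : V → ℂ) := by
    ext v
    have := h v
    change (g v : ℂ) * ψ v = φ v + z * ψ v - B ψ v
    rw [← this]
    ring
  rw [e]
  exact lp.memℓp _

theorem sum_norm_sq_le_of_norm_le {f : V → ℂ} {ψ : L2 V} {C : ℝ} (h : ∀ v, ‖f v‖ ≤ C * ‖ψ v‖)
    (s : Finset V) :
    ∑ v ∈ s, ‖f v‖ ^ (2 : ℝ≥0∞).toReal ≤ (C * ‖ψ‖) ^ (2 : ℝ≥0∞).toReal := by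
  have h1 := lp.sum_rpow_le_norm_rpow (p := 2) (by norm_num) ψ s
  simp only [ENNReal.toReal_ofNat, Real.rpow_ofNat] at h1 ⊢
  calc ∑ v ∈ s, ‖f v‖ ^ 2 ≤ ∑ v ∈ s, C ^ 2 * ‖ψ v‖ ^ 2 := by
        refine Finset.sum_le_sum fun v _ => ?_
        rw [← mul_pow]
        exact pow_le_pow_left₀ (norm_nonneg _) (h v) 2
    _ = C ^ 2 * ∑ v ∈ s, ‖ψ v‖ ^ 2 := (Finset.mul_sum _ _ _).symm
    _ ≤ C ^ 2 * ‖ψ‖ ^ 2 := mul_le_mul_of_nonneg_left h1 (sq_nonneg C)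
    _ = (C * ‖ψ‖) ^ 2 := (mul_pow _ _ _).symm

/-- Multiplication by a bounded function on `ℓ²(V)`. -/
noncomputable def mulOperator (m : V → ℂ) {C : ℝ} (hC : 0 ≤ C) (hm : ∀ v, ‖m v‖ ≤ C) :
    L2 V →L[ℂ] L2 V :=
  have hb : ∀ (ψ : L2 V) v, ‖m v * ψ v‖ ≤ C * ‖ψ v‖ := fun ψ v => by
    rw [norm_mul]
    exact mul_le_mul_of_nonneg_right (hm v) (norm_nonneg _)
  LinearMap.mkContinuous
    { toFun := fun ψ => ⟨fun v => m v * ψ v, memℓp_gen' (sum_norm_sq_le_of_norm_le (hb ψ))⟩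
      map_add' := fun φ ψ => by
        ext v
        exact mul_add (m v) (φ v) (ψ v)
      map_smul' := fun c ψ => by
        ext v
        exact mul_left_comm (m v) c (ψ v) }
    C
    (fun ψ => lp.norm_le_of_forall_sum_le (by norm_num) (by positivity)
      (sum_norm_sq_le_of_norm_le (hb ψ)))

theorem mulOperator_apply (m : V → ℂ) {C : ℝ} (hC : 0 ≤ C) (hm : ∀ v, ‖m v‖ ≤ C) (ψ : L2 V)
    (v : V) : mulOperator m hC hm ψ v = m v * ψ v := rfl

theorem inner_mulOperator (m : V → ℂ) {C : ℝ} (hC : 0 ≤ C) (hm : ∀ v, ‖m v‖ ≤ C)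
    (φ ψ : L2 V) :
    inner ℂ (mulOperator m hC hm φ) ψ = inner ℂ φ (mulOperator (fun v => (starRingEnd ℂ) (m v)) hC
      (fun v => (RCLike.norm_conj (m v)).trans_le (hm v)) ψ) := by
  rw [lp.inner_eq_tsum, lp.inner_eq_tsum]
  congr 1
  ext v
  rw [mulOperator_apply, mulOperator_apply]
  simp
  ring

theorem schroedinger_symm (hB : IsSelfAdjoint B) (g : V → ℝ)
    (x y : (schroedinger B g).domain) :
    inner ℂ (schroedinger B g x) (y : L2 V) = inner ℂ (x : L2 V) (schroedinger B g y) := by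
  have h1 : inner ℂ (B (x : L2 V)) (y : L2 V) = inner ℂ (x : L2 V) (B (y : L2 V)) :=
    hB.isSymmetric x y
  have h2 : inner ℂ (potential g x) (y : L2 V) = inner ℂ (x : L2 V) (potential g y) := by
    rw [lp.inner_eq_tsum, lp.inner_eq_tsum]
    congr 1
    ext v
    change inner ℂ ((g v : ℂ) * (x : L2 V) v) ((y : L2 V) v)
      = inner ℂ ((x : L2 V) v) ((g v : ℂ) * (y : L2 V) v)
    simp
    ring
  change inner ℂ (B (x : L2 V) + potential g x) (y : L2 V)
    = inner ℂ (x : L2 V) (B (y : L2 V) + potential g y)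
  rw [inner_add_left, inner_add_right, h1, h2]

/-- Kato–Rellich for a bounded perturbation: for `T = B + g`, `T - z` composed with `(g - z)⁻¹` is
the bounded operator `1 + B (g - z)⁻¹`, whose range is closed by the a priori bound for `T - z`, and
dense by the same bound for the conjugate parameter. -/
theorem schroedinger_isSelfAdjoint (hB : IsSelfAdjoint B) (g : V → ℝ) :
    IsSelfAdjointPMap (schroedinger B g) where
  symm := schroedinger_symm hB g
  surj z hz φ := by
    have hsymm := schroedinger_symm hB g
    have hzp := abs_pos.2 hz
    have hm := norm_inv_ofReal_sub_le hz
    -- `M` is the inverse of `g - z` and `(B + g - z) M = K`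
    let M : L2 V →L[ℂ] L2 V := mulOperator (fun v => ((g v : ℂ) - z)⁻¹) (inv_nonneg.2 hzp.le)
      fun v => hm (g v)
    let K : L2 V →L[ℂ] L2 V := 1 + B ∘L M
    have hK : ∀ χ v, (B (M χ)) v + (g v : ℂ) * (M χ) v = (K χ) v + z * (M χ) v := by
      intro χ v
      change (B (M χ)) v + (g v : ℂ) * (((g v : ℂ) - z)⁻¹ * χ v)
        = χ v + (B (M χ)) v + z * (((g v : ℂ) - z)⁻¹ * χ v)
      have := ofReal_sub_ne_zero hz (g v)
      field_simp
      ring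
    have hKsol : ∀ χ, ∃ x : (schroedinger B g).domain, (x : L2 V) = M χ ∧
        schroedinger B g x - z • (x : L2 V) = K χ := by
      intro χ
      refine ⟨⟨M χ, mem_domain_of_pointwise (hK χ)⟩, rfl, ?_⟩
      ext v
      change (B (M χ)) v + (g v : ℂ) * (M χ) v - z * (M χ) v = (K χ) v
      rw [hK]
      ring
    have hbound : ∀ χ, ‖χ‖ ≤ (1 + ‖B‖ * |z.im|⁻¹) * ‖K χ‖ := by
      intro χ
      obtain ⟨x, hx, hKx⟩ := hKsol χ
      have h1 := IsSelfAdjointPMap.abs_im_mul_norm_le hsymm z x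
      rw [hKx, hx] at h1
      have h2 : ‖M χ‖ ≤ |z.im|⁻¹ * ‖K χ‖ := by
        rw [inv_mul_eq_div, le_div_iff₀ hzp, mul_comm]
        exact h1
      have h3 : χ = K χ - B (M χ) := by
        change χ = χ + B (M χ) - B (M χ)
        abel
      calc ‖χ‖ = ‖K χ - B (M χ)‖ := congrArg norm h3
        _ ≤ ‖K χ‖ + ‖B‖ * ‖M χ‖ := (norm_sub_le _ _).trans (by gcongr; exact B.le_opNorm _)
        _ ≤ ‖K χ‖ + ‖B‖ * (|z.im|⁻¹ * ‖K χ‖) := by gcongr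
        _ = _ := by ring
    have hclosed : IsClosed (LinearMap.range K.toLinearMap : Set (L2 V)) := by
      have h1 : AntilipschitzWith (Real.toNNReal (1 + ‖B‖ * |z.im|⁻¹)) K := by
        refine AddMonoidHomClass.antilipschitz_of_bound K fun χ => ?_
        rw [Real.coe_toNNReal _ (by positivity)]
        exact hbound χ
      exact h1.isClosed_range K.uniformContinuous
    have hort : (LinearMap.range K.toLinearMap)ᗮ = ⊥ := by
      rw [Submodule.eq_bot_iff]
      intro χ hχ
      have h1 : ∀ φ, inner ℂ (K φ) χ = 0 := fun φ => hχ _ ⟨φ, rfl⟩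
      set M' : L2 V →L[ℂ] L2 V := mulOperator (fun v => (starRingEnd ℂ) (((g v : ℂ) - z)⁻¹))
        (inv_nonneg.2 hzp.le) fun v => (RCLike.norm_conj _).trans_le (hm (g v)) with hM'
      have h2 : χ + M' (B χ) = 0 := by
        refine ext_inner_left ℂ fun φ => ?_
        have h3 : inner ℂ (B (M φ)) χ = inner ℂ φ (M' (B χ)) := by
          rw [show inner ℂ (B (M φ)) χ = inner ℂ (M φ) (B χ) from hB.isSymmetric _ _]
          exact inner_mulOperator _ _ _ _ _
        have h4 := h1 φ
        change inner ℂ (φ + B (M φ)) χ = 0 at h4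
        rw [inner_add_left, h3, ← inner_add_right] at h4
        rw [h4, inner_zero_right]
      have h5 : ∀ v, (B χ) v + (g v : ℂ) * χ v = (0 : L2 V) v + (starRingEnd ℂ) z * χ v := by
        intro v
        have h6 : χ v + (starRingEnd ℂ) (((g v : ℂ) - z)⁻¹) * (B χ) v = 0 :=
          congrArg (fun f : L2 V => f v) h2
        have h7 : (g v : ℂ) - (starRingEnd ℂ) z ≠ 0 :=
          ofReal_sub_ne_zero (by simpa using hz) (g v)
        have h8 : χ v = -(((g v : ℂ) - (starRingEnd ℂ) z)⁻¹ * (B χ) v) := by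
          rw [map_inv₀, map_sub, Complex.conj_ofReal] at h6
          exact eq_neg_of_add_eq_zero_left h6
        change (B χ) v + (g v : ℂ) * χ v = 0 + (starRingEnd ℂ) z * χ v
        rw [h8]
        field_simp
        ring
      have h9 := IsSelfAdjointPMap.abs_im_mul_norm_le hsymm ((starRingEnd ℂ) z)
        ⟨χ, mem_domain_of_pointwise h5⟩
      have h10 : schroedinger B g ⟨χ, mem_domain_of_pointwise h5⟩ - (starRingEnd ℂ) z • χ = 0 := by
        ext v
        change (B χ) v + (g v : ℂ) * χ v - (starRingEnd ℂ) z * χ v = 0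
        rw [h5]
        change 0 + (starRingEnd ℂ) z * χ v - (starRingEnd ℂ) z * χ v = 0
        ring
      change |((starRingEnd ℂ) z).im| * ‖χ‖
        ≤ ‖schroedinger B g ⟨χ, _⟩ - (starRingEnd ℂ) z • χ‖ at h9
      rw [h10, norm_zero, Complex.conj_im, abs_neg] at h9
      exact norm_eq_zero.1 (le_antisymm (by nlinarith [norm_nonneg χ]) (norm_nonneg χ))
    have htop : LinearMap.range K.toLinearMap = ⊤ := by
      have : CompleteSpace (LinearMap.range K.toLinearMap) := hclosed.completeSpace_coe
      exact Submodule.orthogonal_eq_bot_iff.1 hort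
    obtain ⟨χ, hχ⟩ : ∃ χ, K χ = φ := LinearMap.range_eq_top.1 htop φ
    obtain ⟨x, -, hx⟩ := hKsol χ
    exact ⟨x, hx.trans hχ⟩

/-- The resolvent `(B + g - z)⁻¹`. -/
noncomputable def schroedingerResolvent (hB : IsSelfAdjoint B) (g : V → ℝ) {z : ℂ}
    (hz : z.im ≠ 0) : L2 V →L[ℂ] L2 V :=
  (schroedinger_isSelfAdjoint hB g).resolvent hz

variable (hB : IsSelfAdjoint B) {z : ℂ} (hz : z.im ≠ 0)

theorem schroedingerResolvent_pointwise (g : V → ℝ) (φ : L2 V) (v : V) :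
    (B (schroedingerResolvent hB g hz φ)) v + (g v : ℂ) * schroedingerResolvent hB g hz φ v
      = φ v + z * schroedingerResolvent hB g hz φ v :=
  congrArg (fun f : L2 V => f v) ((schroedinger_isSelfAdjoint hB g).apply_resolvent hz φ)

theorem schroedingerResolvent_eq {g : V → ℝ} {ψ φ : L2 V}
    (h : ∀ v, (B ψ) v + (g v : ℂ) * ψ v = φ v + z * ψ v) :
    schroedingerResolvent hB g hz φ = ψ := by
  refine (schroedinger_isSelfAdjoint hB g).resolvent_eq hz (x := ⟨ψ, mem_domain_of_pointwise h⟩) ?_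
  ext v
  exact h v

variable [DecidableEq V]

/-- The resolvent depends continuously, in the strong operator topology, on the potential with the
topology of pointwise convergence: finitely supported functions form a core. -/
theorem continuous_schroedingerResolvent (φ : L2 V) :
    Continuous fun g : V → ℝ => schroedingerResolvent hB g hz φ := by
  rw [continuous_iff_continuousAt]
  intro g₀
  rw [ContinuousAt, Metric.tendsto_nhds]
  intro ε hε
  set ψ := schroedingerResolvent hB g₀ hz φ with hψ
  have hp : (2 : ℝ≥0∞) ≠ ⊤ := by norm_num
  let cut : L2 V → Finset V → L2 V := fun f s => ∑ v ∈ s, lp.single 2 v (f v)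
  have hcut : ∀ f, Tendsto (cut f) atTop (𝓝 f) := fun f => lp.hasSum_single hp f
  have hcutv : ∀ f s v, cut f s v = if v ∈ s then f v else 0 := by
    intro f s v
    change (∑ w ∈ s, lp.single 2 w (f w) : L2 V) v = _
    rw [lp.coeFn_sum, Finset.sum_apply]
    simp [lp.single_apply, Pi.single_apply]
  -- `η` is `g₀ ψ` and `φs s` is `(B + g₀ - z) (cut ψ s)`
  let η : L2 V := φ + z • ψ - B ψ
  have hη : ∀ v, η v = (g₀ v : ℂ) * ψ v := by
    intro v
    change φ v + z * ψ v - B ψ v = _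
    rw [← schroedingerResolvent_pointwise hB hz g₀ φ v]
    ring
  let φs : Finset V → L2 V := fun s => B (cut ψ s) + cut η s - z • cut ψ s
  have hφs : Tendsto φs atTop (𝓝 φ) := by
    have h1 := (((B.continuous.tendsto ψ).comp (hcut ψ)).add (hcut η)).sub ((hcut ψ).const_smul z)
    have e : B ψ + η - z • ψ = φ := by
      change B ψ + (φ + z • ψ - B ψ) - z • ψ = φ
      abel
    rwa [e] at h1
  have hδ : 0 < ε / 3 := by positivity
  have hδ' : 0 < ε / 3 * |z.im| := mul_pos hδ (abs_pos.2 hz)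
  obtain ⟨s, hs1, hs2⟩ := ((Metric.tendsto_nhds.1 (hcut ψ) _ hδ).and
    (Metric.tendsto_nhds.1 hφs _ hδ')).exists
  rw [dist_eq_norm] at hs1 hs2
  -- `corr g` accounts for the change of the potential from `g₀` to `g` on the finite set `s`
  let corr : (V → ℝ) → L2 V := fun g => ∑ v ∈ s, lp.single 2 v (((g v - g₀ v : ℝ) : ℂ) * ψ v)
  have hcorr : Tendsto corr (𝓝 g₀) (𝓝 0) := by
    have h1 : Continuous corr := by
      refine continuous_finsetSum _ fun v _ => ?_
      refine (lp.isometry_single (E := fun _ : V => ℂ) (p := 2) v).continuous.comp ?_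
      fun_prop
    have h2 := h1.tendsto g₀
    have e : corr g₀ = 0 := by
      refine Finset.sum_eq_zero fun v _ => ?_
      rw [sub_self, Complex.ofReal_zero, zero_mul, lp.single_zero]
    rwa [e] at h2
  have hcorrv : ∀ g v, corr g v = if v ∈ s then ((g v : ℂ) - g₀ v) * ψ v else 0 := by
    intro g v
    change (∑ w ∈ s, lp.single 2 w (((g w - g₀ w : ℝ) : ℂ) * ψ w) : L2 V) v = _
    rw [lp.coeFn_sum, Finset.sum_apply]
    simp [lp.single_apply, Pi.single_apply]
  filter_upwards [Metric.tendsto_nhds.1 hcorr _ hδ'] with g hg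
  rw [dist_zero_right] at hg
  have h1 : schroedingerResolvent hB g hz (φs s + corr g) = cut ψ s := by
    refine schroedingerResolvent_eq hB hz fun v => ?_
    change (B (cut ψ s)) v + (g v : ℂ) * cut ψ s v
      = (B (cut ψ s)) v + cut η s v - z * cut ψ s v + corr g v + z * cut ψ s v
    rw [hcutv, hcutv, hcorrv, hη]
    split_ifs <;> ring
  have hR : ∀ χ, ‖χ‖ < ε / 3 * |z.im| → ‖schroedingerResolvent hB g hz χ‖ < ε / 3 := by
    intro χ hχ
    refine ((schroedinger_isSelfAdjoint hB g).norm_resolvent_apply_le hz χ).trans_lt ?_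
    rwa [inv_mul_eq_div, div_lt_iff₀ (abs_pos.2 hz)]
  have h2 : schroedingerResolvent hB g hz φ - ψ
      = (cut ψ s - ψ) - schroedingerResolvent hB g hz (φs s - φ)
        - schroedingerResolvent hB g hz (corr g) := by
    rw [← h1, map_add _ (φs s) (corr g), map_sub _ (φs s) φ]
    abel
  rw [dist_eq_norm, h2]
  calc _ ≤ ‖cut ψ s - ψ‖ + ‖schroedingerResolvent hB g hz (φs s - φ)‖
        + ‖schroedingerResolvent hB g hz (corr g)‖ :=
        (norm_sub_le _ _).trans (add_le_add_left (norm_sub_le _ _) _)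
    _ < ε / 3 + ε / 3 + ε / 3 := by
        have := hR _ hs2
        have := hR _ hg
        linarith
    _ = ε := by ring

/-- The Green function: the diagonal matrix element of the resolvent at `v`. -/
noncomputable def green (g : V → ℝ) (v : V) : ℂ :=
  schroedingerResolvent hB g hz (lp.single 2 v (1 : ℂ)) v

theorem green_eq_inner (g : V → ℝ) (v : V) :
    green hB hz g v = inner ℂ (lp.single 2 v (1 : ℂ) : L2 V)
      (schroedingerResolvent hB g hz (lp.single 2 v (1 : ℂ))) := by
  rw [lp.inner_single_left]
  simp [green]

theorem continuous_green (v : V) : Continuous fun g => green hB hz g v := by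
  simp only [green_eq_inner]
  exact continuous_const.inner (continuous_schroedingerResolvent hB hz _)

/-- The Green function maps the upper half-plane into itself. -/
theorem im_green_pos (hz' : 0 < z.im) (g : V → ℝ) (v : V) : 0 < (green hB hz g v).im := by
  rw [green_eq_inner]
  have h1 := (schroedinger_isSelfAdjoint hB g).im_inner_resolvent hz (lp.single 2 v (1 : ℂ))
  refine h1.symm ▸ mul_pos hz' (pow_pos (norm_pos_iff.2 fun h2 => ?_) 2)
  have h3 := (schroedinger_isSelfAdjoint hB g).resolvent_injective hz (h2.trans (map_zero _).symm)
  have h4 := congrArg (fun f : L2 V => f v) h3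
  rw [lp.single_apply_self] at h4
  exact one_ne_zero h4

/-- Rank-one perturbation: changing the potential at `v` by `s` shifts the inverse Green function
at `v` by `s`. -/
theorem inv_green_update (hz' : 0 < z.im) (g : V → ℝ) (v : V) (s : ℝ) :
    (green hB hz (Function.update g v s) v)⁻¹ = (green hB hz g v)⁻¹ + ((s - g v : ℝ) : ℂ) := by
  set F := green hB hz g v with hF
  set F' := green hB hz (Function.update g v s) v with hF'
  have hne : F ≠ 0 := fun h => (im_green_pos hB hz hz' g v).ne' (by rw [← hF, h, Complex.zero_im])
  have hne' : F' ≠ 0 := fun h =>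
    (im_green_pos hB hz hz' (Function.update g v s) v).ne' (by rw [← hF', h, Complex.zero_im])
  have h1 : schroedingerResolvent hB (Function.update g v s) hz
      ((1 + ((s - g v : ℝ) : ℂ) * F) • lp.single 2 v (1 : ℂ))
      = schroedingerResolvent hB g hz (lp.single 2 v (1 : ℂ)) := by
    refine schroedingerResolvent_eq hB hz fun w => ?_
    have h2 := schroedingerResolvent_pointwise hB hz g (lp.single 2 v (1 : ℂ)) w
    change _ = (1 + ((s - g v : ℝ) : ℂ) * F) * (lp.single 2 v (1 : ℂ) : L2 V) w + _
    by_cases hw : w = v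
    · subst hw
      rw [lp.single_apply_self] at h2 ⊢
      rw [Function.update_self]
      change _ + _ * F = 1 + _ at h2
      change _ + _ * F = _
      push_cast
      linear_combination h2
    · rw [Function.update_of_ne hw, lp.single_apply_ne _ _ _ hw] at *
      rw [h2, mul_zero]
  rw [map_smul] at h1
  have h3 : (1 + ((s - g v : ℝ) : ℂ) * F) * F' = F := congrArg (fun f : L2 V => f v) h1
  have h4 : F⁻¹ + ((s - g v : ℝ) : ℂ) = (1 + ((s - g v : ℝ) : ℂ) * F) * F⁻¹ := by
    field_simp
  rw [h4]
  have h5 : 1 + ((s - g v : ℝ) : ℂ) * F = F * F'⁻¹ := by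
    rw [← h3, mul_assoc, mul_inv_cancel₀ hne', mul_one, h3]
  rw [h5]
  field_simp

end Schroedinger

/-! ### The recursion for the Green function on the tree -/

section Tree

theorem adjacencyOperator_apply {V : Type*} (G : SimpleGraph V) [G.LocallyFinite] {d : ℕ}
    (hG : ∀ v, G.degree v ≤ d) (ψ : L2 V) (v : V) :
    adjacencyOperator G hG ψ v = ∑ w ∈ G.neighborFinset v, ψ w := rfl

theorem adjacencyOperator_isSelfAdjoint {V : Type*} [DecidableEq V] (G : SimpleGraph V)
    [G.LocallyFinite] {d : ℕ} (hG : ∀ v, G.degree v ≤ d) :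
    IsSelfAdjoint (adjacencyOperator G hG) := by
  have hp : (2 : ℝ≥0∞) ≠ ⊤ := by norm_num
  have hA : ∀ v w, adjacencyOperator G hG (lp.single 2 v (1 : ℂ)) w
      = (starRingEnd ℂ) (adjacencyOperator G hG (lp.single 2 w (1 : ℂ)) v) := by
    intro v w
    rw [adjacencyOperator_apply, adjacencyOperator_apply]
    have h : v ∈ G.neighborFinset w ↔ w ∈ G.neighborFinset v := by
      rw [SimpleGraph.mem_neighborFinset, SimpleGraph.mem_neighborFinset, SimpleGraph.adj_comm]
    simp only [lp.single_apply, Pi.single_apply, Finset.sum_ite_eq', h]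
    split_ifs <;> simp
  have h1 : ∀ v, star (adjacencyOperator G hG) (lp.single 2 v (1 : ℂ))
      = adjacencyOperator G hG (lp.single 2 v (1 : ℂ)) := by
    intro v
    ext w
    have h2 : ∀ f : L2 V, f w = inner ℂ (lp.single 2 w (1 : ℂ) : L2 V) f := by
      intro f
      rw [lp.inner_single_left]
      simp
    rw [h2 (star (adjacencyOperator G hG) _), ContinuousLinearMap.star_eq_adjoint,
      ContinuousLinearMap.adjoint_inner_right, lp.inner_single_right, hA v w]
    simp
  rw [isSelfAdjoint_iff]
  refine ContinuousLinearMap.ext fun ψ => ?_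
  have h3 := lp.hasSum_single hp ψ
  have h4 : ∀ v, lp.single 2 v (ψ v) = (ψ v) • (lp.single 2 v (1 : ℂ) : L2 V) := by
    intro v
    rw [← lp.single_smul, smul_eq_mul, mul_one]
  have h5 := (star (adjacencyOperator G hG)).hasSum h3
  have h6 := (adjacencyOperator G hG).hasSum h3
  refine h5.unique ?_
  convert h6 using 2 with v
  rw [h4, map_smul, map_smul, h1]

variable {d : ℕ}

/-- The kinetic term `-t A` of the Hamiltonian. -/
noncomputable def hopping (d : ℕ) (t : ℝ) : L2 (Vertex d) →L[ℂ] L2 (Vertex d) :=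
  -(t : ℂ) • adjacencyOperator (betheLattice d) fun v => (betheLattice_regular d v).le

theorem hopping_apply (t : ℝ) (ψ : L2 (Vertex d)) (v : Vertex d) :
    hopping d t ψ v = -(t : ℂ) * ∑ w ∈ (betheLattice d).neighborFinset v, ψ w := rfl

theorem hopping_isSelfAdjoint (t : ℝ) : IsSelfAdjoint (hopping d t) := by
  refine IsSelfAdjoint.smul ?_ (adjacencyOperator_isSelfAdjoint _ _)
  rw [isSelfAdjoint_iff]
  simp

/-- The neighbour of the root with label `i`. -/
def child (i : Fin d) : Vertex d := ⟨[i], List.isChain_singleton i⟩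

/-- The branch of the tree at the neighbour `i` of the root: the words with last letter `i`. -/
def branch (i : Fin d) : Set (Vertex d) := {v | v.1.getLast? = some i}

theorem child_mem_branch (i : Fin d) : child i ∈ branch i := rfl

theorem root_notMem_branch (i : Fin d) : root d ∉ branch i := by
  simp [branch, root]

theorem neighborFinset_root :
    (betheLattice d).neighborFinset (root d) = Finset.univ.image child := by
  ext w
  rw [SimpleGraph.mem_neighborFinset, Finset.mem_image]
  constructor
  · rintro (⟨a, h⟩ | ⟨a, h⟩)
    · exact absurd h (by simp [root])
    · exact ⟨a, Finset.mem_univ _, Subtype.ext h.symm⟩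
  · rintro ⟨a, -, rfl⟩
    exact Or.inr ⟨a, rfl⟩

theorem child_injective : Function.Injective (child (d := d)) := by
  intro a b h
  simpa [child] using congrArg Subtype.val h

/-- A neighbour of a vertex of a branch is in the same branch, unless it is the root. -/
theorem mem_branch_of_adj {i : Fin d} {v w : Vertex d} (hv : v ∈ branch i)
    (h : (betheLattice d).Adj v w) : w ∈ branch i ∨ w = root d := by
  rcases h with ⟨a, h⟩ | ⟨a, h⟩
  · rcases eq_or_ne w.1 [] with hw | hw
    · exact Or.inr (Subtype.ext hw)
    · left
      change w.1.getLast? = some i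
      have h1 : v.1.getLast? = some i := hv
      rw [h] at h1
      rw [← h1, List.getLast?_cons_of_ne_nil hw]
  · left
    have h1 : v.1.getLast? = some i := hv
    have h2 : v.1 ≠ [] := by
      intro h3
      rw [h3] at h1
      simp at h1
    change w.1.getLast? = some i
    rw [h, List.getLast?_cons_of_ne_nil h2, h1]

theorem adj_root_iff {i : Fin d} {v : Vertex d} (hv : v ∈ branch i) :
    (betheLattice d).Adj v (root d) ↔ v = child i := by
  constructor
  · rintro (⟨a, h⟩ | ⟨a, h⟩)
    · have h1 : v.1.getLast? = some i := hv
      rw [h] at h1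
      have h2 : a = i := by simpa [root] using h1
      subst h2
      exact Subtype.ext h
    · exact absurd h (by simp [root])
  · rintro rfl
    exact Or.inl ⟨i, rfl⟩

open Classical in
/-- The restriction of functions to a branch. -/
noncomputable def branchProj (i : Fin d) : L2 (Vertex d) →L[ℂ] L2 (Vertex d) :=
  mulOperator (C := 1) (fun v => if v ∈ branch i then 1 else 0) zero_le_one
    (fun v => by split_ifs <;> simp)

open Classical in
theorem branchProj_apply (i : Fin d) (ψ : L2 (Vertex d)) (v : Vertex d) :
    branchProj i ψ v = if v ∈ branch i then ψ v else 0 := by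
  change (if v ∈ branch i then 1 else 0) * ψ v = _
  split_ifs <;> simp

theorem branchProj_isSelfAdjoint (i : Fin d) : IsSelfAdjoint (branchProj i) := by
  rw [ContinuousLinearMap.isSelfAdjoint_iff_isSymmetric]
  intro φ ψ
  refine (inner_mulOperator _ _ _ φ ψ).trans ?_
  congr 1
  ext v
  rw [mulOperator_apply]
  change _ = branchProj i ψ v
  rw [branchProj_apply]
  split_ifs <;> simp

/-- The kinetic term of the branch `i`, with all edges outside of the branch removed. It acts on the
functions on the whole tree, vanishing on those supported off the branch. -/
noncomputable def branchHopping (t : ℝ) (i : Fin d) : L2 (Vertex d) →L[ℂ] L2 (Vertex d) :=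
  branchProj i * hopping d t * branchProj i

theorem branchHopping_isSelfAdjoint (t : ℝ) (i : Fin d) : IsSelfAdjoint (branchHopping t i) := by
  rw [isSelfAdjoint_iff, branchHopping, star_mul, star_mul, (branchProj_isSelfAdjoint i).star_eq,
    (hopping_isSelfAdjoint t).star_eq, mul_assoc]

theorem branchHopping_apply_of_notMem (t : ℝ) {i : Fin d} {v : Vertex d} (hv : v ∉ branch i)
    (ψ : L2 (Vertex d)) : branchHopping t i ψ v = 0 := by
  change branchProj i (hopping d t (branchProj i ψ)) v = 0
  rw [branchProj_apply, if_neg hv]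

variable (t : ℝ) {z : ℂ} (hz : z.im ≠ 0)

/-- The Green function at the root. -/
noncomputable def rootGreen (g : Vertex d → ℝ) : ℂ :=
  green (hopping_isSelfAdjoint t) hz g (root d)

/-- The Green function of the branch `i` at its root. -/
noncomputable def branchGreen (i : Fin d) (g : Vertex d → ℝ) : ℂ :=
  green (branchHopping_isSelfAdjoint t i) hz g (child i)

/-- Cutting the edge between the root and the branch `i`: on the branch, the Green function with
source at the root is `t G₀₀` times the Green function of the branch. -/
theorem branchProj_resolvent (i : Fin d) (g : Vertex d → ℝ) :
    branchProj i (schroedingerResolvent (hopping_isSelfAdjoint t) g hz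
        (lp.single 2 (root d) (1 : ℂ)))
      = ((t : ℂ) * rootGreen t hz g) •
        schroedingerResolvent (branchHopping_isSelfAdjoint t i) g hz
          (lp.single 2 (child i) (1 : ℂ)) := by
  set ψ := schroedingerResolvent (hopping_isSelfAdjoint t) g hz (lp.single 2 (root d) (1 : ℂ))
    with hψ
  have hG : rootGreen t hz g = ψ (root d) := rfl
  rw [← map_smul]
  symm
  refine schroedingerResolvent_eq _ hz fun v => ?_
  change _ = ((t : ℂ) * rootGreen t hz g) * (lp.single 2 (child i) (1 : ℂ) : L2 (Vertex d)) v + _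
  by_cases hv : v ∈ branch i
  · have h1 := schroedingerResolvent_pointwise (hopping_isSelfAdjoint t) hz g
      (lp.single 2 (root d) (1 : ℂ)) v
    have hvr : v ≠ root d := fun h => root_notMem_branch i (h ▸ hv)
    rw [lp.single_apply_ne _ _ _ hvr, hopping_apply, ← hψ] at h1
    have h2 : ∑ w ∈ (betheLattice d).neighborFinset v, ψ w
        = ∑ w ∈ (betheLattice d).neighborFinset v, branchProj i (branchProj i ψ) w
          + ψ (root d) * (lp.single 2 (child i) (1 : ℂ) : L2 (Vertex d)) v := by
      have h3 : ∀ w ∈ (betheLattice d).neighborFinset v, ψ w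
          = branchProj i (branchProj i ψ) w + if w = root d then ψ (root d) else 0 := by
        intro w hw
        rw [SimpleGraph.mem_neighborFinset] at hw
        rw [branchProj_apply, branchProj_apply]
        rcases mem_branch_of_adj hv hw with h4 | h4
        · have h5 : w ≠ root d := fun h => root_notMem_branch i (h ▸ h4)
          rw [if_pos h4, if_pos h4, if_neg h5, add_zero]
        · rw [h4, if_neg (root_notMem_branch i), if_pos rfl, zero_add]
      rw [Finset.sum_congr rfl h3, Finset.sum_add_distrib, Finset.sum_ite_eq']
      congr 1
      have h4 : root d ∈ (betheLattice d).neighborFinset v ↔ v = child i := by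
        rw [SimpleGraph.mem_neighborFinset, adj_root_iff hv]
      by_cases h6 : v = child i
      · rw [if_pos (h4.2 h6), h6, lp.single_apply_self, mul_one]
      · rw [if_neg fun h => h6 (h4.1 h), lp.single_apply_ne _ _ _ h6, mul_zero]
    change branchProj i (hopping d t (branchProj i (branchProj i ψ))) v + _ = _
    rw [branchProj_apply, if_pos hv, hopping_apply, branchProj_apply, if_pos hv, hG]
    rw [h2] at h1
    linear_combination h1
  · have hvc : v ≠ child i := fun h => hv (h ▸ child_mem_branch i)
    rw [branchHopping_apply_of_notMem t hv, branchProj_apply, if_neg hv,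
      lp.single_apply_ne _ _ _ hvc]
    simp

/-- The recursion for the Green function on the tree: `G = 1 / (g₀ - z - t² ∑ F_i)`, where `F_i` is
the Green function of the branch `i` at its root. -/
theorem rootGreen_mul (g : Vertex d → ℝ) :
    rootGreen t hz g * ((g (root d) : ℂ) - (z + t ^ 2 * ∑ i, branchGreen t hz i g)) = 1 := by
  have h1 := schroedingerResolvent_pointwise (hopping_isSelfAdjoint t) hz g
    (lp.single 2 (root d) (1 : ℂ)) (root d)
  rw [lp.single_apply_self, hopping_apply, neighborFinset_root,
    Finset.sum_image fun a _ b _ h => child_injective h] at h1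
  have h2 : ∀ i : Fin d, schroedingerResolvent (hopping_isSelfAdjoint t) g hz
      (lp.single 2 (root d) (1 : ℂ)) (child i) = t * rootGreen t hz g * branchGreen t hz i g := by
    intro i
    have h3 := congrArg (fun f : L2 (Vertex d) => f (child i)) (branchProj_resolvent t hz i g)
    change branchProj i _ (child i) = t * rootGreen t hz g * branchGreen t hz i g at h3
    rwa [branchProj_apply, if_pos (child_mem_branch i)] at h3
  rw [Finset.sum_congr rfl fun i _ => h2 i, ← Finset.mul_sum] at h1
  change _ + _ * rootGreen t hz g = 1 + z * rootGreen t hz g at h1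
  linear_combination h1

/-- The Green function of a branch does not depend on the potential at the root. -/
theorem branchGreen_update_root (i : Fin d) (g : Vertex d → ℝ) (s : ℝ) :
    branchGreen t hz i (Function.update g (root d) s) = branchGreen t hz i g := by
  -- the root is isolated in the branch operator, so the solution `φ` vanishes there
  set φ := schroedingerResolvent (branchHopping_isSelfAdjoint t i) g hz
    (lp.single 2 (child i) (1 : ℂ)) with hφ
  have hpt := schroedingerResolvent_pointwise (branchHopping_isSelfAdjoint t i) hz g
    (lp.single 2 (child i) (1 : ℂ))
  have hrc : root d ≠ child i := fun h => root_notMem_branch i (h ▸ child_mem_branch i)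
  have h0 : φ (root d) = 0 := by
    have h1 := hpt (root d)
    rw [branchHopping_apply_of_notMem t (root_notMem_branch i), lp.single_apply_ne _ _ _ hrc,
      zero_add, zero_add, ← sub_eq_zero, ← sub_mul] at h1
    exact (mul_eq_zero.1 h1).resolve_left (ofReal_sub_ne_zero hz _)
  have h2 : schroedingerResolvent (branchHopping_isSelfAdjoint t i) (Function.update g (root d) s)
      hz (lp.single 2 (child i) (1 : ℂ)) = φ := by
    refine schroedingerResolvent_eq _ hz fun v => ?_
    by_cases hv : v = root d
    · subst hv
      rw [h0, branchHopping_apply_of_notMem t (root_notMem_branch i), lp.single_apply_ne _ _ _ hrc]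
      simp
    · rw [Function.update_of_ne hv]
      exact hpt v
  exact congrArg (fun f : L2 (Vertex d) => f (child i)) h2

end Tree

/-! ### The Poisson kernel and Stieltjes inversion -/

section Poisson

/-- The (unnormalized) Poisson kernel `Im (x - (l + i η))⁻¹ = η / ((x - l)² + η²)`. -/
noncomputable def poisson (η l x : ℝ) : ℝ := η / ((x - l) ^ 2 + η ^ 2)

theorem poisson_nonneg {η : ℝ} (hη : 0 ≤ η) (l x : ℝ) : 0 ≤ poisson η l x := by
  unfold poisson
  positivity

theorem continuous_poisson {η : ℝ} (hη : 0 < η) :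
    Continuous fun p : ℝ × ℝ => poisson η p.1 p.2 := by
  unfold poisson
  exact continuous_const.div (by fun_prop) fun p => by positivity

theorem poisson_le {η : ℝ} (hη : 0 < η) (l x : ℝ) : poisson η l x ≤ η⁻¹ := by
  unfold poisson
  rw [div_le_iff₀ (by positivity), inv_mul_eq_div, le_div_iff₀ hη]
  nlinarith [sq_nonneg (x - l)]

theorem im_inv_ofReal_sub (l η x : ℝ) :
    (((x : ℂ) - ⟨l, η⟩)⁻¹).im = poisson η l x := by
  rw [Complex.inv_im, Complex.normSq_apply, poisson]
  simp
  ring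

/-- The integral `∫ l in a..b, poisson η l x` of the Poisson kernel, in closed form. -/
noncomputable def poissonInterval (η a b x : ℝ) : ℝ :=
  Real.arctan ((b - x) / η) - Real.arctan ((a - x) / η)

theorem lintegral_poisson_Icc {η : ℝ} (hη : 0 < η) {a b : ℝ} (hab : a ≤ b) (x : ℝ) :
    ∫⁻ l in Set.Icc a b, ENNReal.ofReal (poisson η l x)
      = ENNReal.ofReal (poissonInterval η a b x) := by
  have hc : Continuous fun l => poisson η l x :=
    (continuous_poisson hη).comp (by fun_prop : Continuous fun l : ℝ => (l, x))
  have hd : ∀ l ∈ Set.uIcc a b,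
      HasDerivAt (fun l => Real.arctan ((l - x) / η)) (poisson η l x) l := by
    intro l _
    have h1 := (((hasDerivAt_id l).sub_const x).div_const η).arctan
    have e : poisson η l x = 1 / (1 + ((id l - x) / η) ^ 2) * (1 / η) := by
      unfold poisson
      simp only [id]
      field_simp
      ring
    rw [e]
    exact h1
  rw [← ofReal_integral_eq_lintegral_ofReal
    (hc.continuousOn.integrableOn_compact isCompact_Icc)
    (Eventually.of_forall fun l => poisson_nonneg hη.le l x), integral_Icc_eq_integral_Ioc,
    ← intervalIntegral.integral_of_le hab,
    intervalIntegral.integral_eq_sub_of_hasDerivAt hd (hc.intervalIntegrable _ _)]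
  rfl

theorem poissonInterval_le (η a b x : ℝ) : poissonInterval η a b x ≤ Real.pi := by
  have h1 := Real.arctan_lt_pi_div_two ((b - x) / η)
  have h2 := Real.neg_pi_div_two_lt_arctan ((a - x) / η)
  unfold poissonInterval
  linarith

theorem continuous_poissonInterval (η a b : ℝ) : Continuous (poissonInterval η a b) := by
  unfold poissonInterval
  exact (Real.continuous_arctan.comp (by fun_prop)).sub (Real.continuous_arctan.comp (by fun_prop))

/-- The limit of `arctan (y / η)` as `η → 0`. -/
noncomputable def stepLimit (y : ℝ) : ℝ :=
  if 0 < y then Real.pi / 2 else if y < 0 then -(Real.pi / 2) else 0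

theorem tendsto_arctan_div {η : ℕ → ℝ} (hη : ∀ n, 0 < η n) (h0 : Tendsto η atTop (𝓝 0)) (y : ℝ) :
    Tendsto (fun n => Real.arctan (y / η n)) atTop (𝓝 (stepLimit y)) := by
  have h1 : Tendsto (fun n => (η n)⁻¹) atTop atTop :=
    (tendsto_nhdsWithin_iff.2 ⟨h0, Eventually.of_forall hη⟩).inv_tendsto_nhdsGT_zero
  unfold stepLimit
  rcases lt_trichotomy y 0 with hy | hy | hy
  · rw [if_neg hy.not_gt, if_pos hy]
    exact (tendsto_nhdsWithin_iff.1 Real.tendsto_arctan_atBot).1.comp (h1.const_mul_atTop_of_neg hy)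
  · simp [hy]
  · rw [if_pos hy]
    exact (tendsto_nhdsWithin_iff.1 Real.tendsto_arctan_atTop).1.comp (h1.const_mul_atTop hy)

/-- The limit of the Poisson integrals of `[a, b]`, namely `π` times the indicator function with
the value `1 / 2` at the end points. -/
noncomputable def poissonLimit (a b x : ℝ) : ℝ := stepLimit (b - x) - stepLimit (a - x)

theorem poissonLimit_le {a b : ℝ} (hab : a ≤ b) (x : ℝ) :
    ENNReal.ofReal (poissonLimit a b x)
      ≤ (Set.Icc a b).indicator (fun _ => ENNReal.ofReal Real.pi) x := by
  have hpi := Real.pi_pos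
  by_cases hx : x ∈ Set.Icc a b
  · rw [Set.indicator_of_mem hx]
    refine ENNReal.ofReal_le_ofReal ?_
    unfold poissonLimit stepLimit
    split_ifs <;> linarith
  · rw [Set.indicator_of_notMem hx]
    rw [Set.mem_Icc, not_and_or, not_le, not_le] at hx
    refine (ENNReal.ofReal_eq_zero.2 (le_of_eq ?_)).le
    unfold poissonLimit stepLimit
    rcases hx with hx | hx
    · rw [if_pos (by linarith), if_pos (by linarith), sub_self]
    · rw [if_neg (by linarith), if_pos (by linarith), if_neg (by linarith), if_pos (by linarith),
        sub_self]

theorem le_poissonLimit (a b x : ℝ) :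
    (Set.Ioo a b).indicator (fun _ => ENNReal.ofReal Real.pi) x
      ≤ ENNReal.ofReal (poissonLimit a b x) := by
  by_cases hx : x ∈ Set.Ioo a b
  · rw [Set.indicator_of_mem hx]
    refine ENNReal.ofReal_le_ofReal (le_of_eq ?_)
    unfold poissonLimit stepLimit
    rw [if_pos (by linarith [hx.2]), if_neg (by linarith [hx.1]), if_pos (by linarith [hx.1])]
    ring
  · rw [Set.indicator_of_notMem hx]
    exact zero_le

variable (μ : Measure ℝ) [IsFiniteMeasure μ]

/-- Stieltjes inversion: the Poisson integrals of `μ`, integrated over `[a, b]`, converge. -/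
theorem tendsto_lintegral_poisson {η : ℕ → ℝ} (hη : ∀ n, 0 < η n) (h0 : Tendsto η atTop (𝓝 0))
    {a b : ℝ} (hab : a ≤ b) :
    Tendsto (fun n => ∫⁻ l in Set.Icc a b, ∫⁻ x, ENNReal.ofReal (poisson (η n) l x) ∂μ) atTop
      (𝓝 (∫⁻ x, ENNReal.ofReal (poissonLimit a b x) ∂μ)) := by
  have h1 : ∀ n, ∫⁻ l in Set.Icc a b, ∫⁻ x, ENNReal.ofReal (poisson (η n) l x) ∂μ
      = ∫⁻ x, ENNReal.ofReal (poissonInterval (η n) a b x) ∂μ := by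
    intro n
    rw [lintegral_lintegral_swap]
    · simp_rw [lintegral_poisson_Icc (hη n) hab]
    · exact ((continuous_poisson (hη n)).measurable.ennreal_ofReal).aemeasurable
  simp_rw [h1]
  refine tendsto_lintegral_of_dominated_convergence (fun _ => ENNReal.ofReal Real.pi)
    (fun n => (continuous_poissonInterval (η n) a b).measurable.ennreal_ofReal)
    (fun n => Eventually.of_forall fun x => ENNReal.ofReal_le_ofReal (poissonInterval_le _ _ _ _))
    (by
      rw [lintegral_const]
      exact ENNReal.mul_ne_top ENNReal.ofReal_ne_top (measure_ne_top _ _))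
    (Eventually.of_forall fun x => ?_)
  exact (ENNReal.continuous_ofReal.tendsto _).comp
    ((tendsto_arctan_div hη h0 (b - x)).sub (tendsto_arctan_div hη h0 (a - x)))

omit [IsFiniteMeasure μ] in
theorem lintegral_poissonLimit_le {a b : ℝ} (hab : a ≤ b) :
    ∫⁻ x, ENNReal.ofReal (poissonLimit a b x) ∂μ ≤ ENNReal.ofReal Real.pi * μ (Set.Icc a b) := by
  refine (lintegral_mono (poissonLimit_le hab)).trans ?_
  rw [lintegral_indicator_const measurableSet_Icc]

omit [IsFiniteMeasure μ] in
theorem le_lintegral_poissonLimit (a b : ℝ) :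
    ENNReal.ofReal Real.pi * μ (Set.Ioo a b) ≤ ∫⁻ x, ENNReal.ofReal (poissonLimit a b x) ∂μ := by
  refine le_trans ?_ (lintegral_mono (le_poissonLimit a b))
  rw [lintegral_indicator_const measurableSet_Ioo]

theorem continuous_integral_poisson {η : ℝ} (hη : 0 < η) :
    Continuous fun l => ∫ x, poisson η l x ∂μ := by
  refine continuous_of_dominated (bound := fun _ => η⁻¹) (fun l => ?_) (fun l => ?_)
    (integrable_const _) (Eventually.of_forall fun x => ?_)
  · exact ((continuous_poisson hη).comp
      (by fun_prop : Continuous fun x : ℝ => (l, x))).aestronglyMeasurable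
  · refine Eventually.of_forall fun x => ?_
    rw [Real.norm_of_nonneg (poisson_nonneg hη.le l x)]
    exact poisson_le hη l x
  · exact (continuous_poisson hη).comp (by fun_prop : Continuous fun l : ℝ => (l, x))

theorem integrable_poisson {η : ℝ} (hη : 0 < η) (l : ℝ) :
    Integrable (fun x => poisson η l x) μ := by
  refine Integrable.of_bound ((continuous_poisson hη).comp
      (by fun_prop : Continuous fun x : ℝ => (l, x))).aestronglyMeasurable η⁻¹
    (Eventually.of_forall fun x => ?_)
  rw [Real.norm_of_nonneg (poisson_nonneg hη.le l x)]
  exact poisson_le hη l x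

theorem lintegral_poisson_eq {η : ℝ} (hη : 0 < η) (l : ℝ) :
    ∫⁻ x, ENNReal.ofReal (poisson η l x) ∂μ = ENNReal.ofReal (∫ x, poisson η l x ∂μ) :=
  (ofReal_integral_eq_lintegral_ofReal (integrable_poisson μ hη l)
    (Eventually.of_forall fun x => poisson_nonneg hη.le l x)).symm

omit [IsFiniteMeasure μ] in
theorem tendsto_measure_Ioo_shrink {a b : ℝ} {η : ℕ → ℝ} (h0 : Tendsto η atTop (𝓝 0))
    (hη : ∀ n, 0 < η n) (hanti : Antitone η) :
    Tendsto (fun n => μ (Set.Ioo (a + η n) (b - η n))) atTop (𝓝 (μ (Set.Ioo a b))) := by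
  have hU : ⋃ n, Set.Ioo (a + η n) (b - η n) = Set.Ioo a b := by
    ext x
    rw [Set.mem_iUnion]
    constructor
    · rintro ⟨n, hn⟩
      exact ⟨by linarith [hn.1, hη n], by linarith [hn.2, hη n]⟩
    · intro hx
      have hpos : 0 < min (x - a) (b - x) := lt_min (by linarith [hx.1]) (by linarith [hx.2])
      obtain ⟨n, hn⟩ := (h0.eventually_lt_const hpos).exists
      exact ⟨n, by linarith [hn.trans_le (min_le_left _ _)],
        by linarith [hn.trans_le (min_le_right _ _)]⟩
  have hm : Monotone fun n => Set.Ioo (a + η n) (b - η n) := fun m n hmn =>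
    Set.Ioo_subset_Ioo (by linarith [hanti hmn]) (by linarith [hanti hmn])
  rw [← hU]
  exact tendsto_measure_iUnion_atTop hm

/-- A family of probability measures whose Poisson integrals depend measurably on the parameter is
measurable. -/
theorem measurable_of_measurable_poisson {Ω : Type*} [MeasurableSpace Ω] {m : Ω → Measure ℝ}
    [∀ ω, IsProbabilityMeasure (m ω)]
    (h : ∀ η l : ℝ, 0 < η → Measurable fun ω => ∫ x, poisson η l x ∂(m ω)) : Measurable m := by
  set η : ℕ → ℝ := fun n => 1 / ((n : ℝ) + 1) with hηdef
  have hη : ∀ n, 0 < η n := fun n => by positivity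
  have h0 : Tendsto η atTop (𝓝 0) := tendsto_one_div_add_atTop_nhds_zero_nat
  have hanti : Antitone η := fun m n hmn => by
    refine one_div_le_one_div_of_le (by positivity) ?_
    have : (m : ℝ) ≤ n := by exact_mod_cast hmn
    linarith
  have hL : ∀ a b : ℝ, a ≤ b →
      Measurable fun ω => ∫⁻ x, ENNReal.ofReal (poissonLimit a b x) ∂(m ω) := by
    intro a b hab
    refine measurable_of_tendsto_metrizable
      (f := fun n ω => ∫⁻ l in Set.Icc a b, ∫⁻ x, ENNReal.ofReal (poisson (η n) l x) ∂(m ω))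
      (fun n => ?_)
      (tendsto_pi_nhds.2 fun ω => tendsto_lintegral_poisson (m ω) hη h0 hab)
    have hj : Measurable (Function.uncurry fun (l : ℝ) ω => ∫ x, poisson (η n) l x ∂(m ω)) :=
      measurable_uncurry_of_continuous_of_measurable
        (fun ω => continuous_integral_poisson (m ω) (hη n)) fun l => h (η n) l (hη n)
    simp_rw [lintegral_poisson_eq _ (hη n)]
    have hj' : Measurable fun p : Ω × ℝ => ENNReal.ofReal (∫ x, poisson (η n) p.2 x ∂(m p.1)) :=
      (hj.comp measurable_swap).ennreal_ofReal
    exact hj'.lintegral_prod_right'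
  refine Measurable.measure_of_isPiSystem_of_isProbabilityMeasure
    (BorelSpace.measurable_eq.trans Real.borel_eq_generateFrom_Ioo_rat) Real.isPiSystem_Ioo_rat ?_
  intro S hS
  simp only [Set.mem_iUnion, Set.mem_singleton_iff] at hS
  obtain ⟨a, b, hab', rfl⟩ := hS
  have hab : (0 : ℝ) < (b - a) / 2 := by
    have : (a : ℝ) < b := by exact_mod_cast hab'
    linarith
  -- the measure of `(a, b)` is squeezed by the limits for the intervals `[a + δ n, b - δ n]`, whose
  -- end points are in order since `δ n ≤ (b - a) / 2`
  set δ : ℕ → ℝ := fun n => ((b : ℝ) - a) / 2 * η n with hδdef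
  have hδ : ∀ n, 0 < δ n := fun n => mul_pos hab (hη n)
  have hδ0 : Tendsto δ atTop (𝓝 0) := by
    have := h0.const_mul (((b : ℝ) - a) / 2)
    rwa [mul_zero] at this
  have hδanti : Antitone δ := fun i j hij => mul_le_mul_of_nonneg_left (hanti hij) hab.le
  have hδle : ∀ n, (a : ℝ) + δ n ≤ b - δ n := by
    intro n
    have h1 : η n ≤ 1 := by
      change 1 / ((n : ℝ) + 1) ≤ 1
      rw [div_le_one (by positivity)]
      linarith [(Nat.cast_nonneg n : (0 : ℝ) ≤ n)]
    have h2 : δ n ≤ ((b : ℝ) - a) / 2 := mul_le_of_le_one_right hab.le h1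
    linarith
  have hmeas : Measurable fun ω => ENNReal.ofReal Real.pi * m ω (Set.Ioo (a : ℝ) b) := by
    refine measurable_of_tendsto_metrizable (fun n => hL _ _ (hδle n))
      (tendsto_pi_nhds.2 fun ω => ?_)
    refine tendsto_of_tendsto_of_tendsto_of_le_of_le
      (ENNReal.Tendsto.const_mul (tendsto_measure_Ioo_shrink (m ω) hδ0 hδ hδanti)
        (Or.inr ENNReal.ofReal_ne_top))
      tendsto_const_nhds (fun n => le_lintegral_poissonLimit (m ω) _ _) fun n => ?_
    refine (lintegral_poissonLimit_le (m ω) (hδle n)).trans ?_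
    gcongr
    exact Set.Icc_subset_Ioo (by linarith [hδ n]) (by linarith [hδ n])
  have hpi : ENNReal.ofReal Real.pi ≠ 0 := by simpa using Real.pi_pos
  have e : (fun ω => m ω (Set.Ioo (a : ℝ) b))
      = fun ω => (ENNReal.ofReal Real.pi)⁻¹ *
        (ENNReal.ofReal Real.pi * m ω (Set.Ioo (a : ℝ) b)) := by
    ext ω
    rw [← mul_assoc, ENNReal.inv_mul_cancel hpi ENNReal.ofReal_ne_top, one_mul]
  rw [e]
  exact hmeas.const_mul _

/-- A finite measure whose Poisson integrals are bounded below by `c` on `[-D, D]`, uniformly in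
the distance to the real axis, is bounded below by `c / π` times Lebesgue measure on intervals. -/
theorem mul_volume_le_of_poisson {c D : ℝ}
    (h : ∀ η l : ℝ, 0 < η → η ≤ 1 → l ∈ Set.Icc (-D) D →
      ENNReal.ofReal c ≤ ∫⁻ x, ENNReal.ofReal (poisson η l x) ∂μ)
    {I : Set ℝ} (hI : I.OrdConnected) (hID : I ⊆ Set.Icc (-D) D) :
    ENNReal.ofReal (c / Real.pi) * volume I ≤ μ I := by
  have hIcc : ∀ a b : ℝ, a ≤ b → Set.Icc a b ⊆ Set.Icc (-D) D →
      ENNReal.ofReal (c / Real.pi) * volume (Set.Icc a b) ≤ μ (Set.Icc a b) := by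
    intro a b hab hD
    set η : ℕ → ℝ := fun n => 1 / ((n : ℝ) + 1) with hηdef
    have hη : ∀ n, 0 < η n := fun n => by positivity
    have hη1 : ∀ n, η n ≤ 1 := fun n => by
      change 1 / ((n : ℝ) + 1) ≤ 1
      rw [div_le_one (by positivity)]
      linarith [(Nat.cast_nonneg n : (0 : ℝ) ≤ n)]
    have h1 := (tendsto_lintegral_poisson μ hη tendsto_one_div_add_atTop_nhds_zero_nat hab)
    have h2 : ENNReal.ofReal c * volume (Set.Icc a b)
        ≤ ENNReal.ofReal Real.pi * μ (Set.Icc a b) := by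
      refine le_trans (ge_of_tendsto' h1 fun n => ?_) (lintegral_poissonLimit_le μ hab)
      rw [← setLIntegral_const]
      exact setLIntegral_mono' measurableSet_Icc fun l hl => h (η n) l (hη n) (hη1 n) (hD hl)
    rw [ENNReal.ofReal_div_of_pos Real.pi_pos, ENNReal.div_eq_inv_mul, mul_assoc]
    have hpi : ENNReal.ofReal Real.pi ≠ 0 := by simpa using Real.pi_pos
    rw [ENNReal.inv_mul_le_iff hpi ENNReal.ofReal_ne_top]
    exact h2
  -- inner regularity: a compact `K ⊆ I` lies in the closed interval `[inf K, sup K] ⊆ I`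
  rw [hI.measurableSet.measure_eq_iSup_isCompact, ENNReal.mul_iSup]
  refine iSup_le fun K => ?_
  rw [ENNReal.mul_iSup]
  refine iSup_le fun hKI => ?_
  rw [ENNReal.mul_iSup]
  refine iSup_le fun hK => ?_
  rcases K.eq_empty_or_nonempty with hK0 | hK0
  · simp [hK0]
  · have h1 : Set.Icc (sInf K) (sSup K) ⊆ I :=
      hI.out (hKI (hK.sInf_mem hK0)) (hKI (hK.sSup_mem hK0))
    have h2 : K ⊆ Set.Icc (sInf K) (sSup K) := fun x hx =>
      ⟨csInf_le hK.bddBelow hx, le_csSup hK.bddAbove hx⟩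
    obtain ⟨x, hx⟩ := hK0
    calc _ ≤ ENNReal.ofReal (c / Real.pi) * volume (Set.Icc (sInf K) (sSup K)) := by gcongr
      _ ≤ μ (Set.Icc (sInf K) (sSup K)) :=
          hIcc _ _ ((h2 hx).1.trans (h2 hx).2) (h1.trans hID)
      _ ≤ μ I := measure_mono h1

end Poisson

/-! ### The density of states -/

open ProbabilityTheory

section DensityOfStates

variable {d : ℕ} (t : ℝ)

/-- The spectral measure at the root is a probability measure whose Poisson integrals are the
imaginary parts of the Green function at the root. -/
theorem rootSpectralMeasure_spec (g : Vertex d → ℝ) :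
    IsProbabilityMeasure (rootSpectralMeasure d t g) ∧
      ∀ (η l : ℝ) (hη : 0 < η), ∫ x, poisson η l x ∂(rootSpectralMeasure d t g)
        = (rootGreen t (z := ⟨l, η⟩) hη.ne' g).im := by
  -- `hamiltonian d t g` is by definition `schroedinger (hopping d t) g`
  have hsa : IsSelfAdjointPMap (hamiltonian d t g) :=
    schroedinger_isSelfAdjoint (hopping_isSelfAdjoint t) g
  have hex : ∃ P : ProjectionValuedMeasure (L2 (Vertex d)), P.Resolves (hamiltonian d t g) :=
    ⟨spectralResolution hsa, spectralResolution_resolves hsa⟩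
  -- the resolution in the definition of the spectral measure is an arbitrary one, so its Stieltjes
  -- transform has to be computed for every resolution
  have e : rootSpectralMeasure d t g
      = hex.choose.scalarMeasure (lp.single 2 (root d) (1 : ℂ)) := by
    rw [rootSpectralMeasure, spectralMeasure, dif_pos hex]
  rw [e]
  refine ⟨⟨?_⟩, fun η l hη => ?_⟩
  · rw [ProjectionValuedMeasure.scalarMeasure_univ, lp.norm_single (by norm_num)]
    simp
  · have h1 := inner_resolvent_eq_integral hsa hex.choose_spec (z := ⟨l, η⟩) hη.ne'
      (lp.single 2 (root d) (1 : ℂ))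
    have h2 := green_eq_inner (hopping_isSelfAdjoint t) (z := ⟨l, η⟩) hη.ne' g (root d)
    rw [rootGreen, h2]
    refine Eq.trans ?_ (congrArg Complex.im h1).symm
    have hi : Integrable (fun x : ℝ => ((x : ℂ) - ⟨l, η⟩)⁻¹)
        (hex.choose.scalarMeasure (lp.single 2 (root d) (1 : ℂ))) :=
      Integrable.of_bound (by fun_prop) _ (Eventually.of_forall
        fun x => norm_inv_ofReal_sub_le (z := ⟨l, η⟩) hη.ne' x)
    simp_rw [← im_inv_ofReal_sub]
    exact integral_im hi

instance (g : Vertex d → ℝ) : IsProbabilityMeasure (rootSpectralMeasure d t g) :=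
  (rootSpectralMeasure_spec t g).1

theorem measurable_rootSpectralMeasure : Measurable (rootSpectralMeasure d t) := by
  refine measurable_of_measurable_poisson fun η l hη => ?_
  simp_rw [fun g => (rootSpectralMeasure_spec t g).2 η l hη]
  exact (Complex.continuous_im.comp (continuous_green (hopping_isSelfAdjoint t) _ _)).measurable

instance : IsProbabilityMeasure (potentialLaw d) := by
  unfold potentialLaw
  infer_instance

theorem measurable_update_prod (v : Vertex d) :
    Measurable fun p : (Vertex d → ℝ) × ℝ => Function.update p.1 v p.2 := by
  refine measurable_pi_iff.2 fun w => ?_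
  by_cases hw : w = v
  · subst hw
    simpa using measurable_snd
  · simp only [Function.update_of_ne hw]
    exact (measurable_pi_apply w).comp measurable_fst

/-- Resampling the potential at one vertex does not change the law. -/
theorem map_update_potentialLaw (v : Vertex d) :
    ((potentialLaw d).prod (gaussianReal 0 1)).map
      (fun p : (Vertex d → ℝ) × ℝ => Function.update p.1 v p.2) = potentialLaw d := by
  have hm := measurable_update_prod v
  refine Measure.eq_infinitePi _ fun s S hS => ?_
  rw [Measure.map_apply hm (MeasurableSet.pi s.countable_toSet fun i _ => hS i)]
  have hpre : (fun p : (Vertex d → ℝ) × ℝ => Function.update p.1 v p.2) ⁻¹' (Set.pi s S)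
      = (Set.pi (s.erase v) S) ×ˢ (if v ∈ s then S v else Set.univ) := by
    ext p
    simp only [Set.mem_preimage, Set.mem_pi, Finset.mem_coe, Set.mem_prod, Finset.mem_erase]
    constructor
    · intro h
      refine ⟨fun i hi => ?_, ?_⟩
      · have := h i hi.2
        rwa [Function.update_of_ne hi.1] at this
      · split_ifs with hv
        · have := h v hv
          rwa [Function.update_self] at this
        · trivial
    · rintro ⟨h1, h2⟩ i hi
      by_cases hiv : i = v
      · subst hiv
        rw [if_pos hi] at h2
        rwa [Function.update_self]
      · rw [Function.update_of_ne hiv]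
        exact h1 i ⟨hiv, hi⟩
  rw [hpre, Measure.prod_prod, potentialLaw, Measure.infinitePi_pi _ fun i _ => hS i]
  split_ifs with hv
  · rw [Finset.prod_erase_mul s _ hv]
  · rw [measure_univ, mul_one, Finset.erase_eq_of_notMem hv]

/-- Averaging over the potential includes an average over its value at one vertex. -/
theorem lintegral_potentialLaw_update (v : Vertex d) {f : (Vertex d → ℝ) → ℝ≥0∞}
    (hf : Measurable f) :
    ∫⁻ g, f g ∂(potentialLaw d)
      = ∫⁻ g, ∫⁻ s, f (Function.update g v s) ∂(gaussianReal 0 1) ∂(potentialLaw d) := by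
  have hm := measurable_update_prod v
  conv_lhs => rw [← map_update_potentialLaw v]
  rw [lintegral_map hf hm]
  exact lintegral_prod _ (hf.comp hm).aemeasurable

theorem gaussianPDF_le_one (x : ℝ) : gaussianPDF 0 1 x ≤ 1 := by
  rw [gaussianPDF, ← ENNReal.ofReal_one]
  refine ENNReal.ofReal_le_ofReal ?_
  rw [gaussianPDFReal]
  refine mul_le_one₀ (inv_le_one_of_one_le₀ ?_) (Real.exp_nonneg _) (Real.exp_le_one_iff.2 ?_)
  · rw [Real.one_le_sqrt]
    have := Real.pi_gt_three
    simp
    linarith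
  · have : 0 ≤ (x - 0) ^ 2 / (2 * ((1 : NNReal) : ℝ)) := by positivity
    rw [neg_div]
    linarith

theorem gaussianReal_Icc_le (a r : ℝ) :
    gaussianReal 0 1 (Set.Icc (a - r) (a + r)) ≤ ENNReal.ofReal (2 * r) := by
  rw [gaussianReal_apply 0 one_ne_zero]
  calc _ ≤ ∫⁻ _ in Set.Icc (a - r) (a + r), 1 :=
        setLIntegral_mono' measurableSet_Icc fun x _ => gaussianPDF_le_one x
    _ = ENNReal.ofReal (2 * r) := by
        rw [setLIntegral_one, Real.volume_Icc]
        congr 1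
        ring

theorem gaussianPDFReal_le_of_abs_le {x y : ℝ} (h : |x| ≤ y) :
    gaussianPDFReal 0 1 y ≤ gaussianPDFReal 0 1 x := by
  rw [gaussianPDFReal, gaussianPDFReal]
  refine mul_le_mul_of_nonneg_left (Real.exp_le_exp.2 ?_) (by positivity)
  have h1 : x ^ 2 ≤ y ^ 2 := sq_le_sq' (by linarith [neg_abs_le x]) ((le_abs_self x).trans h)
  rw [neg_div, neg_div, sub_zero, sub_zero]
  gcongr

/-- The Gaussian average of a Poisson kernel is bounded below, uniformly as long as its pole stays
in a bounded part of the upper half-plane. -/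
theorem le_lintegral_poisson_gaussianReal {K : ℝ} {w : ℂ} (hw : 0 < w.im) (hK : ‖w‖ ≤ K) :
    ENNReal.ofReal (gaussianPDFReal 0 1 (2 * K) / 2)
      ≤ ∫⁻ s, ENNReal.ofReal (poisson w.im w.re s) ∂(gaussianReal 0 1) := by
  have hc : Continuous fun s => poisson w.im w.re s :=
    (continuous_poisson hw).comp (by fun_prop : Continuous fun s : ℝ => (w.re, s))
  have hre := (Complex.abs_re_le_norm w).trans hK
  have him := (Complex.abs_im_le_norm w).trans hK
  rw [abs_le] at hre him
  have hρ : 0 ≤ gaussianPDFReal 0 1 (2 * K) := gaussianPDFReal_nonneg _ _ _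
  rw [gaussianReal_of_var_ne_zero 0 one_ne_zero,
    lintegral_withDensity_eq_lintegral_mul _ (measurable_gaussianPDF 0 1)
      hc.measurable.ennreal_ofReal]
  -- on `[Re w, Re w + Im w]`, an interval inside `[-2 K, 2 K]`, the kernel is at least
  -- `1 / (2 Im w)`
  calc ENNReal.ofReal (gaussianPDFReal 0 1 (2 * K) / 2)
      = ∫⁻ _ in Set.Icc w.re (w.re + w.im),
          ENNReal.ofReal (gaussianPDFReal 0 1 (2 * K) * (1 / (2 * w.im))) := by
        rw [setLIntegral_const, Real.volume_Icc, ← ENNReal.ofReal_mul (by positivity)]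
        congr 1
        field_simp
        ring
    _ ≤ ∫⁻ s in Set.Icc w.re (w.re + w.im),
          (gaussianPDF 0 1 * fun s => ENNReal.ofReal (poisson w.im w.re s)) s := by
        refine setLIntegral_mono' measurableSet_Icc fun s hs => ?_
        rw [Pi.mul_apply, gaussianPDF, ← ENNReal.ofReal_mul (gaussianPDFReal_nonneg _ _ _)]
        refine ENNReal.ofReal_le_ofReal (mul_le_mul ?_ ?_ (by positivity)
          (gaussianPDFReal_nonneg _ _ _))
        · exact gaussianPDFReal_le_of_abs_le (abs_le.2 ⟨by linarith [hs.1], by linarith [hs.2]⟩)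
        · rw [poisson, div_le_div_iff₀ (by positivity) (by positivity)]
          have h1 : (s - w.re) ^ 2 ≤ w.im ^ 2 :=
            sq_le_sq' (by linarith [hs.1]) (by linarith [hs.2])
          nlinarith
    _ ≤ _ := setLIntegral_le_lintegral _ _

variable {z : ℂ} (hz : 0 < z.im)

/-- The Green function of a branch has a weak-type bound uniform in the spectral parameter: as a
function of the potential at the root of the branch, its inverse is a translation. -/
theorem potentialLaw_lt_norm_branchGreen_le (i : Fin d) {M : ℝ} (hM : 0 < M) :
    potentialLaw d {g | M < ‖branchGreen t hz.ne' i g‖} ≤ ENNReal.ofReal (2 / M) := by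
  have hc : Continuous fun g => ‖branchGreen t hz.ne' i g‖ :=
    (continuous_green (branchHopping_isSelfAdjoint t i) hz.ne' (child i)).norm
  have hS : MeasurableSet {g | M < ‖branchGreen t hz.ne' i g‖} :=
    measurableSet_lt measurable_const hc.measurable
  rw [← lintegral_indicator_one hS,
    lintegral_potentialLaw_update (child i) (measurable_one.indicator hS)]
  calc _ ≤ ∫⁻ _ : Vertex d → ℝ, ENNReal.ofReal (2 / M) ∂(potentialLaw d) := by
        refine lintegral_mono fun g => ?_
        set F := branchGreen t hz.ne' i g with hF
        -- `M < |F(s)|` confines `F(s)⁻¹ = F⁻¹ + s - g(child i)` to a disc of radius `1 / M`, and so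
        -- `s` to an interval of length `2 / M`
        have hsub : ∀ s : ℝ, M < ‖branchGreen t hz.ne' i (Function.update g (child i) s)‖ →
            s ∈ Set.Icc ((g (child i) - F⁻¹.re) - 1 / M) ((g (child i) - F⁻¹.re) + 1 / M) := by
          intro s hs
          have h1 := inv_green_update (branchHopping_isSelfAdjoint t i) hz.ne' hz g (child i) s
          change (branchGreen t hz.ne' i (Function.update g (child i) s))⁻¹ = F⁻¹ + _ at h1
          have h2 : ‖F⁻¹ + ((s - g (child i) : ℝ) : ℂ)‖ ≤ 1 / M := by
            rw [← h1, norm_inv, one_div]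
            exact inv_anti₀ hM hs.le
          have h3 := (Complex.abs_re_le_norm _).trans h2
          rw [Complex.add_re, Complex.ofReal_re, abs_le] at h3
          exact ⟨by linarith [h3.1], by linarith [h3.2]⟩
        calc _ ≤ ∫⁻ s, (Set.Icc ((g (child i) - F⁻¹.re) - 1 / M)
              ((g (child i) - F⁻¹.re) + 1 / M)).indicator 1 s ∂(gaussianReal 0 1) := by
              refine lintegral_mono fun s => ?_
              by_cases hs : M < ‖branchGreen t hz.ne' i (Function.update g (child i) s)‖
              · rw [Set.indicator_of_mem (hsub s hs), Set.indicator_of_mem (by exact hs)]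
                rfl
              · rw [Set.indicator_of_notMem (by exact hs)]
                exact zero_le
          _ ≤ ENNReal.ofReal (2 / M) := by
              rw [lintegral_indicator_one measurableSet_Icc]
              refine (gaussianReal_Icc_le _ _).trans (le_of_eq ?_)
              congr 1
              ring
    _ = ENNReal.ofReal (2 / M) := by rw [lintegral_const, measure_univ, mul_one]

/-- With probability at least one half all branch Green functions are bounded by `4 d`: each of the
`d` branches violates the bound with probability at most `2 / (4 d)`. -/
theorem half_le_potentialLaw_norm_branchGreen_le (hd : 0 < d) :
    (1 / 2 : ℝ≥0∞) ≤ potentialLaw d {g | ∀ i, ‖branchGreen t hz.ne' i g‖ ≤ 4 * d} := by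
  have hd' : (0 : ℝ) < d := by exact_mod_cast hd
  have hS : MeasurableSet {g : Vertex d → ℝ | ∀ i, ‖branchGreen t hz.ne' i g‖ ≤ 4 * d} := by
    simp only [Set.ofPred_forall]
    refine MeasurableSet.iInter fun i => measurableSet_le (Continuous.measurable ?_)
      measurable_const
    exact (continuous_green (branchHopping_isSelfAdjoint t i) hz.ne' (child i)).norm
  have hcompl : potentialLaw d {g | ∀ i, ‖branchGreen t hz.ne' i g‖ ≤ 4 * d}ᶜ ≤ 1 / 2 := by
    have e : {g : Vertex d → ℝ | ∀ i, ‖branchGreen t hz.ne' i g‖ ≤ 4 * d}ᶜ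
        = ⋃ i, {g | 4 * (d : ℝ) < ‖branchGreen t hz.ne' i g‖} := by
      ext g
      simp
    rw [e]
    calc _ ≤ ∑ i : Fin d, potentialLaw d {g | 4 * (d : ℝ) < ‖branchGreen t hz.ne' i g‖} :=
          measure_iUnion_fintype_le _ _
      _ ≤ ∑ _ : Fin d, ENNReal.ofReal (2 / (4 * d)) :=
          Finset.sum_le_sum fun i _ => potentialLaw_lt_norm_branchGreen_le t hz i (by positivity)
      _ = 1 / 2 := by
          rw [Finset.sum_const, Finset.card_univ, Fintype.card_fin, nsmul_eq_mul,
            ← ENNReal.ofReal_natCast, ← ENNReal.ofReal_mul hd'.le]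
          have e2 : (d : ℝ) * (2 / (4 * d)) = 1 / 2 := by
            field_simp
            norm_num
          rw [e2, ENNReal.ofReal_div_of_pos two_pos]
          simp
  have h1 := measure_add_measure_compl (μ := potentialLaw d) hS
  rw [measure_univ] at h1
  by_contra hlt
  rw [not_le] at hlt
  have h2 := ENNReal.add_lt_add_of_lt_of_le (ne_top_of_le_ne_top (by simp) hcompl) hlt hcompl
  rw [h1, ENNReal.add_halves] at h2
  exact lt_irrefl _ h2

/-- As a function of the potential at the root alone, the imaginary part of the Green function at
the root is a Poisson kernel with pole at `z + t² ∑ F_i`. -/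
theorem rootGreen_update_root (g : Vertex d → ℝ) (s : ℝ) :
    (rootGreen t hz.ne' (Function.update g (root d) s)).im
      = poisson (z + t ^ 2 * ∑ i, branchGreen t hz.ne' i g).im
        (z + t ^ 2 * ∑ i, branchGreen t hz.ne' i g).re s := by
  have h1 := rootGreen_mul t hz.ne' (Function.update g (root d) s)
  simp_rw [branchGreen_update_root] at h1
  rw [Function.update_self] at h1
  rw [← im_inv_ofReal_sub, eq_inv_of_mul_eq_one_left h1]

theorem im_self_energy_pos (g : Vertex d → ℝ) :
    0 < (z + t ^ 2 * ∑ i, branchGreen t hz.ne' i g).im := by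
  have h1 : 0 ≤ (∑ i, branchGreen t hz.ne' i g).im := by
    rw [Complex.im_sum]
    exact Finset.sum_nonneg fun i _ =>
      (im_green_pos (branchHopping_isSelfAdjoint t i) hz.ne' hz g (child i)).le
  rw [Complex.add_im, ← Complex.ofReal_pow, Complex.im_ofReal_mul]
  positivity

/-- The averaged Green function at the root has imaginary part bounded below, uniformly as long as
the spectral parameter stays bounded. -/
theorem le_lintegral_im_rootGreen (hd : 0 < d) {C : ℝ} (hC : ‖z‖ ≤ C) :
    ENNReal.ofReal (gaussianPDFReal 0 1 (2 * (C + t ^ 2 * (d * (4 * d)))) / 4)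
      ≤ ∫⁻ g, ENNReal.ofReal (rootGreen t hz.ne' g).im ∂(potentialLaw d) := by
  set ρ := gaussianPDFReal 0 1 (2 * (C + t ^ 2 * (d * (4 * d)))) with hρ
  have hρ0 : 0 ≤ ρ := gaussianPDFReal_nonneg _ _ _
  have hm : Measurable fun g => ENNReal.ofReal (rootGreen t hz.ne' (d := d) g).im :=
    (Complex.continuous_im.comp (continuous_green (hopping_isSelfAdjoint t) hz.ne'
      (root d))).measurable.ennreal_ofReal
  set S := {g : Vertex d → ℝ | ∀ i, ‖branchGreen t hz.ne' i g‖ ≤ 4 * d} with hSdef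
  have hS : MeasurableSet S := by
    simp only [hSdef, Set.ofPred_forall]
    refine MeasurableSet.iInter fun i => measurableSet_le (Continuous.measurable ?_)
      measurable_const
    exact (continuous_green (branchHopping_isSelfAdjoint t i) hz.ne' (child i)).norm
  -- the pole `z + t² ∑ F_i` does not depend on the potential at the root, and on the event `S` it
  -- is bounded by `C + t² d (4 d)`
  rw [lintegral_potentialLaw_update (root d) hm]
  calc ENNReal.ofReal (ρ / 4) = ENNReal.ofReal (ρ / 2) * (1 / 2) := by
        rw [show ρ / 4 = ρ / 2 * (1 / 2) by ring, ENNReal.ofReal_mul (by positivity),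
          ENNReal.ofReal_div_of_pos two_pos]
        simp
    _ ≤ ENNReal.ofReal (ρ / 2) * potentialLaw d S := by
        gcongr
        exact half_le_potentialLaw_norm_branchGreen_le t hz hd
    _ = ∫⁻ _ in S, ENNReal.ofReal (ρ / 2) ∂(potentialLaw d) := (setLIntegral_const _ _).symm
    _ ≤ ∫⁻ g in S, ∫⁻ s, ENNReal.ofReal (rootGreen t hz.ne' (Function.update g (root d) s)).im
          ∂(gaussianReal 0 1) ∂(potentialLaw d) := by
        refine setLIntegral_mono' hS fun g hg => ?_
        simp_rw [rootGreen_update_root t hz g]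
        refine le_lintegral_poisson_gaussianReal (im_self_energy_pos t hz g) ?_
        refine (norm_add_le _ _).trans (add_le_add hC ?_)
        rw [norm_mul, norm_pow, Complex.norm_real, Real.norm_eq_abs, sq_abs]
        gcongr
        refine (norm_sum_le _ _).trans ((Finset.sum_le_sum fun i _ => hg i).trans ?_)
        simp
    _ ≤ _ := setLIntegral_le_lintegral _ _

instance : IsProbabilityMeasure (densityOfStates d t) := by
  constructor
  rw [densityOfStates, Measure.bind_apply MeasurableSet.univ
    (measurable_rootSpectralMeasure t).aemeasurable]
  simp

/-- The Poisson integrals of the density of states at `l + i η` are averages of the imaginary part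
of the Green function, hence bounded below for bounded `l` and `η ≤ 1`. -/
theorem le_lintegral_poisson_densityOfStates (hd : 0 < d) {D η l : ℝ} (hη : 0 < η) (hη1 : η ≤ 1)
    (hl : l ∈ Set.Icc (-D) D) :
    ENNReal.ofReal (gaussianPDFReal 0 1 (2 * ((D + 1) + t ^ 2 * (d * (4 * d)))) / 4)
      ≤ ∫⁻ x, ENNReal.ofReal (poisson η l x) ∂(densityOfStates d t) := by
  have hpm : Measurable fun x => ENNReal.ofReal (poisson η l x) :=
    ((continuous_poisson hη).comp
      (by fun_prop : Continuous fun x : ℝ => (l, x))).measurable.ennreal_ofReal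
  rw [densityOfStates, Measure.lintegral_bind (measurable_rootSpectralMeasure t).aemeasurable
    hpm.aemeasurable]
  simp_rw [fun g => lintegral_poisson_eq (rootSpectralMeasure d t g) hη l,
    fun g => (rootSpectralMeasure_spec t g).2 η l hη]
  refine le_lintegral_im_rootGreen (z := ⟨l, η⟩) t hη hd ?_
  refine (Complex.norm_le_abs_re_add_abs_im _).trans ?_
  exact add_le_add (abs_le.2 hl) ((abs_of_pos hη).le.trans hη1)

end DensityOfStates

end BetheDOS

theorem lemma6p2 (d : ℕ) (hd : 3 ≤ d) (t : ℝ) (ht : 0 < t) (D : ℝ) (hD : 0 < D) :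
    ∃ c : ℝ, 0 < c ∧ ∀ I : Set ℝ, I.OrdConnected → I ⊆ Set.Icc (-D) D →
      ENNReal.ofReal c * volume I ≤ BetheDOS.densityOfStates d t I := by
  have hd0 : 0 < d := by omega
  refine ⟨ProbabilityTheory.gaussianPDFReal 0 1 (2 * ((D + 1) + t ^ 2 * (d * (4 * d)))) / 4
    / Real.pi, ?_, fun I hI hID => ?_⟩
  · have := ProbabilityTheory.gaussianPDFReal_pos 0 1
      (2 * ((D + 1) + t ^ 2 * (d * (4 * d)))) one_ne_zero
    positivity
  · exact BetheDOS.mul_volume_le_of_poisson _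
      (fun η l hη hη1 hl => BetheDOS.le_lintegral_poisson_densityOfStates t hd0 hη hη1 hl) hI hID
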